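/- **The meta-logic.** $FO\lambda^{\Delta\mathbb N}$ is an intuitionistic sequent calculus. Its terms are simply typed $\lambda$-terms, identified up to $\alpha\beta\eta$-conversion. Its formulas are built from atoms with $\bot,\top,\land,\lor,\supset$ and $\forall_\tau,\exists_\tau$, where $\tau$ is a simple type not containing the type $o$ of formulas. Its sequents are $\Gamma\longrightarrow B$ with $\Gamma$ a finite multiset of formulas. It has * the usual left and right rules for the connectives and quantifiers, contraction on the left, cut, and the initial rule $A,\Gamma\longrightarrow A$ for atomic $A$; * for the predicate $\mathit{nat}$ on the type $nt$ (with constants $z:nt$ and $s:nt\to nt$): $\Gamma\longrightarrow \mathit{nat}\,z$; from $\Gamma\longrightarrow\mathit{nat}\,I$ infer $\Gamma\longrightarrow \mathit{nat}\,(s\,I)$; and from $\longrightarrow B\,z$, $\;B\,j\longrightarrow B\,(s\,j)$ ($j$ a new eigenvariable) and $B\,I,\Gamma\longrightarrow C$ infer $\mathit{nat}\,I,\Gamma\longrightarrow C$; * for the other predicates, relative to a definition (a set of clauses $\forall\bar x[p\,\bar t\triangleq B]$ in which every free variable of $B$ is free in $p\,\bar t$, stratified by levels so that the level of $B$ is at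 most that of $p$): from $\Gamma\longrightarrow B\theta$ infer $\Gamma\longrightarrow p\,\bar u$ if $p\,\bar u=(p\,\bar t)\theta$ for some clause; and infer $p\,\bar u,\Gamma\longrightarrow C$ from all the premises $B\theta,\Gamma\theta\longrightarrow C\theta$, where $\forall\bar x[p\,\bar t\triangleq B]$ ranges over the clauses and $\theta$ over a complete set of unifiers of $p\,\bar u$ and $p\,\bar t$. **The definition $\mathcal D$.** Besides $nt$ the primitive types are $i$ (object-level terms and types), $atm$, $prp$ and $atmlst$. The constants are $\mathit{nil}:atmlst$ and $::$ of type $atm\to atmlst\to atmlst$; $\langle\cdot\rangle:atm\to prp$, $tt:prp$, $\&:prp\to prp\to prp$, $\Rightarrow:atm\to prp\to prp$, $\bigwedge:(i\to prp)\to prp$; $\mathit{abs}:(i\to i)\to i$, $\mathit{app},\mathit{arr}:i\to i\to i$, $\mathit{gnd}:i$; and $\mathit{typeof},\Downarrow,\leadsto,\leadsto^*:i\to i\to atm$. Capital letters are universally quantified, and a clause written without $\triangleq$ has body $\top$. The clauses of $\mathcal D$ are: * natural numbers: $I=I$; $\;\mathit{sum}\,z\,J\,J\triangleq \mathit{nat}\,J$;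 $\;\mathit{sum}\,(s\,I)\,J\,(s\,K)\triangleq\mathit{sum}\,I\,J\,K$; $\;z<s\,J\triangleq\mathit{nat}\,J$; $\;s\,I<s\,J\triangleq I<J$; $\;I\le I$; $\;I\le J\triangleq I<J$; * lists: $\mathit{length}\,\mathit{nil}\,z$; $\;\mathit{length}\,(X::L)\,(s\,I)\triangleq\mathit{length}\,L\,I$; $\;\mathit{list}\,L\triangleq\exists i(\mathit{nat}\,i\land\mathit{length}\,L\,i)$; $\;\mathit{element}\,X\,(X::L)$; $\;\mathit{element}\,X\,(Y::L)\triangleq\mathit{element}\,X\,L$; $\;\mathit{split}\,\mathit{nil}\,\mathit{nil}\,\mathit{nil}$; $\;\mathit{split}\,(X::L_1)\,(X::L_2)\,L_3\triangleq\mathit{split}\,L_1\,L_2\,L_3$; $\;\mathit{split}\,(X::L_1)\,L_2\,(X::L_3)\triangleq\mathit{split}\,L_1\,L_2\,L_3$; $\;\mathit{permute}\,\mathit{nil}\,\mathit{nil}$; $\;\mathit{permute}\,(X::L_1)\,L_2\triangleq\exists l(\mathit{split}\,L_2\,(X::\mathit{nil})\,l\land\mathit{permute}\,L_1\,l)$;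 * intuitionistic object logic: $\mathit{seq}\,I\,(A'::L)\,\langle A\rangle\triangleq\mathit{element}\,A\,(A'::L)$; $\;\mathit{seq}\,I\,L\,tt$; $\;\mathit{seq}\,(s\,I)\,L\,(B\,\&\,C)\triangleq\mathit{seq}\,I\,L\,B\land\mathit{seq}\,I\,L\,C$; $\;\mathit{seq}\,(s\,I)\,L\,(A\Rightarrow B)\triangleq\mathit{seq}\,I\,(A::L)\,B$; $\;\mathit{seq}\,(s\,I)\,L\,(\bigwedge B)\triangleq\forall x\,\mathit{seq}\,I\,L\,(B\,x)$; $\;\mathit{seq}\,(s\,I)\,L\,\langle A\rangle\triangleq\exists b(\mathit{prog}\,A\,b\land\mathit{seq}\,I\,L\,b)$; * untyped $\lambda$-calculus: $\mathit{prog}\,(\mathit{typeof}\,(\mathit{abs}\,R)\,(\mathit{arr}\,T\,U))\,(\bigwedge n(\mathit{typeof}\,n\,T\Rightarrow\langle\mathit{typeof}\,(R\,n)\,U\rangle))$; $\;\mathit{prog}\,(\mathit{typeof}\,(\mathit{app}\,M\,N)\,T)\,(\langle\mathit{typeof}\,M\,(\mathit{arr}\,U\,T)\rangle\,\&\,\langle\mathit{typeof}\,N\,U\rangle)$;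 $\;\mathit{prog}\,(\mathit{abs}\,R\Downarrow\mathit{abs}\,R)\,tt$; $\;\mathit{prog}\,(\mathit{app}\,M\,N\Downarrow V)\,(\langle M\Downarrow\mathit{abs}\,R\rangle\,\&\,\langle R\,N\Downarrow V\rangle)$; $\;\mathit{prog}\,(\mathit{app}\,(\mathit{abs}\,R)\,M\leadsto R\,M)\,tt$; $\;\mathit{prog}\,(\mathit{app}\,M\,N\leadsto\mathit{app}\,M'\,N)\,\langle M\leadsto M'\rangle$; $\;\mathit{prog}\,(M\leadsto^*M)\,tt$; $\;\mathit{prog}\,(M\leadsto^*N)\,(\langle M\leadsto M'\rangle\,\&\,\langle M'\leadsto^*N\rangle)$; * $X\equiv X$, for $\equiv$ on type $i$. Write $\rhd A$ for $\exists j(\mathit{nat}\,j\land\mathit{seq}\,j\,\mathit{nil}\,\langle A\rangle)$. **Theorem.** The following formulas are derivable in $FO\lambda^{\Delta\mathbb N}$ with the definition $\mathcal D$. Determinacy of semantics: $$\forall m\forall m_1\forall m_2(\rhd(m\Downarrow m_1)\supset\rhd(m\Downarrow m_2)\supset m_1\equiv m_2)$$ $$\forall m\forall m_1\forall m_2(\rhd(m\leadsto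 m_1)\supset\rhd(m\leadsto m_2)\supset m_1\equiv m_2)$$ $$\forall m\forall r_1\forall r_2(\rhd(m\leadsto^*\mathit{abs}\,r_1)\supset\rhd(m\leadsto^*\mathit{abs}\,r_2)\supset \mathit{abs}\,r_1\equiv\mathit{abs}\,r_2)$$ Equivalence of semantics: $$\forall m\forall r(\rhd(m\Downarrow\mathit{abs}\,r)\supset\rhd(m\leadsto^*\mathit{abs}\,r))$$ $$\forall m\forall r(\rhd(m\leadsto^*\mathit{abs}\,r)\supset\rhd(m\Downarrow\mathit{abs}\,r))$$ Subject reduction: $$\forall m\forall n(\rhd(m\Downarrow n)\supset\forall t(\rhd(\mathit{typeof}\,m\,t)\supset\rhd(\mathit{typeof}\,n\,t)))$$ $$\forall m\forall n(\rhd(m\leadsto n)\supset\forall t(\rhd(\mathit{typeof}\,m\,t)\supset\rhd(\mathit{typeof}\,n\,t)))$$ $$\forall m\forall n(\rhd(m\leadsto^* n)\supset\forall t(\rhd(\mathit{typeof}\,m\,t)\supset\rhd(\mathit{typeof}\,n\,t)))$$ -/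

import Mathlib

namespace FOLDN

/-! ## Types, variables and constants -/

/-- Primitive types (other than the type of formulas): natural numbers, terms of the object
logic, and atoms, propositions and lists of atoms of the object logic. -/
inductive Base : Type
  | nt | i | atm | prp | atmlst

/-- Simple types not containing the type of formulas. -/
inductive Ty : Type
  | base (b : Base)
  | fn (a b : Ty)

abbrev nt : Ty := .base .nt
abbrev ι : Ty := .base .i
abbrev atm : Ty := .base .atm
abbrev prp : Ty := .base .prp
abbrev atmlst : Ty := .base .atmlst

infixr:60 " →ₜ " => Ty.fn

/-- A context lists the types of the variables that may occur free. -/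
abbrev Ctx : Type := List Ty

/-- Typed de Bruijn variables: positions in a context. -/
inductive Var : Ctx → Ty → Type
  | z {Γ : Ctx} {a : Ty} : Var (a :: Γ) a
  | s {Γ : Ctx} {a b : Ty} (x : Var Γ a) : Var (b :: Γ) a

/-- The term constants with their types. -/
inductive Const : Ty → Type
  | zero : Const nt
  | succ : Const (nt →ₜ nt)
  | nil : Const atmlst
  | cons : Const (atm →ₜ atmlst →ₜ atmlst)
  /-- the coercion from atoms to propositions -/
  | atom : Const (atm →ₜ prp)
  | tt : Const prp
  | conj : Const (prp →ₜ prp →ₜ prp)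
  | impl : Const (atm →ₜ prp →ₜ prp)
  /-- object-level universal quantification at type `i` -/
  | forallI : Const ((ι →ₜ prp) →ₜ prp)
  | abs : Const ((ι →ₜ ι) →ₜ ι)
  | app : Const (ι →ₜ ι →ₜ ι)
  | gnd : Const ι
  | arr : Const (ι →ₜ ι →ₜ ι)
  | typeof : Const (ι →ₜ ι →ₜ atm)
  /-- big-step evaluation `⇓` -/
  | natsem : Const (ι →ₜ ι →ₜ atm)
  /-- one-step evaluation `⇝` -/
  | transone : Const (ι →ₜ ι →ₜ atm)
  /-- multi-step evaluation `⇝*` -/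
  | transsem : Const (ι →ₜ ι →ₜ atm)

/-! ## Simply typed λ-terms -/

/-- Simply typed λ-terms before βη-identification. -/
inductive Raw : Ctx → Ty → Type
  | var {Γ : Ctx} {a : Ty} (x : Var Γ a) : Raw Γ a
  | const {Γ : Ctx} {a : Ty} (c : Const a) : Raw Γ a
  | lam {Γ : Ctx} {a b : Ty} (t : Raw (a :: Γ) b) : Raw Γ (a →ₜ b)
  | app {Γ : Ctx} {a b : Ty} (t : Raw Γ (a →ₜ b)) (u : Raw Γ a) : Raw Γ b

abbrev Ren (Γ Δ : Ctx) : Type := ∀ a : Ty, Var Γ a → Var Δ a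

abbrev RawSubst (Γ Δ : Ctx) : Type := ∀ a : Ty, Var Γ a → Raw Δ a

def Ren.lift {Γ Δ : Ctx} (ρ : Ren Γ Δ) {b : Ty} : Ren (b :: Γ) (b :: Δ)
  | _, .z => .z
  | _, .s x => .s (ρ _ x)

def Ren.wk {Γ : Ctx} {b : Ty} : Ren Γ (b :: Γ) := fun _ x => .s x

def Raw.rename {Γ Δ : Ctx} {a : Ty} (ρ : Ren Γ Δ) : Raw Γ a → Raw Δ a
  | .var x => .var (ρ _ x)
  | .const c => .const c
  | .lam t => .lam (t.rename ρ.lift)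
  | .app t u => .app (t.rename ρ) (u.rename ρ)

def RawSubst.lift {Γ Δ : Ctx} (σ : RawSubst Γ Δ) {b : Ty} : RawSubst (b :: Γ) (b :: Δ)
  | _, .z => .var .z
  | _, .s x => (σ _ x).rename Ren.wk

/-- Simultaneous capture-avoiding substitution. -/
def Raw.subst {Γ Δ : Ctx} {a : Ty} (σ : RawSubst Γ Δ) : Raw Γ a → Raw Δ a
  | .var x => σ _ x
  | .const c => .const c
  | .lam t => .lam (t.subst σ.lift)
  | .app t u => .app (t.subst σ) (u.subst σ)

def RawSubst.single {Γ : Ctx} {b : Ty} (u : Raw Γ b) : RawSubst (b :: Γ) Γ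
  | _, .z => u
  | _, .s x => .var x

/-- βη-conversion. -/
inductive Conv : ∀ {Γ : Ctx} {a : Ty}, Raw Γ a → Raw Γ a → Prop
  | refl {Γ : Ctx} {a : Ty} (t : Raw Γ a) : Conv t t
  | symm {Γ : Ctx} {a : Ty} {t u : Raw Γ a} : Conv t u → Conv u t
  | trans {Γ : Ctx} {a : Ty} {t u v : Raw Γ a} : Conv t u → Conv u v → Conv t v
  | app {Γ : Ctx} {a b : Ty} {t t' : Raw Γ (a →ₜ b)} {u u' : Raw Γ a} :
      Conv t t' → Conv u u' → Conv (.app t u) (.app t' u')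
  | lam {Γ : Ctx} {a b : Ty} {t t' : Raw (a :: Γ) b} : Conv t t' → Conv (.lam t) (.lam t')
  | beta {Γ : Ctx} {a b : Ty} (t : Raw (a :: Γ) b) (u : Raw Γ a) :
      Conv (.app (.lam t) u) (t.subst (.single u))
  | eta {Γ : Ctx} {a b : Ty} (t : Raw Γ (a →ₜ b)) :
      Conv (.lam (.app (t.rename Ren.wk) (.var .z))) t

theorem Raw.rename_rename {Γ : Ctx} {a : Ty} (t : Raw Γ a) : ∀ {Δ Θ : Ctx}
    (ρ : Ren Γ Δ) (ρ' : Ren Δ Θ),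
    (t.rename ρ).rename ρ' = t.rename (fun b x => ρ' b (ρ b x)) := by
  induction t with
  | var x => intros; rfl
  | const c => intros; rfl
  | lam t ih =>
    intro Δ Θ ρ ρ'
    simp only [Raw.rename, ih]
    congr 2; funext b x; cases x <;> rfl
  | app t u iht ihu => intro Δ Θ ρ ρ'; simp only [Raw.rename, iht, ihu]

theorem Raw.subst_rename {Γ : Ctx} {a : Ty} (t : Raw Γ a) : ∀ {Δ Θ : Ctx}
    (ρ : Ren Γ Δ) (σ : RawSubst Δ Θ),
    (t.rename ρ).subst σ = t.subst (fun b x => σ b (ρ b x)) := by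
  induction t with
  | var x => intros; rfl
  | const c => intros; rfl
  | lam t ih =>
    intro Δ Θ ρ σ
    simp only [Raw.rename, Raw.subst, ih]
    congr 2; funext b x; cases x <;> rfl
  | app t u iht ihu => intro Δ Θ ρ σ; simp only [Raw.rename, Raw.subst, iht, ihu]

theorem Raw.rename_subst {Γ : Ctx} {a : Ty} (t : Raw Γ a) : ∀ {Δ Θ : Ctx}
    (σ : RawSubst Γ Δ) (ρ : Ren Δ Θ),
    (t.subst σ).rename ρ = t.subst (fun b x => (σ b x).rename ρ) := by
  induction t with
  | var x => intros; rfl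
  | const c => intros; rfl
  | lam t ih =>
    intro Δ Θ σ ρ
    simp only [Raw.rename, Raw.subst, ih]
    congr 2; funext b x
    cases x with
    | z => rfl
    | s x => simp only [RawSubst.lift, Raw.rename_rename]; rfl
  | app t u iht ihu => intro Δ Θ σ ρ; simp only [Raw.rename, Raw.subst, iht, ihu]

theorem Raw.subst_subst {Γ : Ctx} {a : Ty} (t : Raw Γ a) : ∀ {Δ Θ : Ctx}
    (σ : RawSubst Γ Δ) (σ' : RawSubst Δ Θ),
    (t.subst σ).subst σ' = t.subst (fun b x => (σ b x).subst σ') := by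
  induction t with
  | var x => intros; rfl
  | const c => intros; rfl
  | lam t ih =>
    intro Δ Θ σ σ'
    simp only [Raw.subst, ih]
    congr 2; funext b x
    cases x with
    | z => rfl
    | s x => simp only [RawSubst.lift, Raw.subst_rename, Raw.rename_subst]; rfl
  | app t u iht ihu => intro Δ Θ σ σ'; simp only [Raw.subst, iht, ihu]

theorem Raw.subst_var {Γ : Ctx} {a : Ty} (t : Raw Γ a) : t.subst (fun _ x => .var x) = t := by
  induction t with
  | var x => rfl
  | const c => rfl
  | @lam Γ a b t ih =>
    simp only [Raw.subst]
    congr 1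
    refine Eq.trans ?_ ih
    congr 1; funext b x; cases x <;> rfl
  | app t u iht ihu => simp only [Raw.subst, iht, ihu]

theorem Conv.rename {Γ : Ctx} {a : Ty} {t u : Raw Γ a} (h : Conv t u) :
    ∀ {Δ : Ctx} (ρ : Ren Γ Δ), Conv (t.rename ρ) (u.rename ρ) := by
  induction h with
  | refl t => exact fun ρ => .refl _
  | symm _ ih => exact fun ρ => .symm (ih ρ)
  | trans _ _ ih ih' => exact fun ρ => .trans (ih ρ) (ih' ρ)
  | app _ _ ih ih' => exact fun ρ => .app (ih ρ) (ih' ρ)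
  | lam _ ih => exact fun ρ => .lam (ih _)
  | beta t u =>
    intro Δ ρ
    have h := Conv.beta (t.rename ρ.lift) (u.rename ρ)
    rw [Raw.subst_rename] at h
    rw [Raw.rename_subst]
    refine cast (congrArg (Conv _) (congrArg (fun τ => Raw.subst τ t) ?_)) h
    funext b x; cases x <;> rfl
  | eta t =>
    intro Δ ρ
    have h := Conv.eta (t.rename ρ)
    rw [Raw.rename_rename] at h
    simp only [Raw.rename, Raw.rename_rename]
    exact h

theorem Conv.subst {Γ : Ctx} {a : Ty} {t u : Raw Γ a} (h : Conv t u) :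
    ∀ {Δ : Ctx} (σ : RawSubst Γ Δ), Conv (t.subst σ) (u.subst σ) := by
  induction h with
  | refl t => exact fun σ => .refl _
  | symm _ ih => exact fun σ => .symm (ih σ)
  | trans _ _ ih ih' => exact fun σ => .trans (ih σ) (ih' σ)
  | app _ _ ih ih' => exact fun σ => .app (ih σ) (ih' σ)
  | lam _ ih => exact fun σ => .lam (ih _)
  | beta t u =>
    intro Δ σ
    have h := Conv.beta (t.subst σ.lift) (u.subst σ)
    rw [Raw.subst_subst] at h
    rw [Raw.subst_subst]
    refine cast (congrArg (Conv _) (congrArg (fun τ => Raw.subst τ t) ?_)) h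
    funext b x
    cases x with
    | z => rfl
    | s x =>
      simp only [RawSubst.lift, RawSubst.single, Raw.subst_rename, Raw.subst]
      exact Raw.subst_var _
  | eta t =>
    intro Δ σ
    have h := Conv.eta (t.subst σ)
    rw [Raw.rename_subst] at h
    simp only [Raw.subst, Raw.subst_rename]
    exact h

theorem Conv.subst_congr {Γ : Ctx} {a : Ty} (t : Raw Γ a) : ∀ {Δ : Ctx} {σ σ' : RawSubst Γ Δ},
    (∀ b x, Conv (σ b x) (σ' b x)) → Conv (t.subst σ) (t.subst σ') := by
  induction t with
  | var x => exact fun h => h _ x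
  | const c => exact fun _ => .refl _
  | lam t ih =>
    intro Δ σ σ' h
    refine .lam (ih fun b x => ?_)
    cases x with
    | z => exact .refl _
    | s x => exact (h _ x).rename _
  | app t u iht ihu => exact fun h => .app (iht h) (ihu h)

instance Raw.setoid (Γ : Ctx) (a : Ty) : Setoid (Raw Γ a) :=
  ⟨Conv, Conv.refl, Conv.symm, Conv.trans⟩

/-- Terms: simply typed λ-terms, identified up to α-, β- and η-conversion. -/
def Tm (Γ : Ctx) (a : Ty) : Type := Quotient (Raw.setoid Γ a)

namespace Tm

def mk {Γ : Ctx} {a : Ty} (t : Raw Γ a) : Tm Γ a := Quotient.mk _ t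

def var {Γ : Ctx} {a : Ty} (x : Var Γ a) : Tm Γ a := mk (.var x)

def const {Γ : Ctx} {a : Ty} (c : Const a) : Tm Γ a := mk (.const c)

def lam {Γ : Ctx} {a b : Ty} : Tm (a :: Γ) b → Tm Γ (a →ₜ b) :=
  Quotient.map Raw.lam fun _ _ h => Conv.lam h

def app {Γ : Ctx} {a b : Ty} : Tm Γ (a →ₜ b) → Tm Γ a → Tm Γ b :=
  Quotient.map₂ Raw.app fun _ _ h _ _ h' => Conv.app h h'

def rename {Γ Δ : Ctx} {a : Ty} (ρ : Ren Γ Δ) : Tm Γ a → Tm Δ a :=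
  Quotient.map (Raw.rename ρ) fun _ _ h => Conv.rename h ρ

/-- Weakening by one variable. -/
def wk {Γ : Ctx} {a b : Ty} (t : Tm Γ a) : Tm (b :: Γ) a := t.rename Ren.wk

end Tm

/-- Substitutions of terms for variables. -/
abbrev Subst (Γ Δ : Ctx) : Type := ∀ a : Ty, Var Γ a → Tm Δ a

/-- Application of a substitution to a term. The result does not depend on the chosen
representatives, see `Tm.subst_mk`. -/
noncomputable def Tm.subst {Γ Δ : Ctx} {a : Ty} (θ : Subst Γ Δ) : Tm Γ a → Tm Δ a :=
  Quotient.map (Raw.subst fun b x => Quotient.out (θ b x)) fun _ _ h => Conv.subst h _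

theorem Tm.subst_mk {Γ Δ : Ctx} {a : Ty} (σ : RawSubst Γ Δ) (t : Raw Γ a) :
    (Tm.mk t).subst (fun b x => Tm.mk (σ b x)) = Tm.mk (t.subst σ) :=
  Quotient.sound (Conv.subst_congr t fun b x => Quotient.mk_out (σ b x))

namespace Subst

def lift {Γ Δ : Ctx} (θ : Subst Γ Δ) {b : Ty} : Subst (b :: Γ) (b :: Δ)
  | _, .z => .var .z
  | _, .s x => (θ _ x).wk

/-- `θ.comp σ` applies first `θ`, then `σ`. -/
noncomputable def comp {Γ Δ Θ : Ctx} (θ : Subst Γ Δ) (σ : Subst Δ Θ) : Subst Γ Θ :=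
  fun a x => (θ a x).subst σ

/-- The weakening substitution. -/
def weak {Γ : Ctx} {b : Ty} : Subst Γ (b :: Γ) := fun _ x => .var (.s x)

/-- Replace the most recent variable by `t`. -/
def single {Γ : Ctx} {b : Ty} (t : Tm Γ b) : Subst (b :: Γ) Γ
  | _, .z => t
  | _, .s x => .var x

/-- Replace the most recent variable `j` by `s j`. -/
def succ {Γ : Ctx} : Subst (nt :: Γ) (nt :: Γ)
  | _, .z => .app (.const .succ) (.var .z)
  | _, .s x => .var (.s x)

end Subst

/-! ## Predicates and formulas -/

/-- The predicate constants with their argument types; `nat` is not among them, since it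
is not a defined predicate and has its own inference rules. -/
inductive Pred : List Ty → Type
  | eq : Pred [nt, nt]
  | sum : Pred [nt, nt, nt]
  | lt : Pred [nt, nt]
  | le : Pred [nt, nt]
  | length : Pred [atmlst, nt]
  | list : Pred [atmlst]
  | element : Pred [atm, atmlst]
  | split : Pred [atmlst, atmlst, atmlst]
  | permute : Pred [atmlst, atmlst]
  | seq : Pred [nt, atmlst, prp]
  | prog : Pred [atm, prp]
  /-- the predicate `≡` -/
  | same : Pred [ι, ι]

/-- Lists of arguments. -/
inductive Args (Γ : Ctx) : List Ty → Type
  | nil : Args Γ []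
  | cons {a : Ty} {as : List Ty} (t : Tm Γ a) (ts : Args Γ as) : Args Γ (a :: as)

noncomputable def Args.subst {Γ Δ : Ctx} (θ : Subst Γ Δ) : ∀ {as : List Ty}, Args Γ as → Args Δ as
  | _, .nil => .nil
  | _, .cons t ts => .cons (t.subst θ) (ts.subst θ)

/-- Formulas of the meta-logic with free variables in a context. -/
inductive Form : Ctx → Type
  | bot {Γ : Ctx} : Form Γ
  | top {Γ : Ctx} : Form Γ
  | and {Γ : Ctx} (B C : Form Γ) : Form Γ
  | or {Γ : Ctx} (B C : Form Γ) : Form Γ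
  | imp {Γ : Ctx} (B C : Form Γ) : Form Γ
  | all {Γ : Ctx} (a : Ty) (B : Form (a :: Γ)) : Form Γ
  | ex {Γ : Ctx} (a : Ty) (B : Form (a :: Γ)) : Form Γ
  | nat {Γ : Ctx} (t : Tm Γ nt) : Form Γ
  | pred {Γ : Ctx} {as : List Ty} (p : Pred as) (ts : Args Γ as) : Form Γ

infixr:35 " ∧ₘ " => Form.and
infixr:25 " ⊃ₘ " => Form.imp

namespace Form

noncomputable def subst : ∀ {Γ Δ : Ctx}, Subst Γ Δ → Form Γ → Form Δ
  | _, _, _, .bot => .bot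
  | _, _, _, .top => .top
  | _, _, θ, .and B C => .and (B.subst θ) (C.subst θ)
  | _, _, θ, .or B C => .or (B.subst θ) (C.subst θ)
  | _, _, θ, .imp B C => .imp (B.subst θ) (C.subst θ)
  | _, _, θ, .all a B => .all a (B.subst θ.lift)
  | _, _, θ, .ex a B => .ex a (B.subst θ.lift)
  | _, _, θ, .nat t => .nat (t.subst θ)
  | _, _, θ, .pred p ts => .pred p (ts.subst θ)

/-- Weakening by one variable. -/
noncomputable def wk {Γ : Ctx} {b : Ty} (B : Form Γ) : Form (b :: Γ) := B.subst Subst.weak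

/-- `B[t/x]` for the most recent variable `x`. -/
noncomputable def inst {Γ : Ctx} {b : Ty} (B : Form (b :: Γ)) (t : Tm Γ b) : Form Γ :=
  B.subst (Subst.single t)

/-- Atomic formulas. -/
def IsAtomic {Γ : Ctx} : Form Γ → Prop
  | .nat _ => True
  | .pred _ _ => True
  | _ => False

end Form

/-! ## Definitions -/

/-- The variable `x` occurs free in a λ-term. -/
def Raw.Occurs : ∀ {Γ : Ctx} {a b : Ty}, Var Γ b → Raw Γ a → Prop
  | Γ, a, b, x, .var y => (⟨b, x⟩ : Σ c, Var Γ c) = ⟨a, y⟩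
  | _, _, _, _, .const _ => False
  | _, _, _, x, .lam t => t.Occurs (.s x)
  | _, _, _, x, .app t u => t.Occurs x ∨ u.Occurs x

/-- The variable `x` is free in the term `t`: it occurs free in every representative of `t`
(equivalently, in its normal form). -/
def Tm.Free {Γ : Ctx} {a b : Ty} (x : Var Γ b) (t : Tm Γ a) : Prop :=
  ∀ r : Raw Γ a, Tm.mk r = t → r.Occurs x

def Args.Free {Γ : Ctx} {b : Ty} (x : Var Γ b) : ∀ {as : List Ty}, Args Γ as → Prop
  | _, .nil => False
  | _, .cons t ts => t.Free x ∨ ts.Free x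

def Form.Free : ∀ {Γ : Ctx} {b : Ty}, Var Γ b → Form Γ → Prop
  | _, _, _, .bot => False
  | _, _, _, .top => False
  | _, _, x, .and B C => B.Free x ∨ C.Free x
  | _, _, x, .or B C => B.Free x ∨ C.Free x
  | _, _, x, .imp B C => B.Free x ∨ C.Free x
  | _, _, x, .all _ B => B.Free (.s x)
  | _, _, x, .ex _ B => B.Free (.s x)
  | _, _, x, .nat t => t.Free x
  | _, _, x, .pred _ ts => ts.Free x

/-- An assignment of levels to the predicates. -/
structure Levels where
  nat : ℕ
  pred : ∀ {as : List Ty}, Pred as → ℕ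

/-- The level of a formula. -/
def Form.level (ℓ : Levels) : ∀ {Γ : Ctx}, Form Γ → ℕ
  | _, .bot => 0
  | _, .top => 0
  | _, .and B C => max (B.level ℓ) (C.level ℓ)
  | _, .or B C => max (B.level ℓ) (C.level ℓ)
  | _, .imp B C => max (B.level ℓ + 1) (C.level ℓ)
  | _, .all _ B => B.level ℓ
  | _, .ex _ B => B.level ℓ
  | _, .nat _ => ℓ.nat
  | _, .pred p _ => ℓ.pred p

/-- Definitional clauses `∀ x̄ [p t̄ ≜ B]`; `vars` lists the types of the variables `x̄`. -/
structure Clause where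
  vars : Ctx
  {arity : List Ty}
  pred : Pred arity
  args : Args vars arity
  body : Form vars

/-- The head of a clause. -/
def Clause.head (c : Clause) : Form c.vars := .pred c.pred c.args

/-- A set of clauses is a definition if free variables of bodies are free in the heads, and
levels can be assigned to the predicates so that no body has a higher level than its head. -/
structure Definition where
  clauses : Set Clause
  free_head : ∀ c ∈ clauses, ∀ (a : Ty) (x : Var c.vars a), c.body.Free x → c.head.Free x
  stratified : ∃ ℓ : Levels, ∀ c ∈ clauses, c.body.level ℓ ≤ c.head.level ℓ

/-! ## The derivation rules -/

/-- Unifiers of two formulas whose free variables are taken to be disjoint: a substitution for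
the variables of either formula, with a common range, that makes the formulas equal. -/
structure Unifier {Γ Δ : Ctx} (A : Form Γ) (H : Form Δ) where
  cod : Ctx
  left : Subst Γ cod
  right : Subst Δ cod
  eq : A.subst left = H.subst right

/-- Complete sets of unifiers: every unifier is an instance of one in the set. -/
def IsCSU {Γ Δ : Ctx} {A : Form Γ} {H : Form Δ} (S : Set (Unifier A H)) : Prop :=
  ∀ ρ : Unifier A H, ∃ θ ∈ S, ∃ σ : Subst θ.cod ρ.cod,
    ρ.left = θ.left.comp σ ∧ ρ.right = θ.right.comp σ

/-- `Der D V Γ B`: the sequent `Γ ⟶ B`, whose free variables are in the context `V`, is derivable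
with the definition `D`. A new eigenvariable extends the context by one variable, and
the formulas of the lower sequent are weakened accordingly. -/
inductive Der (D : Definition) : ∀ V : Ctx, Multiset (Form V) → Form V → Prop
  | botL {V : Ctx} {Γ : Multiset (Form V)} {B : Form V} : Der D V (.bot ::ₘ Γ) B
  | topR {V : Ctx} {Γ : Multiset (Form V)} : Der D V Γ .top
  | andL₁ {V : Ctx} {Γ : Multiset (Form V)} {B C E : Form V} :
      Der D V (B ::ₘ Γ) E → Der D V (.and B C ::ₘ Γ) E
  | andL₂ {V : Ctx} {Γ : Multiset (Form V)} {B C E : Form V} :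
      Der D V (C ::ₘ Γ) E → Der D V (.and B C ::ₘ Γ) E
  | andR {V : Ctx} {Γ : Multiset (Form V)} {B C : Form V} :
      Der D V Γ B → Der D V Γ C → Der D V Γ (.and B C)
  | orL {V : Ctx} {Γ : Multiset (Form V)} {B C E : Form V} :
      Der D V (B ::ₘ Γ) E → Der D V (C ::ₘ Γ) E → Der D V (.or B C ::ₘ Γ) E
  | orR₁ {V : Ctx} {Γ : Multiset (Form V)} {B C : Form V} :
      Der D V Γ B → Der D V Γ (.or B C)
  | orR₂ {V : Ctx} {Γ : Multiset (Form V)} {B C : Form V} :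
      Der D V Γ C → Der D V Γ (.or B C)
  | impL {V : Ctx} {Γ : Multiset (Form V)} {B C E : Form V} :
      Der D V Γ B → Der D V (C ::ₘ Γ) E → Der D V (.imp B C ::ₘ Γ) E
  | impR {V : Ctx} {Γ : Multiset (Form V)} {B C : Form V} :
      Der D V (B ::ₘ Γ) C → Der D V Γ (.imp B C)
  | allL {V : Ctx} {Γ : Multiset (Form V)} {a : Ty} {B : Form (a :: V)} {C : Form V} (t : Tm V a) :
      Der D V (B.inst t ::ₘ Γ) C → Der D V (.all a B ::ₘ Γ) C
  | allR {V : Ctx} {Γ : Multiset (Form V)} {a : Ty} {B : Form (a :: V)} :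
      Der D (a :: V) (Γ.map Form.wk) B → Der D V Γ (.all a B)
  | exL {V : Ctx} {Γ : Multiset (Form V)} {a : Ty} {B : Form (a :: V)} {C : Form V} :
      Der D (a :: V) (B ::ₘ Γ.map Form.wk) C.wk → Der D V (.ex a B ::ₘ Γ) C
  | exR {V : Ctx} {Γ : Multiset (Form V)} {a : Ty} {B : Form (a :: V)} (t : Tm V a) :
      Der D V Γ (B.inst t) → Der D V Γ (.ex a B)
  | init {V : Ctx} {Γ : Multiset (Form V)} {A : Form V} : A.IsAtomic → Der D V (A ::ₘ Γ) A
  | contr {V : Ctx} {Γ : Multiset (Form V)} {B C : Form V} :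
      Der D V (B ::ₘ B ::ₘ Γ) C → Der D V (B ::ₘ Γ) C
  | cut {V : Ctx} {Δ Γ : Multiset (Form V)} {B C : Form V} :
      Der D V Δ B → Der D V (B ::ₘ Γ) C → Der D V (Δ + Γ) C
  | natR_zero {V : Ctx} {Γ : Multiset (Form V)} : Der D V Γ (.nat (.const .zero))
  | natR_succ {V : Ctx} {Γ : Multiset (Form V)} {t : Tm V nt} :
      Der D V Γ (.nat t) → Der D V Γ (.nat (.app (.const .succ) t))
  /-- induction with the invariant `B`; in the second premise the most recent variable is the
  eigenvariable `j`, and the right-hand side is `B (s j)` -/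
  | natL {V : Ctx} {Γ : Multiset (Form V)} {C : Form V} {t : Tm V nt} (B : Form (nt :: V)) :
      Der D V 0 (B.inst (.const .zero)) →
      Der D (nt :: V) {B} (B.subst Subst.succ) →
      Der D V (B.inst t ::ₘ Γ) C → Der D V (.nat t ::ₘ Γ) C
  | defR {V : Ctx} {Γ : Multiset (Form V)} {as : List Ty} {p : Pred as} {us : Args V as}
      (c : Clause) (_ : c ∈ D.clauses) (θ : Subst c.vars V) :
      Form.pred p us = c.head.subst θ → Der D V Γ (c.body.subst θ) → Der D V Γ (.pred p us)
  /-- definitional reflection: one premise for every clause and every element of some complete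
  set of unifiers of the atom with the head of the clause -/
  | defL {V : Ctx} {Γ : Multiset (Form V)} {C : Form V} {as : List Ty} {p : Pred as} {us : Args V as}
      (S : ∀ c : Clause, Set (Unifier (Form.pred p us) c.head)) :
      (∀ c ∈ D.clauses, IsCSU (S c)) →
      (∀ c ∈ D.clauses, ∀ θ ∈ S c,
        Der D θ.cod (c.body.subst θ.right ::ₘ Γ.map (Form.subst θ.left)) (C.subst θ.left)) →
      Der D V (.pred p us ::ₘ Γ) C

/-- A closed formula is derivable with the definition `D`. -/
def Derivable (D : Definition) (B : Form []) : Prop := Der D [] 0 B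

/-! ## Notation for terms and atomic formulas -/

section
variable {Γ : Ctx}

def zero : Tm Γ nt := .const .zero
def succ (t : Tm Γ nt) : Tm Γ nt := .app (.const .succ) t
def nil : Tm Γ atmlst := .const .nil
def cons (x : Tm Γ atm) (l : Tm Γ atmlst) : Tm Γ atmlst := .app (.app (.const .cons) x) l
def atom (x : Tm Γ atm) : Tm Γ prp := .app (.const .atom) x
def tt : Tm Γ prp := .const .tt
def conj (b c : Tm Γ prp) : Tm Γ prp := .app (.app (.const .conj) b) c
def impl (x : Tm Γ atm) (b : Tm Γ prp) : Tm Γ prp := .app (.app (.const .impl) x) b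
def forallI (b : Tm Γ (ι →ₜ prp)) : Tm Γ prp := .app (.const .forallI) b
def abs (r : Tm Γ (ι →ₜ ι)) : Tm Γ ι := .app (.const .abs) r
def app (m n : Tm Γ ι) : Tm Γ ι := .app (.app (.const .app) m) n
def gnd : Tm Γ ι := .const .gnd
def arr (t u : Tm Γ ι) : Tm Γ ι := .app (.app (.const .arr) t) u
def typeof (m t : Tm Γ ι) : Tm Γ atm := .app (.app (.const .typeof) m) t
def natsem (m n : Tm Γ ι) : Tm Γ atm := .app (.app (.const .natsem) m) n
def transone (m n : Tm Γ ι) : Tm Γ atm := .app (.app (.const .transone) m) n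
def transsem (m n : Tm Γ ι) : Tm Γ atm := .app (.app (.const .transsem) m) n

abbrev Args.one {a : Ty} (t : Tm Γ a) : Args Γ [a] := .cons t .nil
abbrev Args.two {a b : Ty} (t : Tm Γ a) (u : Tm Γ b) : Args Γ [a, b] := .cons t (.one u)
abbrev Args.three {a b c : Ty} (t : Tm Γ a) (u : Tm Γ b) (v : Tm Γ c) : Args Γ [a, b, c] :=
  .cons t (.two u v)

def lt (t u : Tm Γ nt) : Form Γ := .pred .lt (.two t u)
def sum (t u v : Tm Γ nt) : Form Γ := .pred .sum (.three t u v)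
def length (l : Tm Γ atmlst) (t : Tm Γ nt) : Form Γ := .pred .length (.two l t)
def element (x : Tm Γ atm) (l : Tm Γ atmlst) : Form Γ := .pred .element (.two x l)
def split (l l₁ l₂ : Tm Γ atmlst) : Form Γ := .pred .split (.three l l₁ l₂)
def permute (l₁ l₂ : Tm Γ atmlst) : Form Γ := .pred .permute (.two l₁ l₂)
def seq (t : Tm Γ nt) (l : Tm Γ atmlst) (b : Tm Γ prp) : Form Γ := .pred .seq (.three t l b)
def prog (x : Tm Γ atm) (b : Tm Γ prp) : Form Γ := .pred .prog (.two x b)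
def same (m n : Tm Γ ι) : Form Γ := .pred .same (.two m n)

/-- `L ⊳ B`, that is, `∃ i (nat i ∧ seq i L B)`. -/
def prvv (l : Tm Γ atmlst) (b : Tm Γ prp) : Form Γ :=
  .ex nt (.nat (.var .z) ∧ₘ seq (.var .z) l.wk b.wk)

/-- `⊳ ⟨A⟩`: the object-level atom `A` is provable from no assumptions. -/
def prv (x : Tm Γ atm) : Form Γ := prvv nil (atom x)

end

/-- The variables of a context, counted from the most recent one. -/
abbrev v0 {Γ : Ctx} {a : Ty} : Tm (a :: Γ) a := .var .z
abbrev v1 {Γ : Ctx} {a b : Ty} : Tm (b :: a :: Γ) a := .var (.s .z)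
abbrev v2 {Γ : Ctx} {a b c : Ty} : Tm (c :: b :: a :: Γ) a := .var (.s (.s .z))
abbrev v3 {Γ : Ctx} {a b c d : Ty} : Tm (d :: c :: b :: a :: Γ) a := .var (.s (.s (.s .z)))

/-! ## The clauses -/

/-- Clauses for predicates over natural numbers. -/
def clausesNat : List Clause :=
  [ -- I = I
    ⟨[nt], .eq, .two v0 v0, .top⟩,
    -- variables: J
    ⟨[nt], .sum, .three zero v0 v0, .nat v0⟩,
    -- variables: K, J, I
    ⟨[nt, nt, nt], .sum, .three (succ v2) v1 (succ v0), sum v2 v1 v0⟩,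
    -- variables: J
    ⟨[nt], .lt, .two zero (succ v0), .nat v0⟩,
    -- variables: J, I
    ⟨[nt, nt], .lt, .two (succ v1) (succ v0), lt v1 v0⟩,
    ⟨[nt], .le, .two v0 v0, .top⟩,
    -- variables: J, I
    ⟨[nt, nt], .le, .two v1 v0, lt v1 v0⟩ ]

/-- Clauses for predicates over lists of atoms. -/
def clausesList : List Clause :=
  [ ⟨[], .length, .two nil zero, .top⟩,
    -- variables: I, L, X
    ⟨[nt, atmlst, atm], .length, .two (cons v2 v1) (succ v0), length v1 v0⟩,
    -- variables: L
    ⟨[atmlst], .list, .one v0, .ex nt (.nat v0 ∧ₘ length v1 v0)⟩,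
    -- variables: L, X
    ⟨[atmlst, atm], .element, .two v1 (cons v1 v0), .top⟩,
    -- variables: L, Y, X
    ⟨[atmlst, atm, atm], .element, .two v2 (cons v1 v0), element v2 v0⟩,
    ⟨[], .split, .three nil nil nil, .top⟩,
    -- variables: L₃, L₂, L₁, X
    ⟨[atmlst, atmlst, atmlst, atm], .split, .three (cons v3 v2) (cons v3 v1) v0, split v2 v1 v0⟩,
    ⟨[atmlst, atmlst, atmlst, atm], .split, .three (cons v3 v2) v1 (cons v3 v0), split v2 v1 v0⟩,
    ⟨[], .permute, .two nil nil, .top⟩,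
    -- variables: L₂, L₁, X; the bound variable of the body is `v0` there
    ⟨[atmlst, atmlst, atm], .permute, .two (cons v2 v1) v0,
      .ex atmlst (split v1 (cons v3 nil) v0 ∧ₘ permute v2 v0)⟩ ]

/-- Clauses for the intuitionistic object logic. -/
def clausesIntuit : List Clause :=
  [ -- variables: A, L, A', I
    ⟨[atm, atmlst, atm, nt], .seq, .three v3 (cons v2 v1) (atom v0), element v0 (cons v2 v1)⟩,
    -- variables: L, I
    ⟨[atmlst, nt], .seq, .three v1 v0 tt, .top⟩,
    -- variables: C, B, L, I
    ⟨[prp, prp, atmlst, nt], .seq, .three (succ v3) v2 (conj v1 v0), seq v3 v2 v1 ∧ₘ seq v3 v2 v0⟩,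
    -- variables: B, A, L, I
    ⟨[prp, atm, atmlst, nt], .seq, .three (succ v3) v2 (impl v1 v0), seq v3 (cons v1 v2) v0⟩,
    -- variables: B, L, I; the bound variable of the body is `v0` there
    ⟨[ι →ₜ prp, atmlst, nt], .seq, .three (succ v2) v1 (forallI v0),
      .all ι (seq v3 v2 (.app v1 v0))⟩,
    -- variables: A, L, I; the bound variable of the body is `v0` there
    ⟨[atm, atmlst, nt], .seq, .three (succ v2) v1 (atom v0),
      .ex prp (prog v1 v0 ∧ₘ seq v3 v2 v0)⟩ ]

/-- Clauses `prog A G ≜ ⊤` for typing and call-by-name evaluation of untyped λ-terms. -/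
def clausesLambda : List Clause :=
  [ -- variables: U, T, R; the bound variable of the goal is `v0` there
    ⟨[ι, ι, ι →ₜ ι], .prog, .two (typeof (abs v2) (arr v1 v0))
      (forallI (.lam (impl (typeof v0 v2) (atom (typeof (.app v3 v0) v1))))), .top⟩,
    -- variables: U, T, N, M
    ⟨[ι, ι, ι, ι], .prog, .two (typeof (app v3 v2) v1)
      (conj (atom (typeof v3 (arr v0 v1))) (atom (typeof v2 v0))), .top⟩,
    -- variables: R
    ⟨[ι →ₜ ι], .prog, .two (natsem (abs v0) (abs v0)) tt, .top⟩,
    -- variables: R, V, N, M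
    ⟨[ι →ₜ ι, ι, ι, ι], .prog, .two (natsem (app v3 v2) v1)
      (conj (atom (natsem v3 (abs v0))) (atom (natsem (.app v0 v2) v1))), .top⟩,
    -- variables: M, R
    ⟨[ι, ι →ₜ ι], .prog, .two (transone (app (abs v1) v0) (.app v1 v0)) tt, .top⟩,
    -- variables: M', N, M
    ⟨[ι, ι, ι], .prog, .two (transone (app v2 v1) (app v0 v1)) (atom (transone v2 v0)), .top⟩,
    -- variables: M
    ⟨[ι], .prog, .two (transsem v0 v0) tt, .top⟩,
    -- variables: M', N, M
    ⟨[ι, ι, ι], .prog, .two (transsem v2 v1)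
      (conj (atom (transone v2 v0)) (atom (transsem v0 v1))), .top⟩ ]

/-- The clause `X ≡ X ≜ ⊤`. -/
def clauseSame : Clause := ⟨[ι], .same, .two v0 v0, .top⟩

/-- All the clauses together. -/
def clausesAll : List Clause :=
  clausesNat ++ clausesList ++ clausesIntuit ++ clausesLambda ++ [clauseSame]

/-! ## The clauses form a definition

Free occurrences in the heads are detected by an interpretation of terms in the full type
structure over `ℕ`, which is invariant under conversion. -/

def Ty.Sem : Ty → Type
  | .base _ => ℕ
  | .fn a b => a.Sem → b.Sem

def Const.sem : ∀ {a : Ty}, Const a → a.Sem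
  | _, .zero => (0 : ℕ)
  | _, .succ => fun n : ℕ => n
  | _, .nil => (0 : ℕ)
  | _, .cons => fun m n : ℕ => m + n
  | _, .atom => fun n : ℕ => n
  | _, .tt => (0 : ℕ)
  | _, .conj => fun m n : ℕ => m + n
  | _, .impl => fun m n : ℕ => m + n
  | _, .forallI => fun f : ℕ → ℕ => f 0
  | _, .abs => fun f : ℕ → ℕ => f 0
  | _, .app => fun m n : ℕ => m + n
  | _, .gnd => (0 : ℕ)
  | _, .arr => fun m n : ℕ => m + n
  | _, .typeof => fun m n : ℕ => m + n
  | _, .natsem => fun m n : ℕ => m + n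
  | _, .transone => fun m n : ℕ => m + n
  | _, .transsem => fun m n : ℕ => m + n

abbrev Env (Γ : Ctx) : Type := ∀ a : Ty, Var Γ a → a.Sem

def Env.cons {Γ : Ctx} {b : Ty} (d : b.Sem) (e : Env Γ) : Env (b :: Γ)
  | _, .z => d
  | _, .s x => e _ x

def Raw.sem : ∀ {Γ : Ctx} {a : Ty}, Raw Γ a → Env Γ → a.Sem
  | _, _, .var x, e => e _ x
  | _, _, .const c, _ => c.sem
  | _, _, .lam t, e => fun d => t.sem (e.cons d)
  | _, _, .app t u, e => (t.sem e) (u.sem e)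

theorem Raw.sem_rename {Γ : Ctx} {a : Ty} (t : Raw Γ a) : ∀ {Δ : Ctx} (ρ : Ren Γ Δ) (e : Env Δ),
    (t.rename ρ).sem e = t.sem fun b x => e b (ρ b x) := by
  induction t with
  | var x => intros; rfl
  | const c => intros; rfl
  | lam t ih =>
    intro Δ ρ e
    simp only [Raw.rename, Raw.sem, ih]
    funext d; congr 1; funext b x; cases x <;> rfl
  | app t u iht ihu => intro Δ ρ e; simp only [Raw.rename, Raw.sem, iht, ihu]

theorem Raw.sem_subst {Γ : Ctx} {a : Ty} (t : Raw Γ a) :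
    ∀ {Δ : Ctx} (σ : RawSubst Γ Δ) (e : Env Δ),
    (t.subst σ).sem e = t.sem fun b x => (σ b x).sem e := by
  induction t with
  | var x => intros; rfl
  | const c => intros; rfl
  | lam t ih =>
    intro Δ σ e
    simp only [Raw.subst, Raw.sem, ih]
    funext d; congr 1; funext b x
    cases x with
    | z => rfl
    | s x => simp only [RawSubst.lift, Raw.sem_rename]; rfl
  | app t u iht ihu => intro Δ σ e; simp only [Raw.subst, Raw.sem, iht, ihu]

theorem Conv.sem_eq {Γ : Ctx} {a : Ty} {t u : Raw Γ a} (h : Conv t u) : t.sem = u.sem := by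
  induction h with
  | refl t => rfl
  | symm _ ih => exact ih.symm
  | trans _ _ ih ih' => exact ih.trans ih'
  | app _ _ ih ih' => funext e; simp only [Raw.sem, ih, ih']
  | lam _ ih => funext e d; exact congrFun ih _
  | beta t u =>
    funext e
    simp only [Raw.sem, Raw.sem_subst]
    congr 1; funext b x; cases x <;> rfl
  | eta t => funext e d; simp only [Raw.sem, Raw.sem_rename]; rfl

def Tm.sem {Γ : Ctx} {a : Ty} (t : Tm Γ a) : Env Γ → a.Sem :=
  Quotient.lift Raw.sem (fun _ _ h => Conv.sem_eq h) t

theorem Raw.sem_congr {Γ : Ctx} {a : Ty} (t : Raw Γ a) : ∀ {b : Ty} (x : Var Γ b),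
    ¬ t.Occurs x → ∀ e e' : Env Γ,
    (∀ c y, (⟨b, x⟩ : Σ c, Var Γ c) ≠ ⟨c, y⟩ → e c y = e' c y) → t.sem e = t.sem e' := by
  induction t with
  | var y => intro b x hx e e' h; exact h _ y hx
  | const c => intros; rfl
  | lam t ih =>
    intro b x hx e e' h
    funext d
    refine ih (.s x) hx _ _ fun c y hy => ?_
    cases y with
    | z => rfl
    | s y =>
      refine h c y fun hxy => hy ?_
      cases hxy; rfl
  | app t u iht ihu =>
    intro b x hx e e' h
    simp only [Raw.Occurs, not_or] at hx
    simp only [Raw.sem, iht x hx.1 e e' h, ihu x hx.2 e e' h]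

def Ty.dflt (n : ℕ) : ∀ a : Ty, a.Sem
  | .base _ => n
  | .fn _ b => fun _ => b.dflt n

/-- The environment that is `1` at `x` and `0` elsewhere. -/
def Env.ind {Γ : Ctx} {b : Ty} : Var Γ b → Env Γ
  | .z => Env.cons (Ty.dflt 1 _) fun c _ => c.dflt 0
  | .s x => Env.cons (Ty.dflt 0 _) (Env.ind x)

theorem Env.ind_ne {Γ : Ctx} {b : Ty} (x : Var Γ b) : ∀ (c : Ty) (y : Var Γ c),
    (⟨b, x⟩ : Σ c, Var Γ c) ≠ ⟨c, y⟩ → Env.ind x c y = c.dflt 0 := by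
  induction x with
  | z =>
    intro c y h
    cases y with
    | z => exact absurd rfl h
    | s y => rfl
  | s x ih =>
    intro c y h
    cases y with
    | z => rfl
    | s y =>
      refine ih c y fun hxy => h ?_
      cases hxy; rfl

theorem Tm.free_of_sem {Γ : Ctx} {a b : Ty} (x : Var Γ b) (t : Tm Γ a)
    (h : t.sem (Env.ind x) ≠ t.sem fun c _ => c.dflt 0) : t.Free x := by
  intro r hr
  by_contra hx
  subst hr
  exact h (r.sem_congr x hx _ _ (Env.ind_ne x))

theorem free_head_all : ∀ c ∈ clausesAll, ∀ (a : Ty) (x : Var c.vars a),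
    c.body.Free x → c.head.Free x := by
  simp only [clausesAll, clausesNat, clausesList, clausesIntuit, clausesLambda, clauseSame,
    List.cons_append, List.nil_append, List.forall_mem_cons, List.not_mem_nil]
  repeat' refine And.intro ?_ ?_
  all_goals intro c x h
  all_goals first
    | exact h.elim
    | (rcases x with _ | _ | _ | _ | x <;> first
        | exact Or.inl (Tm.free_of_sem _ _ fun h => Nat.one_ne_zero h)
        | exact Or.inr (Or.inl (Tm.free_of_sem _ _ fun h => Nat.one_ne_zero h))
        | exact Or.inr (Or.inr (Or.inl (Tm.free_of_sem _ _ fun h => Nat.one_ne_zero h)))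
        | cases x)

theorem level_all : ∀ c ∈ clausesAll,
    c.body.level ⟨0, fun _ => 0⟩ ≤ c.head.level ⟨0, fun _ => 0⟩ := by
  simp [clausesAll, clausesNat, clausesList, clausesIntuit, clausesLambda, clauseSame,
    Form.level, Clause.head, lt, sum, length, element, split, permute, seq, prog]

/-- The definition that accumulates the clauses above. -/
def lambdaDefinition : Definition where
  clauses := {c | c ∈ clausesAll}
  free_head := free_head_all
  stratified := ⟨⟨0, fun _ => 0⟩, level_all⟩

/-! ## The properties of the untyped λ-calculus

In each formula the variables bound by the outer quantifiers are, from left to right,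
`v2`, `v1`, `v0` (three quantifiers) or `v1`, `v0` (two quantifiers). -/

/-- `∀ m m₁ m₂ (⊳⟨m ⇓ m₁⟩ ⊃ ⊳⟨m ⇓ m₂⟩ ⊃ m₁ ≡ m₂)` -/
def natsemDet : Form [] :=
  .all ι (.all ι (.all ι
    (prv (natsem v2 v1) ⊃ₘ prv (natsem v2 v0) ⊃ₘ same v1 v0)))

/-- `∀ m m₁ m₂ (⊳⟨m ⇝ m₁⟩ ⊃ ⊳⟨m ⇝ m₂⟩ ⊃ m₁ ≡ m₂)` -/
def transoneDet : Form [] :=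
  .all ι (.all ι (.all ι
    (prv (transone v2 v1) ⊃ₘ prv (transone v2 v0) ⊃ₘ same v1 v0)))

/-- `∀ m r₁ r₂ (⊳⟨m ⇝* abs r₁⟩ ⊃ ⊳⟨m ⇝* abs r₂⟩ ⊃ abs r₁ ≡ abs r₂)` -/
def transsemDet : Form [] :=
  .all ι (.all (ι →ₜ ι) (.all (ι →ₜ ι)
    (prv (transsem v2 (abs v1)) ⊃ₘ prv (transsem v2 (abs v0)) ⊃ₘ same (abs v1) (abs v0))))

/-- `∀ m r (⊳⟨m ⇓ abs r⟩ ⊃ ⊳⟨m ⇝* abs r⟩)` -/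
def natsemToTranssem : Form [] :=
  .all ι (.all (ι →ₜ ι) (prv (natsem v1 (abs v0)) ⊃ₘ prv (transsem v1 (abs v0))))

/-- `∀ m r (⊳⟨m ⇝* abs r⟩ ⊃ ⊳⟨m ⇓ abs r⟩)` -/
def transsemToNatsem : Form [] :=
  .all ι (.all (ι →ₜ ι) (prv (transsem v1 (abs v0)) ⊃ₘ prv (natsem v1 (abs v0))))

/-- `∀ m n (⊳⟨m ⇓ n⟩ ⊃ ∀ t (⊳⟨typeof m t⟩ ⊃ ⊳⟨typeof n t⟩))` -/
def natsemSubjRed : Form [] :=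
  .all ι (.all ι
    (prv (natsem v1 v0) ⊃ₘ .all ι (prv (typeof v2 v0) ⊃ₘ prv (typeof v1 v0))))

/-- `∀ m n (⊳⟨m ⇝ n⟩ ⊃ ∀ t (⊳⟨typeof m t⟩ ⊃ ⊳⟨typeof n t⟩))` -/
def transoneSubjRed : Form [] :=
  .all ι (.all ι
    (prv (transone v1 v0) ⊃ₘ .all ι (prv (typeof v2 v0) ⊃ₘ prv (typeof v1 v0))))

/-- `∀ m n (⊳⟨m ⇝* n⟩ ⊃ ∀ t (⊳⟨typeof m t⟩ ⊃ ⊳⟨typeof n t⟩))` -/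
def transsemSubjRed : Form [] :=
  .all ι (.all ι
    (prv (transsem v1 v0) ⊃ₘ .all ι (prv (typeof v2 v0) ⊃ₘ prv (typeof v1 v0))))

end FOLDN

/-!
Eigenvariables and hypotheses of a sequent form a stage, and a formula is forced at a stage when it
is derivable there. Since derivability is stable under substitutions for the eigenvariables, each
left rule becomes an elimination principle quantifying over later stages; in the definition-left
rule the unifiers are such stages. One can therefore reason in the ambient logic about what is
forced, and formulas of the meta-logic are needed only as induction invariants.

Matching a clause of `D` against an atom requires that the term constructors be injective and
disjoint up to `αβη`-conversion. This is read off from normalization by evaluation, whose neutral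
terms separate the constructors.

The object logic admits cut, by induction on the height of the derivation of the hypothetical
judgement, with a bound on the height of the result that depends only on the two given heights; this
yields substitution for typing derivations. The eight properties follow by rule induction on
evaluation and reduction. For their equivalence, evaluation is closed under expansion along `⇝`; for
determinacy of `⇝*`, a reduction to a value passes through every one-step reduct, `⇝` being
deterministic.
-/

namespace FOLDN

/-! ## Substitution in terms and formulas -/

/-- The identity renaming. -/
abbrev Ren.id {Γ : Ctx} : Ren Γ Γ := fun _ x => x

/-- Composition of renamings in diagrammatic order, like `Subst.comp`. -/
abbrev Ren.comp {Γ Δ Θ : Ctx} (ρ : Ren Γ Δ) (ρ' : Ren Δ Θ) : Ren Γ Θ := fun _ x => ρ' _ (ρ _ x)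

/-- The identity substitution. -/
def Subst.id {Γ : Ctx} : Subst Γ Γ := fun _ x => .var x

/-- The extension of a substitution by a term for the most recent variable. -/
def Subst.cons {Γ Δ : Ctx} {b : Ty} (t : Tm Δ b) (θ : Subst Γ Δ) : Subst (b :: Γ) Δ
  | _, .z => t
  | _, .s x => θ _ x

/-- The unique substitution for the variables of the empty context. -/
def Subst.empty {Δ : Ctx} : Subst [] Δ := fun _ x => nomatch x

theorem Raw.rename_eq_subst {Γ : Ctx} {a : Ty} (t : Raw Γ a) : ∀ {Δ : Ctx} (ρ : Ren Γ Δ),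
    t.rename ρ = t.subst fun b x => .var (ρ b x) := by
  induction t with
  | var x => intros; rfl
  | const c => intros; rfl
  | lam t ih =>
    intro Δ ρ
    simp only [Raw.rename, Raw.subst, ih]
    congr 2; funext b x; cases x <;> rfl
  | app t u iht ihu => intro Δ ρ; simp only [Raw.rename, Raw.subst, iht, ihu]

theorem Tm.exists_eq_mk {Γ : Ctx} {a : Ty} (t : Tm Γ a) : ∃ r : Raw Γ a, t = Tm.mk r :=
  (Quotient.exists_rep t).imp fun _ => Eq.symm

theorem Subst.exists_eq_mk {Γ Δ : Ctx} (θ : Subst Γ Δ) :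
    ∃ σ : RawSubst Γ Δ, θ = fun b x => Tm.mk (σ b x) :=
  ⟨fun b x => (θ b x).out, by funext b x; exact (Quotient.out_eq _).symm⟩

namespace Tm

variable {Γ Δ Θ : Ctx} {a b : Ty}

@[simp] theorem subst_var (θ : Subst Γ Δ) (x : Var Γ a) : (Tm.var x).subst θ = θ a x :=
  Quotient.out_eq _

@[simp] theorem subst_const (θ : Subst Γ Δ) (c : Const a) :
    (Tm.const c : Tm Γ a).subst θ = Tm.const c := rfl

@[simp] theorem subst_app (θ : Subst Γ Δ) (t : Tm Γ (a →ₜ b)) (u : Tm Γ a) :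
    (Tm.app t u).subst θ = Tm.app (t.subst θ) (u.subst θ) := by
  obtain ⟨t, rfl⟩ := t.exists_eq_mk
  obtain ⟨u, rfl⟩ := u.exists_eq_mk
  rfl

@[simp] theorem subst_lam (θ : Subst Γ Δ) (t : Tm (a :: Γ) b) :
    (Tm.lam t).subst θ = Tm.lam (t.subst θ.lift) := by
  obtain ⟨t, rfl⟩ := t.exists_eq_mk
  obtain ⟨σ, rfl⟩ := θ.exists_eq_mk
  have lift_mk : (Subst.lift (fun b x => Tm.mk (σ b x)) : Subst (a :: Γ) (a :: Δ)) =
      fun b x => Tm.mk (σ.lift b x) := by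
    funext b x; cases x <;> rfl
  rw [lift_mk, Tm.subst_mk]
  exact Tm.subst_mk σ (.lam t)

theorem subst_subst (t : Tm Γ a) (θ : Subst Γ Δ) (σ : Subst Δ Θ) :
    (t.subst θ).subst σ = t.subst (θ.comp σ) := by
  obtain ⟨t, rfl⟩ := t.exists_eq_mk
  obtain ⟨θ, rfl⟩ := θ.exists_eq_mk
  obtain ⟨σ, rfl⟩ := σ.exists_eq_mk
  have comp_mk : Subst.comp (fun b x => Tm.mk (θ b x)) (fun b x => Tm.mk (σ b x)) =
      fun b x => Tm.mk ((θ b x).subst σ) := by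
    funext b x; exact Tm.subst_mk _ _
  rw [comp_mk, Tm.subst_mk, Tm.subst_mk, Tm.subst_mk, Raw.subst_subst]

@[simp] theorem subst_id (t : Tm Γ a) : t.subst Subst.id = t := by
  obtain ⟨t, rfl⟩ := t.exists_eq_mk
  exact (Tm.subst_mk (fun _ x => Raw.var x) t).trans (congrArg Tm.mk t.subst_var)

theorem rename_eq_subst (ρ : Ren Γ Δ) (t : Tm Γ a) :
    t.rename ρ = t.subst fun b x => .var (ρ b x) := by
  obtain ⟨t, rfl⟩ := t.exists_eq_mk
  exact (congrArg Tm.mk (t.rename_eq_subst ρ)).trans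
    (Tm.subst_mk (fun b x => Raw.var (ρ b x)) t).symm

theorem wk_eq_subst (t : Tm Γ a) : (t.wk : Tm (b :: Γ) a) = t.subst Subst.weak :=
  rename_eq_subst _ t

theorem rename_id (t : Tm Γ a) : t.rename Ren.id = t :=
  (rename_eq_subst _ t).trans t.subst_id

theorem rename_rename (ρ : Ren Γ Δ) (ρ' : Ren Δ Θ) (t : Tm Γ a) :
    (t.rename ρ).rename ρ' = t.rename (ρ.comp ρ') := by
  obtain ⟨t, rfl⟩ := t.exists_eq_mk
  exact congrArg Tm.mk (t.rename_rename ρ ρ')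

theorem rename_lam (ρ : Ren Γ Δ) (t : Tm (a :: Γ) b) :
    (Tm.lam t).rename ρ = Tm.lam (t.rename ρ.lift) := by
  obtain ⟨t, rfl⟩ := t.exists_eq_mk
  rfl

theorem rename_app (ρ : Ren Γ Δ) (t : Tm Γ (a →ₜ b)) (u : Tm Γ a) :
    (Tm.app t u).rename ρ = Tm.app (t.rename ρ) (u.rename ρ) := by
  obtain ⟨t, rfl⟩ := t.exists_eq_mk
  obtain ⟨u, rfl⟩ := u.exists_eq_mk
  rfl

@[simp] theorem app_lam (t : Tm (a :: Γ) b) (u : Tm Γ a) :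
    Tm.app (Tm.lam t) u = t.subst (Subst.cons u Subst.id) := by
  obtain ⟨t, rfl⟩ := t.exists_eq_mk
  obtain ⟨u, rfl⟩ := u.exists_eq_mk
  have cons_mk : Subst.cons (Tm.mk u) Subst.id = fun b x => Tm.mk (RawSubst.single u b x) := by
    funext b x; cases x <;> rfl
  rw [cons_mk, Tm.subst_mk]
  exact Quotient.sound (Conv.beta t u)

theorem lam_app_wk (t : Tm Γ (a →ₜ b)) : Tm.lam (Tm.app t.wk (.var .z)) = t := by
  obtain ⟨t, rfl⟩ := t.exists_eq_mk
  exact Quotient.sound (Conv.eta t)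

end Tm

namespace Subst

variable {Γ Δ Θ Ξ : Ctx} {b : Ty}

@[simp] theorem cons_z (t : Tm Δ b) (θ : Subst Γ Δ) : Subst.cons t θ b .z = t := rfl

@[simp] theorem cons_s {a : Ty} (t : Tm Δ b) (θ : Subst Γ Δ) (x : Var Γ a) :
    Subst.cons t θ a (.s x) = θ a x := rfl

theorem single_eq_cons (t : Tm Γ b) : Subst.single t = Subst.cons t Subst.id := by
  funext a x; cases x <;> rfl

theorem succ_eq_cons : (Subst.succ : Subst (nt :: Γ) (nt :: Γ)) =
    Subst.cons (FOLDN.succ (.var .z)) Subst.weak := by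
  funext a x; cases x <;> rfl

theorem lift_eq_cons (θ : Subst Γ Δ) :
    (θ.lift : Subst (b :: Γ) (b :: Δ)) = Subst.cons (.var .z) (θ.comp Subst.weak) := by
  funext a x
  cases x with
  | z => rfl
  | s x => exact Tm.wk_eq_subst _

theorem eq_empty (θ : Subst [] Δ) : θ = Subst.empty := by
  funext a x; cases x

@[simp] theorem cons_comp (t : Tm Δ b) (θ : Subst Γ Δ) (σ : Subst Δ Θ) :
    (Subst.cons t θ).comp σ = Subst.cons (t.subst σ) (θ.comp σ) := by
  funext a x; cases x <;> rfl

@[simp] theorem id_comp (θ : Subst Γ Δ) : Subst.id.comp θ = θ := by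
  funext a x; exact Tm.subst_var _ _

@[simp] theorem comp_id (θ : Subst Γ Δ) : θ.comp Subst.id = θ := by
  funext a x; exact Tm.subst_id _

theorem comp_assoc (θ : Subst Γ Δ) (σ : Subst Δ Θ) (τ : Subst Θ Ξ) :
    (θ.comp σ).comp τ = θ.comp (σ.comp τ) := by
  funext a x; exact Tm.subst_subst _ _ _

@[simp] theorem weak_comp_cons (t : Tm Δ b) (θ : Subst Γ Δ) :
    Subst.weak.comp (Subst.cons t θ) = θ := by
  funext a x; exact Tm.subst_var _ _

@[simp] theorem empty_comp (θ : Subst Γ Δ) : Subst.empty.comp θ = Subst.empty :=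
  eq_empty _

@[simp] theorem lift_comp_cons (θ : Subst Γ Δ) (t : Tm Θ b) (σ : Subst Δ Θ) :
    θ.lift.comp (Subst.cons t σ) = Subst.cons t (θ.comp σ) := by
  rw [lift_eq_cons, cons_comp, comp_assoc, weak_comp_cons, Tm.subst_var, cons_z]

theorem lift_comp_lift (θ : Subst Γ Δ) (σ : Subst Δ Θ) :
    (θ.lift : Subst (b :: Γ) (b :: Δ)).comp σ.lift = (θ.comp σ).lift := by
  rw [lift_eq_cons σ, lift_comp_cons, lift_eq_cons, comp_assoc]

@[simp] theorem lift_id : (Subst.id.lift : Subst (b :: Γ) (b :: Γ)) = Subst.id := by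
  funext a x; cases x <;> rfl

theorem weak_comp_lift (θ : Subst Γ Δ) :
    (Subst.weak : Subst Γ (b :: Γ)).comp θ.lift = θ.comp Subst.weak := by
  rw [lift_eq_cons, weak_comp_cons]

theorem cons_z_weak : (Subst.cons (.var .z) Subst.weak : Subst (b :: Γ) (b :: Γ)) = Subst.id := by
  funext a x; cases x <;> rfl

end Subst

theorem Args.subst_subst {Γ Δ Θ : Ctx} (θ : Subst Γ Δ) (σ : Subst Δ Θ) {as : List Ty}
    (ts : Args Γ as) : (ts.subst θ).subst σ = ts.subst (θ.comp σ) := by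
  induction ts with
  | nil => rfl
  | cons t ts ih => simp only [Args.subst, ih, Tm.subst_subst]

theorem Args.subst_id {Γ : Ctx} {as : List Ty} (ts : Args Γ as) : ts.subst Subst.id = ts := by
  induction ts with
  | nil => rfl
  | cons t ts ih => simp only [Args.subst, ih, Tm.subst_id]

namespace Form

theorem subst_subst {Γ : Ctx} (B : Form Γ) : ∀ {Δ Θ : Ctx} (θ : Subst Γ Δ) (σ : Subst Δ Θ),
    (B.subst θ).subst σ = B.subst (θ.comp σ) := by
  induction B <;> intros <;>
    simp only [Form.subst, Subst.lift_comp_lift, Tm.subst_subst, Args.subst_subst, *]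

@[simp] theorem subst_id {Γ : Ctx} (B : Form Γ) : B.subst Subst.id = B := by
  induction B <;> simp only [Form.subst, Subst.lift_id, Tm.subst_id, Args.subst_id, *]

variable {Γ Δ : Ctx} {b : Ty}

theorem inst_eq_subst (B : Form (b :: Γ)) (t : Tm Γ b) :
    B.inst t = B.subst (Subst.cons t Subst.id) := by
  rw [Form.inst, Subst.single_eq_cons]

theorem subst_lift_inst (B : Form (b :: Γ)) (θ : Subst Γ Δ) (t : Tm Δ b) :
    (B.subst θ.lift).inst t = B.subst (Subst.cons t θ) := by
  rw [inst_eq_subst, subst_subst, Subst.lift_comp_cons, Subst.comp_id]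

theorem inst_subst (B : Form (b :: Γ)) (θ : Subst Γ Δ) (t : Tm Γ b) :
    (B.inst t).subst θ = (B.subst θ.lift).inst (t.subst θ) := by
  rw [subst_lift_inst, inst_eq_subst, subst_subst, Subst.cons_comp, Subst.id_comp]

theorem wk_subst_lift (B : Form Γ) (θ : Subst Γ Δ) :
    (B.wk : Form (b :: Γ)).subst θ.lift = (B.subst θ).wk := by
  rw [Form.wk, Form.wk, subst_subst, subst_subst, Subst.weak_comp_lift]

theorem map_wk_map_subst_lift (M : Multiset (Form Γ)) (θ : Subst Γ Δ) :
    (M.map (Form.wk (b := b))).map (Form.subst θ.lift) = (M.map (Form.subst θ)).map Form.wk := by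
  simp only [Multiset.map_map, Function.comp_def, wk_subst_lift]

theorem IsAtomic.subst {A : Form Γ} (h : A.IsAtomic) (θ : Subst Γ Δ) : (A.subst θ).IsAtomic := by
  cases A <;> exact h

end Form

/-! ## Injectivity of neutral terms up to conversion -/

/-- A presheaf on contexts and renamings: the interpretation of a type in the model by which
`αβη`-conversion is decided. -/
structure Psh where
  obj : Ctx → Type
  ren : ∀ {Γ Δ : Ctx}, Ren Γ Δ → obj Γ → obj Δ
  ren_id : ∀ {Γ : Ctx} (x : obj Γ), ren Ren.id x = x
  ren_ren : ∀ {Γ Δ Θ : Ctx} (ρ : Ren Γ Δ) (ρ' : Ren Δ Θ) (x : obj Γ),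
    ren ρ' (ren ρ x) = ren (ρ.comp ρ') x

namespace Psh

/-- A natural transformation of presheaves. -/
structure Hom (A B : Psh) where
  app : ∀ {Γ : Ctx}, A.obj Γ → B.obj Γ
  ren_app : ∀ {Γ Δ : Ctx} (ρ : Ren Γ Δ) (x : A.obj Γ), B.ren ρ (app x) = app (A.ren ρ x)

/-- The elements at `Γ` of the exponential of two presheaves. -/
@[ext] structure ExpObj (A B : Psh) (Γ : Ctx) where
  app : ∀ {Δ : Ctx}, Ren Γ Δ → A.obj Δ → B.obj Δ
  ren_app : ∀ {Δ Θ : Ctx} (ρ : Ren Γ Δ) (ρ' : Ren Δ Θ) (x : A.obj Δ),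
    B.ren ρ' (app ρ x) = app (ρ.comp ρ') (A.ren ρ' x)

/-- The exponential of two presheaves, which interprets a function type. -/
def exp (A B : Psh) : Psh where
  obj := ExpObj A B
  ren ρ f := ⟨fun ρ' x => f.app (ρ.comp ρ') x, fun _ _ _ => f.ren_app _ _ _⟩
  ren_id _ := rfl
  ren_ren _ _ _ := rfl

end Psh

/-- Neutral terms: a variable or a constant applied to arguments, which are taken up to
conversion. -/
inductive Ne (Γ : Ctx) : Ty → Type
  | var {a : Ty} (x : Var Γ a) : Ne Γ a
  | const {a : Ty} (c : Const a) : Ne Γ a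
  | app {a b : Ty} (n : Ne Γ (a →ₜ b)) (t : Tm Γ a) : Ne Γ b

namespace Ne

variable {Γ Δ Θ : Ctx}

/-- The action of a renaming on neutral terms. -/
def rename (ρ : Ren Γ Δ) : ∀ {a : Ty}, Ne Γ a → Ne Δ a
  | _, .var x => .var (ρ _ x)
  | _, .const c => .const c
  | _, .app n t => .app (n.rename ρ) (t.rename ρ)

/-- The term denoted by a neutral term. -/
def toTm : ∀ {a : Ty}, Ne Γ a → Tm Γ a
  | _, .var x => .var x
  | _, .const c => .const c
  | _, .app n t => .app n.toTm t

theorem rename_id {a : Ty} (n : Ne Γ a) : n.rename Ren.id = n := by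
  induction n with
  | var x => rfl
  | const c => rfl
  | app n t ih => simp only [rename, ih, Tm.rename_id]

theorem rename_rename {a : Ty} (ρ : Ren Γ Δ) (ρ' : Ren Δ Θ) (n : Ne Γ a) :
    (n.rename ρ).rename ρ' = n.rename (ρ.comp ρ') := by
  induction n with
  | var x => rfl
  | const c => rfl
  | app n t ih => simp only [rename, ih, Tm.rename_rename]

theorem rename_toTm {a : Ty} (ρ : Ren Γ Δ) (n : Ne Γ a) :
    n.toTm.rename ρ = (n.rename ρ).toTm := by
  induction n with
  | var x => rfl
  | const c => rfl
  | app n t ih => simp only [rename, toTm, Tm.rename_app, ih]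

/-- The presheaf of neutral terms of a given type. -/
def psh (a : Ty) : Psh where
  obj Γ := Ne Γ a
  ren ρ n := n.rename ρ
  ren_id := rename_id
  ren_ren := rename_rename

end Ne

/-- The presheaf of terms of a given type. -/
def Tm.psh (a : Ty) : Psh where
  obj Γ := Tm Γ a
  ren ρ t := t.rename ρ
  ren_id := Tm.rename_id
  ren_ren := Tm.rename_rename

namespace Ty

/-- The presheaf that interprets a type: the elements of base type are the neutral terms. -/
def psh : Ty → Psh
  | .base b => Ne.psh (.base b)
  | .fn a b => a.psh.exp b.psh

theorem fn_ext {a b : Ty} {Γ : Ctx} {f g : (a →ₜ b).psh.obj Γ}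
    (h : ∀ (Δ : Ctx) (ρ : Ren Γ Δ) (x : a.psh.obj Δ), f.app ρ x = g.app ρ x) : f = g :=
  Psh.ExpObj.ext (by funext Δ ρ x; exact h Δ ρ x)

/-- The maps between the syntax and the model at a given type, as used in normalization by
evaluation: neutral terms are reflected in the model, and its elements are reified as terms. -/
structure ReifyReflect (a : Ty) where
  reflect : (Ne.psh a).Hom a.psh
  reify : a.psh.Hom (Tm.psh a)

/-- Reification and reflection, by recursion on types. -/
def reifyReflect : ∀ a : Ty, a.ReifyReflect
  | .base _ =>
    { reflect := ⟨fun n => n, fun _ _ => rfl⟩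
      reify := ⟨Ne.toTm, Ne.rename_toTm⟩ }
  | .fn a b =>
    { reflect :=
        { app := fun {Γ} (n : Ne Γ (.fn a b)) =>
            { app := fun ρ x =>
                b.reifyReflect.reflect.app (.app (n.rename ρ) (a.reifyReflect.reify.app x))
              ren_app := fun ρ ρ' x =>
                (b.reifyReflect.reflect.ren_app _ _).trans (congrArg _ (congrArg₂ Ne.app
                  (n.rename_rename ρ ρ') (a.reifyReflect.reify.ren_app ρ' x))) }
          ren_app := fun ρ n => fn_ext fun _ ρ' x =>
            congrArg (fun m => b.reifyReflect.reflect.app (.app m (a.reifyReflect.reify.app x)))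
              (Ne.rename_rename ρ ρ' n).symm }
      reify :=
        { app := fun f => .lam (b.reifyReflect.reify.app
            (f.app Ren.wk (a.reifyReflect.reflect.app (.var .z))))
          ren_app := fun ρ f => (Tm.rename_lam ρ _).trans <| congrArg Tm.lam <|
            (b.reifyReflect.reify.ren_app _ _).trans <| congrArg _ <|
              (f.ren_app _ _ _).trans <| congrArg (f.app (Ren.wk.comp ρ.lift))
                (a.reifyReflect.reflect.ren_app _ _) } }

/-- The reflection of a neutral term in the model. -/
abbrev reflect (a : Ty) {Γ : Ctx} (n : Ne Γ a) : a.psh.obj Γ := a.reifyReflect.reflect.app n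

/-- The reification of an element of the model as a term. -/
abbrev reify (a : Ty) {Γ : Ctx} (x : a.psh.obj Γ) : Tm Γ a := a.reifyReflect.reify.app x

end Ty

/-- The presheaf of environments, which interpret the variables of a context in the model. -/
def Ctx.psh (Γ : Ctx) : Psh where
  obj Δ := ∀ a : Ty, Var Γ a → a.psh.obj Δ
  ren ρ e a x := a.psh.ren ρ (e a x)
  ren_id e := by funext a x; exact a.psh.ren_id _
  ren_ren ρ ρ' e := by funext a x; exact a.psh.ren_ren _ _ _

namespace PshEnv

/-- The extension of an environment by a value for the most recent variable. -/
def cons {Γ Δ : Ctx} {b : Ty} (d : b.psh.obj Δ) (e : (Ctx.psh Γ).obj Δ) :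
    (Ctx.psh (b :: Γ)).obj Δ
  | _, .z => d
  | _, .s x => e _ x

/-- The environment that interprets every variable by itself. -/
def id {Γ : Ctx} : (Ctx.psh Γ).obj Γ := fun a x => a.reflect (.var x)

theorem ren_cons {Γ Δ Θ : Ctx} {b : Ty} (ρ : Ren Δ Θ) (d : b.psh.obj Δ) (e : (Ctx.psh Γ).obj Δ) :
    (Ctx.psh (b :: Γ)).ren ρ (cons d e) = cons (b.psh.ren ρ d) ((Ctx.psh Γ).ren ρ e) := by
  funext a x; cases x <;> rfl

end PshEnv

namespace Raw

/-- The evaluation of a term in the model. -/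
def eval : ∀ {Γ : Ctx} {a : Ty}, Raw Γ a → (Ctx.psh Γ).Hom a.psh
  | _, _, .var x => ⟨fun e => e _ x, fun _ _ => rfl⟩
  | _, a, .const c => ⟨fun _ => a.reflect (.const c), fun _ _ => a.reifyReflect.reflect.ren_app _ _⟩
  | Γ, _, .lam t =>
    { app := fun e =>
        { app := fun ρ d => t.eval.app (PshEnv.cons d ((Ctx.psh Γ).ren ρ e))
          ren_app := fun _ _ _ => by rw [t.eval.ren_app, PshEnv.ren_cons, Psh.ren_ren] }
      ren_app := fun ρ e => Ty.fn_ext fun _ ρ' d =>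
        congrArg (fun e => t.eval.app (PshEnv.cons d e)) ((Ctx.psh Γ).ren_ren ρ ρ' e).symm }
  | Γ, _, .app t u =>
    { app := fun e => (t.eval.app e).app Ren.id (u.eval.app e)
      ren_app := fun ρ e => by
        refine ((t.eval.app e).ren_app _ _ _).trans ?_
        rw [u.eval.ren_app]
        exact congrArg (fun f => f.app Ren.id (u.eval.app ((Ctx.psh Γ).ren ρ e)))
          (t.eval.ren_app ρ e) }

theorem eval_rename {Γ : Ctx} {a : Ty} (t : Raw Γ a) : ∀ {Δ Θ : Ctx} (ρ : Ren Γ Δ)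
    (e : (Ctx.psh Δ).obj Θ), (t.rename ρ).eval.app e = t.eval.app fun b x => e b (ρ b x) := by
  induction t with
  | var x => intros; rfl
  | const c => intros; rfl
  | lam t ih =>
    intro Δ Θ ρ e
    refine Ty.fn_ext fun Ξ ρ' d => ?_
    refine (ih _ _).trans (congrArg t.eval.app ?_)
    funext b x; cases x <;> rfl
  | app t u iht ihu => intro Δ Θ ρ e; simp only [Raw.rename, eval, iht, ihu]

theorem eval_subst {Γ : Ctx} {a : Ty} (t : Raw Γ a) : ∀ {Δ Θ : Ctx} (σ : RawSubst Γ Δ)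
    (e : (Ctx.psh Δ).obj Θ),
    (t.subst σ).eval.app e = t.eval.app fun b x => (σ b x).eval.app e := by
  induction t with
  | var x => intros; rfl
  | const c => intros; rfl
  | lam t ih =>
    intro Δ Θ σ e
    refine Ty.fn_ext fun Ξ ρ' d => ?_
    refine (ih _ _).trans (congrArg t.eval.app ?_)
    funext b x
    cases x with
    | z => rfl
    | s x => exact (eval_rename _ _ _).trans ((σ b x).eval.ren_app ρ' e).symm
  | app t u iht ihu => intro Δ Θ σ e; simp only [Raw.subst, eval, iht, ihu]

end Raw

theorem Conv.eval_eq {Γ : Ctx} {a : Ty} {t u : Raw Γ a} (h : Conv t u) :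
    ∀ {Δ : Ctx} (e : (Ctx.psh Γ).obj Δ), t.eval.app e = u.eval.app e := by
  induction h with
  | refl t => intros; rfl
  | symm _ ih => exact fun e => (ih e).symm
  | trans _ _ ih ih' => exact fun e => (ih e).trans (ih' e)
  | app _ _ iht ihu => intro Δ e; simp only [Raw.eval, iht, ihu]
  | lam _ ih =>
    intro Δ e
    refine Ty.fn_ext fun Ξ ρ d => ?_
    exact ih _
  | beta t u =>
    intro Δ e
    rw [Raw.eval_subst]
    refine congrArg t.eval.app ?_
    funext b x
    cases x with
    | z => rfl
    | s x => exact b.psh.ren_id _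
  | @eta Γ a b t =>
    intro Δ e
    refine Ty.fn_ext fun Ξ ρ d => ?_
    calc ((t.rename Ren.wk).eval.app (PshEnv.cons d ((Ctx.psh Γ).ren ρ e))).app Ren.id d
        = (t.eval.app ((Ctx.psh Γ).ren ρ e)).app Ren.id d := by rw [Raw.eval_rename]; rfl
      _ = ((a.psh.exp b.psh).ren ρ (t.eval.app e)).app Ren.id d :=
        congrArg (fun f => f.app Ren.id d) (t.eval.ren_app ρ e).symm

namespace Ty

/-- The logical relation between terms and elements of the model, by which reification is seen
to invert evaluation. -/
def Rel : ∀ (a : Ty) {Γ : Ctx}, Tm Γ a → a.psh.obj Γ → Prop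
  | .base _, _, t, n => t = Ne.toTm n
  | .fn a b, Γ, t, f => ∀ (Δ : Ctx) (ρ : Ren Γ Δ) (u : Tm Δ a) (x : a.psh.obj Δ),
      a.Rel u x → b.Rel (.app (t.rename ρ) u) (f.app ρ x)

theorem Rel.ren {a : Ty} {Γ Δ : Ctx} {t : Tm Γ a} {x : a.psh.obj Γ} (h : a.Rel t x)
    (ρ : Ren Γ Δ) : a.Rel (t.rename ρ) (a.psh.ren ρ x) := by
  cases a with
  | base b =>
    cases h
    exact Ne.rename_toTm ρ x
  | fn a b =>
    intro Θ ρ' u y hy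
    rw [Tm.rename_rename]
    exact h Θ _ u y hy

theorem rel_reify_reflect (a : Ty) :
    (∀ {Γ : Ctx} {t : Tm Γ a} {x : a.psh.obj Γ}, a.Rel t x → a.reify x = t) ∧
      ∀ {Γ : Ctx} (n : Ne Γ a), a.Rel n.toTm (a.reflect n) := by
  induction a with
  | base b => exact ⟨fun h => h.symm, fun n => rfl⟩
  | fn a b iha ihb =>
    constructor
    · intro Γ t f h
      have reify_body := ihb.1 (h _ Ren.wk _ _ (iha.2 (.var .z)))
      exact (congrArg Tm.lam reify_body).trans t.lam_app_wk
    · intro Γ n Δ ρ u x hx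
      rw [Ne.rename_toTm, ← iha.1 hx]
      exact ihb.2 (.app (n.rename ρ) (a.reify x))

theorem Rel.reify_eq {a : Ty} {Γ : Ctx} {t : Tm Γ a} {x : a.psh.obj Γ} (h : a.Rel t x) :
    a.reify x = t :=
  a.rel_reify_reflect.1 h

theorem rel_reflect {a : Ty} {Γ : Ctx} (n : Ne Γ a) : a.Rel n.toTm (a.reflect n) :=
  a.rel_reify_reflect.2 n

end Ty

theorem Tm.app_lam_subst_rename {Γ Δ Θ : Ctx} {a b : Ty} (t : Tm (a :: Γ) b) (θ : Subst Γ Δ)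
    (ρ : Ren Δ Θ) (u : Tm Θ a) :
    Tm.app (((Tm.lam t).subst θ).rename ρ) u =
      t.subst (Subst.cons u fun c y => (θ c y).rename ρ) := by
  rw [Tm.rename_eq_subst, Tm.subst_lam, Tm.subst_lam, Tm.app_lam, Tm.subst_subst,
    Tm.subst_subst, Subst.lift_comp_cons, Subst.lift_comp_cons, Subst.comp_id]
  congr 2; funext c y; exact (Tm.rename_eq_subst _ _).symm

theorem Raw.rel_eval {Γ : Ctx} {a : Ty} (t : Raw Γ a) : ∀ {Δ : Ctx} (θ : Subst Γ Δ)
    (e : (Ctx.psh Γ).obj Δ), (∀ (b : Ty) (x : Var Γ b), b.Rel (θ b x) (e b x)) →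
      a.Rel ((Tm.mk t).subst θ) (t.eval.app e) := by
  induction t with
  | var x =>
    intro Δ θ e h
    exact (Tm.subst_var θ x).symm ▸ h _ x
  | const c => exact fun θ e _ => Ty.rel_reflect (.const c)
  | @lam Γ a b t ih =>
    intro Δ θ e h Θ ρ u x hx
    refine (Tm.app_lam_subst_rename (Tm.mk t) θ ρ u).symm ▸ ih _ _ fun c y => ?_
    cases y with
    | z => exact hx
    | s y => exact (h c y).ren ρ
  | app t u iht ihu =>
    intro Δ θ e h
    have rel_app := iht θ e h _ Ren.id _ _ (ihu θ e h)
    rwa [Tm.rename_id] at rel_app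

namespace Tm

variable {Γ : Ctx} {a b : Ty}

/-- The value of a term in the environment that interprets every variable by itself. -/
def eval (t : Tm Γ a) : a.psh.obj Γ :=
  Quotient.lift (fun r : Raw Γ a => r.eval.app PshEnv.id) (fun _ _ h => Conv.eval_eq h _) t

theorem reify_eval (t : Tm Γ a) : a.reify t.eval = t := by
  obtain ⟨t, rfl⟩ := t.exists_eq_mk
  have rel_eval := t.rel_eval Subst.id PshEnv.id fun b x => Ty.rel_reflect (.var x)
  rw [Tm.subst_id] at rel_eval
  exact rel_eval.reify_eq

theorem eval_app (t : Tm Γ (a →ₜ b)) (u : Tm Γ a) :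
    (Tm.app t u).eval = t.eval.app Ren.id u.eval := by
  obtain ⟨t, rfl⟩ := t.exists_eq_mk
  obtain ⟨u, rfl⟩ := u.exists_eq_mk
  rfl

end Tm

theorem Ne.eval_toTm {Γ : Ctx} {a : Ty} (n : Ne Γ a) : n.toTm.eval = a.reflect n := by
  induction n with
  | var x => rfl
  | const c => rfl
  | @app a b n t ih =>
    rw [Ne.toTm, Tm.eval_app, ih]
    change b.reflect (.app (n.rename Ren.id) (a.reify t.eval)) = _
    rw [Ne.rename_id, Tm.reify_eval]

theorem Ne.toTm_injective {Γ : Ctx} {b : Base} :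
    Function.Injective (Ne.toTm : Ne Γ (.base b) → Tm Γ (.base b)) := by
  intro n n' h
  have eval_eq := congrArg Tm.eval h
  rwa [Ne.eval_toTm, Ne.eval_toTm] at eval_eq

/-! ## Admissible rules -/

theorem Form.subst_succ_subst_lift {Γ Δ : Ctx} (B : Form (nt :: Γ)) (θ : Subst Γ Δ) :
    (B.subst Subst.succ).subst θ.lift = (B.subst θ.lift).subst Subst.succ := by
  rw [subst_subst, subst_subst, Subst.succ_eq_cons, Subst.succ_eq_cons, Subst.cons_comp,
    Subst.lift_comp_cons, Subst.weak_comp_lift, FOLDN.succ, Tm.subst_app, Tm.subst_const,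
    Tm.subst_var]
  rfl

namespace Der

variable {D : Definition} {V : Ctx} {Γ Δ : Multiset (Form V)} {C : Form V}

theorem defL_univ {as : List Ty} {p : Pred as} {us : Args V as}
    (h : ∀ c ∈ D.clauses, ∀ ρ : Unifier (Form.pred p us) c.head,
      Der D ρ.cod (c.body.subst ρ.right ::ₘ Γ.map (Form.subst ρ.left)) (C.subst ρ.left)) :
    Der D V (.pred p us ::ₘ Γ) C :=
  .defL (fun _ => Set.univ)
    (fun _ _ ρ => ⟨ρ, trivial, Subst.id, (Subst.comp_id _).symm, (Subst.comp_id _).symm⟩)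
    fun c hc ρ _ => h c hc ρ

theorem add_right (h : Der D V Γ C) : ∀ Δ : Multiset (Form V), Der D V (Γ + Δ) C := by
  induction h with try simp only [Multiset.cons_add, add_assoc] at *
  | botL => exact fun _ => .botL
  | topR => exact fun _ => .topR
  | andL₁ _ ih => exact fun Δ => .andL₁ (ih Δ)
  | andL₂ _ ih => exact fun Δ => .andL₂ (ih Δ)
  | andR _ _ ihB ihC => exact fun Δ => .andR (ihB Δ) (ihC Δ)
  | orL _ _ ihB ihC => exact fun Δ => .orL (ihB Δ) (ihC Δ)
  | orR₁ _ ih => exact fun Δ => .orR₁ (ih Δ)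
  | orR₂ _ ih => exact fun Δ => .orR₂ (ih Δ)
  | impL _ _ ihB ihC => exact fun Δ => .impL (ihB Δ) (ihC Δ)
  | impR _ ih => exact fun Δ => .impR (ih Δ)
  | allL t _ ih => exact fun Δ => .allL t (ih Δ)
  | allR _ ih => exact fun Δ => .allR (by simpa only [Multiset.map_add] using ih _)
  | exL _ ih => exact fun Δ => .exL (by simpa only [Multiset.map_add] using ih _)
  | exR t _ ih => exact fun Δ => .exR t (ih Δ)
  | init hA => exact fun _ => .init hA
  | contr _ ih => exact fun Δ => .contr (ih Δ)
  | cut hB _ _ ihC => exact fun Δ => .cut hB (ihC Δ)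
  | natR_zero => exact fun _ => .natR_zero
  | natR_succ _ ih => exact fun Δ => .natR_succ (ih Δ)
  | natL B h_zero h_succ _ _ _ ih => exact fun Δ => .natL B h_zero h_succ (ih Δ)
  | defR c hc θ heq _ ih => exact fun Δ => .defR c hc θ heq (ih Δ)
  | defL S hS _ ih =>
    exact fun Δ => .defL S hS fun c hc θ hθ => by simpa only [Multiset.map_add] using ih c hc θ hθ _

theorem subst (h : Der D V Γ C) :
    ∀ {V' : Ctx} (θ : Subst V V'), Der D V' (Γ.map (Form.subst θ)) (C.subst θ) := by
  induction h with try simp only [Multiset.map_cons, Multiset.map_add, Multiset.map_zero,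
      Multiset.map_singleton, Form.inst_subst] at *
  | botL => exact fun _ => .botL
  | topR => exact fun _ => .topR
  | andL₁ _ ih => exact fun θ => .andL₁ (ih θ)
  | andL₂ _ ih => exact fun θ => .andL₂ (ih θ)
  | andR _ _ ihB ihC => exact fun θ => .andR (ihB θ) (ihC θ)
  | orL _ _ ihB ihC => exact fun θ => .orL (ihB θ) (ihC θ)
  | orR₁ _ ih => exact fun θ => .orR₁ (ih θ)
  | orR₂ _ ih => exact fun θ => .orR₂ (ih θ)
  | impL _ _ ihB ihC => exact fun θ => .impL (ihB θ) (ihC θ)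
  | impR _ ih => exact fun θ => .impR (ih θ)
  | allL t _ ih => exact fun θ => .allL _ (ih θ)
  | allR _ ih => exact fun θ => .allR (by simpa only [Form.map_wk_map_subst_lift] using ih θ.lift)
  | exL _ ih =>
    intro V' θ
    exact .exL (by simpa only [Form.wk_subst_lift, Form.map_wk_map_subst_lift] using ih θ.lift)
  | exR t _ ih => exact fun θ => .exR _ (ih θ)
  | init hA => exact fun θ => .init (hA.subst θ)
  | contr _ ih => exact fun θ => .contr (ih θ)
  | cut _ _ ihB ihC => exact fun θ => .cut (ihB θ) (ihC θ)
  | natR_zero => exact fun _ => .natR_zero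
  | natR_succ _ ih =>
    intro V' θ
    rw [Form.subst, Tm.subst_app]
    exact .natR_succ (ih θ)
  | natL B _ _ _ ih_zero ih_succ ih =>
    intro V' θ
    exact .natL (B.subst θ.lift) (ih_zero θ)
      (by simpa only [Form.subst_succ_subst_lift] using ih_succ θ.lift) (ih θ)
  | defR c hc σ heq _ ih =>
    intro V' θ
    refine .defR c hc (σ.comp θ) (by rw [← Form.subst_subst, ← heq]; rfl) ?_
    rw [← Form.subst_subst]
    exact ih θ
  | defL S hS _ ih =>
    intro V' θ
    refine defL_univ fun c hc ρ => ?_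
    -- A unifier of the instance by `θ` yields one of the atom, hence factors through `S`.
    obtain ⟨τ, hτ, σ, hleft, hright⟩ := hS c hc ⟨ρ.cod, θ.comp ρ.left, ρ.right, by
      rw [← ρ.eq, ← Form.subst_subst]; rfl⟩
    have h := ih c hc τ hτ σ
    dsimp only at hleft hright
    simpa only [Multiset.map_map, Function.comp_def, Form.subst_subst, hleft, hright] using h

theorem refl (A : Form V) : ∀ Γ : Multiset (Form V), Der D V (A ::ₘ Γ) A := by
  induction A with
  | bot => exact fun Γ => .botL
  | top => exact fun Γ => .topR
  | and B C ihB ihC => exact fun Γ => .andR (.andL₁ (ihB Γ)) (.andL₂ (ihC Γ))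
  | or B C ihB ihC => exact fun Γ => .orL (.orR₁ (ihB Γ)) (.orR₂ (ihC Γ))
  | imp B C ihB ihC =>
    intro Γ
    refine .impR ?_
    rw [Multiset.cons_swap]
    exact .impL (ihB Γ) (ihC _)
  | all a B ih =>
    intro Γ
    refine .allR ?_
    rw [Multiset.map_cons]
    refine .allL (.var .z) ?_
    rw [Form.subst_lift_inst, Subst.cons_z_weak, Form.subst_id]
    exact ih _
  | ex a B ih =>
    intro Γ
    refine .exL (.exR (.var .z) ?_)
    rw [Form.subst_lift_inst, Subst.cons_z_weak, Form.subst_id]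
    exact ih _
  | nat t => exact fun Γ => .init trivial
  | pred p ts => exact fun Γ => .init trivial

theorem of_mem {A : Form V} (h : A ∈ Γ) : Der D V Γ A := by
  obtain ⟨Δ, rfl⟩ := Multiset.exists_cons_of_mem h
  exact refl A Δ

theorem contr_add (Δ : Multiset (Form V)) :
    ∀ Γ : Multiset (Form V), Der D V (Δ + (Γ + Δ)) C → Der D V (Γ + Δ) C := by
  induction Δ using Multiset.induction_on with
  | empty => intro Γ h; rwa [zero_add] at h
  | cons A Δ ih =>
    intro Γ h
    simp only [Multiset.cons_add, Multiset.add_cons] at h ⊢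
    have h_ih := ih (A ::ₘ Γ) (by
      simpa only [Multiset.cons_add, Multiset.add_cons] using h.contr)
    rwa [Multiset.cons_add] at h_ih

theorem multicut (Γ : Multiset (Form V)) (hΓ : ∀ A ∈ Γ, Der D V Δ A) (h : Der D V (Γ + Δ) C) :
    Der D V Δ C := by
  induction Γ using Multiset.induction_on with
  | empty => rwa [zero_add] at h
  | cons A Γ ih =>
    refine ih (fun B hB => hΓ B (Multiset.mem_cons_of_mem hB)) (contr_add Δ Γ ?_)
    rw [Multiset.cons_add] at h
    exact .cut (hΓ A (Multiset.mem_cons_self A Γ)) h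

end Der

/-! ## Forcing -/

/-- A point in the course of a derivation: the eigenvariables and the hypotheses available there.
The definition `D` is an index only, so that `Forces` need not mention it. -/
structure Stage (D : Definition) where
  ctx : Ctx
  hyps : Multiset (Form ctx)

variable {D : Definition}

/-- A formula is forced at a stage if it is derivable from the hypotheses there. -/
def Forces (w : Stage D) (A : Form w.ctx) : Prop := Der D w.ctx w.hyps A

infix:30 " ⊩ " => Forces

/-- The later stages of a derivation: a substitution for the eigenvariables under which the
hypotheses remain derivable. -/
structure Stage.Hom (w w' : Stage D) where
  θ : Subst w.ctx w'.ctx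
  forces : ∀ A ∈ w.hyps, w' ⊩ A.subst θ

theorem Forces.mono {w w' : Stage D} {A : Form w.ctx} (h : w ⊩ A) (e : w.Hom w') :
    w' ⊩ A.subst e.θ := by
  refine Der.multicut (w.hyps.map (Form.subst e.θ)) (fun B hB => ?_)
    ((Der.subst h e.θ).add_right w'.hyps)
  obtain ⟨A, hA, rfl⟩ := Multiset.mem_map.1 hB
  exact e.forces A hA

namespace Stage

namespace Hom

/-- The identity of a stage. -/
def id (w : Stage D) : w.Hom w :=
  ⟨Subst.id, fun A hA => by rw [Form.subst_id]; exact Der.of_mem hA⟩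

/-- Composition of morphisms of stages, in diagrammatic order. -/
noncomputable def comp {w w' w'' : Stage D} (e : w.Hom w') (e' : w'.Hom w'') : w.Hom w'' :=
  ⟨e.θ.comp e'.θ, fun A hA => by rw [← Form.subst_subst]; exact Forces.mono (e.forces A hA) e'⟩

@[simp] theorem id_θ (w : Stage D) : (Hom.id w).θ = Subst.id := rfl

@[simp] theorem comp_θ {w w' w'' : Stage D} (e : w.Hom w') (e' : w'.Hom w'') :
    (e.comp e').θ = e.θ.comp e'.θ := rfl

end Hom

/-- The stage with the further hypothesis `A`. -/
abbrev assume (w : Stage D) (A : Form w.ctx) : Stage D := ⟨w.ctx, A ::ₘ w.hyps⟩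

/-- The passage to a stage with a further hypothesis. -/
def Hom.assume (w : Stage D) (A : Form w.ctx) : w.Hom (w.assume A) :=
  ⟨Subst.id, fun B hB => by
    rw [Form.subst_id]; exact Der.of_mem (Multiset.mem_cons_of_mem hB)⟩

/-- The stage with a further eigenvariable of type `a`. -/
noncomputable abbrev extend (w : Stage D) (a : Ty) : Stage D := ⟨a :: w.ctx, w.hyps.map Form.wk⟩

/-- The passage to a stage with a further eigenvariable. -/
noncomputable def Hom.extend (w : Stage D) (a : Ty) : w.Hom (w.extend a) :=
  ⟨Subst.weak, fun _ hB => Der.of_mem (Multiset.mem_map_of_mem _ hB)⟩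

end Stage

namespace Forces

variable {w : Stage D} {A B C : Form w.ctx}

theorem cut (hA : w ⊩ A) (hC : w.assume A ⊩ C) : w ⊩ C := by
  refine Der.multicut {A} (fun B hB => ?_) hC
  rwa [Multiset.mem_singleton.1 hB]

theorem assume (A : Form w.ctx) : w.assume A ⊩ A := Der.refl A _

theorem and_intro (hA : w ⊩ A) (hB : w ⊩ B) : w ⊩ A ∧ₘ B := Der.andR hA hB

theorem and_left (h : w ⊩ A ∧ₘ B) : w ⊩ A := h.cut (.andL₁ (.refl _ _))

theorem and_right (h : w ⊩ A ∧ₘ B) : w ⊩ B := h.cut (.andL₂ (.refl _ _))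

theorem imp_elim (h : w ⊩ (A ⊃ₘ B)) (hA : w ⊩ A) : w ⊩ B := h.cut (.impL hA (.refl _ _))

theorem all_elim {Δ : Ctx} {θ : Subst Δ w.ctx} {a : Ty} {B : Form (a :: Δ)}
    (h : w ⊩ (Form.all a B).subst θ) (t : Tm w.ctx a) : w ⊩ B.subst (Subst.cons t θ) := by
  refine h.cut (.allL t ?_)
  rw [Form.subst_lift_inst]
  exact .refl _ _

theorem ex_intro {Δ : Ctx} {θ : Subst Δ w.ctx} {a : Ty} {B : Form (a :: Δ)} (t : Tm w.ctx a)
    (h : w ⊩ B.subst (Subst.cons t θ)) : w ⊩ (Form.ex a B).subst θ := by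
  rw [← Form.subst_lift_inst] at h
  exact Der.exR t h

theorem ex_elim {a : Ty} {B : Form (a :: w.ctx)} (h : w ⊩ Form.ex a B)
    (k : ∀ (w' : Stage D) (e : w.Hom w') (t : Tm w'.ctx a), w' ⊩ B.subst (Subst.cons t e.θ) →
      w' ⊩ C.subst e.θ) : w ⊩ C := by
  have hC := k ((w.extend a).assume B)
    ((Stage.Hom.extend w a).comp (Stage.Hom.assume (w.extend a) B)) (.var .z)
  simp only [Stage.Hom.comp_θ, Stage.Hom.extend, Stage.Hom.assume, Subst.comp_id,
    Subst.cons_z_weak, Form.subst_id] at hC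
  exact h.cut (.exL (hC (Forces.assume (w := w.extend a) B)))

theorem def_elim {as : List Ty} {p : Pred as} {us : Args w.ctx as} (cs : List Clause)
    (hcs : ∀ c ∈ D.clauses, (⟨c.arity, c.pred⟩ : Σ as, Pred as) = ⟨as, p⟩ → c ∈ cs)
    (h : w ⊩ Form.pred p us)
    (k : ∀ (w' : Stage D) (e : w.Hom w'), ∀ c ∈ cs, ∀ ρ : Subst c.vars w'.ctx,
      Form.pred p (us.subst e.θ) = Form.pred c.pred (c.args.subst ρ) → w' ⊩ c.body.subst ρ →
      w' ⊩ C.subst e.θ) : w ⊩ C := by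
  refine h.cut (.defL_univ fun c hc ρ => ?_)
  have hpred : (⟨c.arity, c.pred⟩ : Σ as, Pred as) = ⟨as, p⟩ := by
    obtain ⟨h_arity, h_pred, -⟩ := Form.pred.inj ρ.eq
    exact Sigma.ext h_arity.symm h_pred.symm
  exact k ⟨ρ.cod, c.body.subst ρ.right ::ₘ w.hyps.map (Form.subst ρ.left)⟩
    ⟨ρ.left, fun _ hA => Der.of_mem (Multiset.mem_cons_of_mem (Multiset.mem_map_of_mem _ hA))⟩
    c (hcs c hc hpred) ρ.right ρ.eq (Der.refl _ _)

theorem def_intro {c : Clause} (hc : c ∈ D.clauses) (ρ : Subst c.vars w.ctx)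
    (h : w ⊩ c.body.subst ρ) : w ⊩ Form.pred c.pred (c.args.subst ρ) :=
  Der.defR c hc ρ rfl h

theorem nat_induction (B : Form [nt])
    (h_zero : ∀ w : Stage D, w ⊩ B.subst (Subst.cons zero Subst.empty))
    (h_succ : ∀ (w : Stage D) (j : Tm w.ctx nt), w ⊩ B.subst (Subst.cons j Subst.empty) →
      w ⊩ B.subst (Subst.cons (succ j) Subst.empty))
    {t : Tm w.ctx nt} (h : w ⊩ .nat t) : w ⊩ B.subst (Subst.cons t Subst.empty) := by
  have subst_B {Θ : Ctx} (σ : Subst (nt :: w.ctx) Θ) :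
      (B.subst (Subst.cons (.var .z) Subst.empty)).subst σ
        = B.subst (Subst.cons (σ _ .z) Subst.empty) := by
    rw [Form.subst_subst, Subst.cons_comp, Tm.subst_var, Subst.empty_comp]
  refine h.cut (.natL (B.subst (Subst.cons (.var .z) Subst.empty)) ?_ ?_ ?_)
  · rw [Form.inst, subst_B]; exact h_zero ⟨w.ctx, 0⟩
  · rw [subst_B]; exact h_succ ⟨_, _⟩ _ (Der.refl _ 0)
  · rw [Form.inst, subst_B]; exact Der.refl _ _

end Forces

/-- The content of a formula at a stage, where quantification over terms, implication and
conjunction in the ambient logic replace the positive occurrences of `∀`, `⊃` and `∧`. -/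
def Sat : ∀ {Δ : Ctx}, Form Δ → ∀ w : Stage D, Subst Δ w.ctx → Prop
  | _, .imp A B, w, θ => (w ⊩ A.subst θ) → Sat B w θ
  | _, .all a B, w, θ => ∀ t : Tm w.ctx a, Sat B w (Subst.cons t θ)
  | _, .and A B, w, θ => Sat A w θ ∧ Sat B w θ
  | _, .bot, w, _ => w ⊩ .bot
  | _, .top, w, _ => w ⊩ .top
  | _, .or A B, w, θ => w ⊩ (Form.or A B).subst θ
  | _, .ex a B, w, θ => w ⊩ (Form.ex a B).subst θ
  | _, .nat t, w, θ => w ⊩ (Form.nat t).subst θ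
  | _, .pred p ts, w, θ => w ⊩ (Form.pred p ts).subst θ

section
variable {Δ : Ctx} (w : Stage D) (θ : Subst Δ w.ctx)

@[simp] theorem sat_imp (A B : Form Δ) :
    Sat (A ⊃ₘ B) w θ ↔ ((w ⊩ A.subst θ) → Sat B w θ) := Iff.rfl

@[simp] theorem sat_all (a : Ty) (B : Form (a :: Δ)) :
    Sat (.all a B) w θ ↔ ∀ t : Tm w.ctx a, Sat B w (Subst.cons t θ) := Iff.rfl

@[simp] theorem sat_and (A B : Form Δ) : Sat (A ∧ₘ B) w θ ↔ Sat A w θ ∧ Sat B w θ := Iff.rfl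

@[simp] theorem sat_nat (t : Tm Δ nt) : Sat (.nat t) w θ ↔ w ⊩ .nat (t.subst θ) := Iff.rfl

end

theorem sat_subst {Δ : Ctx} (A : Form Δ) : ∀ {Θ : Ctx} (w : Stage D) (σ : Subst Δ Θ)
    (θ : Subst Θ w.ctx), Sat (A.subst σ) w θ ↔ Sat A w (σ.comp θ) := by
  induction A with
  | imp A B _ ih => intro Θ w σ θ; simp only [Form.subst, sat_imp, ih, Form.subst_subst]
  | all a B ih => intro Θ w σ θ; simp only [Form.subst, sat_all, ih, Subst.lift_comp_cons]
  | and A B ihA ihB => intro Θ w σ θ; simp only [Form.subst, sat_and, ihA, ihB]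
  | bot => intros; rfl
  | top => intros; rfl
  | _ =>
    intro Θ w σ θ
    simp only [Sat, Form.subst, Tm.subst_subst, Args.subst_subst, Form.subst_subst,
      Subst.lift_comp_lift]

theorem Forces.sat {Δ : Ctx} {A : Form Δ} : ∀ {w : Stage D} {θ : Subst Δ w.ctx},
    w ⊩ A.subst θ → Sat A w θ := by
  induction A with
  | imp A B _ ih => exact fun h hA => ih (h.imp_elim hA)
  | all a B ih => exact fun h t => ih (h.all_elim t)
  | and A B ihA ihB => exact fun h => ⟨ihA h.and_left, ihB h.and_right⟩
  | _ => exact fun h => h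

theorem Forces.of_forall_hom {Δ : Ctx} {A : Form Δ} {w : Stage D} {θ : Subst Δ w.ctx}
    (h : ∀ (w' : Stage D) (e : w.Hom w'), w' ⊩ A.subst (θ.comp e.θ)) : w ⊩ A.subst θ := by
  simpa only [Stage.Hom.id_θ, Subst.comp_id] using h w (.id w)

theorem Forces.of_sat {Δ : Ctx} {A : Form Δ} : ∀ {w : Stage D} {θ : Subst Δ w.ctx},
    (∀ (w' : Stage D) (e : w.Hom w'), Sat A w' (θ.comp e.θ)) → w ⊩ A.subst θ := by
  induction A with
  | imp A B _ ih =>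
    intro w θ h
    refine .impR (ih (w := w.assume (A.subst θ)) fun w' e => ?_)
    have hB := h w' ((Stage.Hom.assume w (A.subst θ)).comp e)
    simp only [Stage.Hom.comp_θ, Stage.Hom.assume, Subst.id_comp] at hB
    refine hB ?_
    rw [← Form.subst_subst]
    exact (Forces.assume (A.subst θ)).mono e
  | all a B ih =>
    intro w θ h
    refine .allR (ih (w := w.extend a) fun w' e => ?_)
    have hB := h w' ((Stage.Hom.extend w a).comp e) (e.θ _ .z)
    have hθ : Subst.cons (e.θ _ .z) (θ.comp ((Stage.Hom.extend w a).comp e).θ) =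
        θ.lift.comp e.θ := by
      rw [Subst.lift_eq_cons, Subst.cons_comp, Tm.subst_var, Subst.comp_assoc]
      rfl
    rwa [hθ] at hB
  | and A B ihA ihB =>
    exact fun h => .and_intro (ihA fun w' e => (h w' e).1) (ihB fun w' e => (h w' e).2)
  | bot => exact fun h => Forces.of_forall_hom (A := .bot) h
  | top => exact fun _ => .topR
  | or A B => exact Forces.of_forall_hom
  | ex a B => exact Forces.of_forall_hom
  | nat t => exact Forces.of_forall_hom
  | pred p ts => exact Forces.of_forall_hom

theorem Forces.iff_sat {w : Stage D} {A : Form w.ctx} :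
    (w ⊩ A) ↔ ∀ (w' : Stage D) (e : w.Hom w'), Sat A w' e.θ := by
  refine ⟨fun h w' e => (h.mono e).sat, fun h => ?_⟩
  rw [← Form.subst_id A]
  exact Forces.of_sat fun w' e => by rw [Subst.id_comp]; exact h w' e

theorem derivable_of_sat {A : Form []} (h : ∀ w : Stage D, Sat A w Subst.empty) :
    Derivable D A := by
  have hA : (⟨[], 0⟩ : Stage D) ⊩ A.subst Subst.empty :=
    Forces.of_sat fun w' e => by rw [Subst.empty_comp]; exact h w'
  rwa [← Subst.eq_empty Subst.id, Form.subst_id] at hA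

/-! ## Terms of the object logic -/

theorem Tm.app_const_inj {Γ : Ctx} {a : Ty} {b : Base} {c : Const (a →ₜ .base b)}
    {t t' : Tm Γ a} : Tm.app (.const c) t = Tm.app (.const c) t' ↔ t = t' := by
  refine ⟨fun h => ?_, fun h => by rw [h]⟩
  cases Ne.toTm_injective (a₁ := .app (.const c) t) (a₂ := .app (.const c) t') h
  rfl

theorem Tm.app_app_const_inj {Γ : Ctx} {a a' : Ty} {b : Base} {c : Const (a →ₜ a' →ₜ .base b)}
    {t t' : Tm Γ a} {u u' : Tm Γ a'} :
    Tm.app (.app (.const c) t) u = Tm.app (.app (.const c) t') u' ↔ t = t' ∧ u = u' := by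
  refine ⟨fun h => ?_, fun h => by rw [h.1, h.2]⟩
  cases Ne.toTm_injective (a₁ := .app (.app (.const c) t) u)
    (a₂ := .app (.app (.const c) t') u') h
  exact ⟨rfl, rfl⟩

/-- The constant at the head of a neutral term, if the head is not a variable. -/
def Ne.head {Γ : Ctx} : ∀ {a : Ty}, Ne Γ a → Option (Σ a, Const a)
  | _, .var _ => none
  | _, .const c => some ⟨_, c⟩
  | _, .app n _ => n.head

/-- The constant at the head of the normal form of a term of base type, if any. -/
def Tm.head {Γ : Ctx} {b : Base} (t : Tm Γ (.base b)) : Option (Σ a, Const a) := Ne.head t.eval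

theorem Ne.head_toTm {Γ : Ctx} {b : Base} (n : Ne Γ (.base b)) : n.toTm.head = n.head :=
  congrArg Ne.head n.eval_toTm

section
variable {Γ Δ : Ctx}

@[simp] theorem head_zero : (zero : Tm Γ nt).head = some ⟨_, .zero⟩ := Ne.head_toTm (.const .zero)

@[simp] theorem head_succ (t : Tm Γ nt) : (succ t).head = some ⟨_, .succ⟩ :=
  Ne.head_toTm (.app (.const .succ) t)

@[simp] theorem head_nil : (nil : Tm Γ atmlst).head = some ⟨_, .nil⟩ := Ne.head_toTm (.const .nil)

@[simp] theorem head_cons (x : Tm Γ atm) (l : Tm Γ atmlst) : (cons x l).head = some ⟨_, .cons⟩ :=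
  Ne.head_toTm (.app (.app (.const .cons) x) l)

@[simp] theorem head_atom (x : Tm Γ atm) : (atom x).head = some ⟨_, .atom⟩ :=
  Ne.head_toTm (.app (.const .atom) x)

@[simp] theorem head_tt : (tt : Tm Γ prp).head = some ⟨_, .tt⟩ := Ne.head_toTm (.const .tt)

@[simp] theorem head_conj (b c : Tm Γ prp) : (conj b c).head = some ⟨_, .conj⟩ :=
  Ne.head_toTm (.app (.app (.const .conj) b) c)

@[simp] theorem head_impl (x : Tm Γ atm) (b : Tm Γ prp) : (impl x b).head = some ⟨_, .impl⟩ :=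
  Ne.head_toTm (.app (.app (.const .impl) x) b)

@[simp] theorem head_forallI (b : Tm Γ (ι →ₜ prp)) : (forallI b).head = some ⟨_, .forallI⟩ :=
  Ne.head_toTm (.app (.const .forallI) b)

@[simp] theorem head_abs (r : Tm Γ (ι →ₜ ι)) : (abs r).head = some ⟨_, .abs⟩ :=
  Ne.head_toTm (.app (.const .abs) r)

@[simp] theorem head_app (m n : Tm Γ ι) : (app m n).head = some ⟨_, .app⟩ :=
  Ne.head_toTm (.app (.app (.const .app) m) n)

@[simp] theorem head_typeof (m n : Tm Γ ι) : (typeof m n).head = some ⟨_, .typeof⟩ :=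
  Ne.head_toTm (.app (.app (.const .typeof) m) n)

@[simp] theorem head_natsem (m n : Tm Γ ι) : (natsem m n).head = some ⟨_, .natsem⟩ :=
  Ne.head_toTm (.app (.app (.const .natsem) m) n)

@[simp] theorem head_transone (m n : Tm Γ ι) : (transone m n).head = some ⟨_, .transone⟩ :=
  Ne.head_toTm (.app (.app (.const .transone) m) n)

@[simp] theorem head_transsem (m n : Tm Γ ι) : (transsem m n).head = some ⟨_, .transsem⟩ :=
  Ne.head_toTm (.app (.app (.const .transsem) m) n)

@[simp] theorem succ_inj {t t' : Tm Γ nt} : succ t = succ t' ↔ t = t' := Tm.app_const_inj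

@[simp] theorem cons_inj {x x' : Tm Γ atm} {l l' : Tm Γ atmlst} :
    cons x l = cons x' l' ↔ x = x' ∧ l = l' := Tm.app_app_const_inj

@[simp] theorem atom_inj {x x' : Tm Γ atm} : atom x = atom x' ↔ x = x' := Tm.app_const_inj

@[simp] theorem conj_inj {b c b' c' : Tm Γ prp} : conj b c = conj b' c' ↔ b = b' ∧ c = c' :=
  Tm.app_app_const_inj

@[simp] theorem impl_inj {x x' : Tm Γ atm} {b b' : Tm Γ prp} :
    impl x b = impl x' b' ↔ x = x' ∧ b = b' := Tm.app_app_const_inj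

@[simp] theorem forallI_inj {b b' : Tm Γ (ι →ₜ prp)} : forallI b = forallI b' ↔ b = b' :=
  Tm.app_const_inj

@[simp] theorem abs_inj {r r' : Tm Γ (ι →ₜ ι)} : abs r = abs r' ↔ r = r' := Tm.app_const_inj

@[simp] theorem app_inj {m n m' n' : Tm Γ ι} : app m n = app m' n' ↔ m = m' ∧ n = n' :=
  Tm.app_app_const_inj

@[simp] theorem arr_inj {m n m' n' : Tm Γ ι} : arr m n = arr m' n' ↔ m = m' ∧ n = n' :=
  Tm.app_app_const_inj

@[simp] theorem typeof_inj {m n m' n' : Tm Γ ι} : typeof m n = typeof m' n' ↔ m = m' ∧ n = n' :=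
  Tm.app_app_const_inj

@[simp] theorem natsem_inj {m n m' n' : Tm Γ ι} : natsem m n = natsem m' n' ↔ m = m' ∧ n = n' :=
  Tm.app_app_const_inj

@[simp] theorem transone_inj {m n m' n' : Tm Γ ι} :
    transone m n = transone m' n' ↔ m = m' ∧ n = n' := Tm.app_app_const_inj

@[simp] theorem transsem_inj {m n m' n' : Tm Γ ι} :
    transsem m n = transsem m' n' ↔ m = m' ∧ n = n' := Tm.app_app_const_inj

theorem succ_ne_zero (t : Tm Γ nt) : succ t ≠ zero := fun h => by
  simpa using congrArg Tm.head h

theorem app_ne_abs (m n : Tm Γ ι) (r : Tm Γ (ι →ₜ ι)) : app m n ≠ abs r := fun h => by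
  simpa using congrArg Tm.head h

theorem cons_ne_nil (x : Tm Γ atm) (l : Tm Γ atmlst) : cons x l ≠ nil := fun h => by
  simpa using congrArg Tm.head h

variable (θ : Subst Γ Δ)

@[simp] theorem subst_zero : (zero : Tm Γ nt).subst θ = zero := rfl

@[simp] theorem subst_succ (t : Tm Γ nt) : (succ t).subst θ = succ (t.subst θ) := by
  simp only [succ, Tm.subst_app, Tm.subst_const]

@[simp] theorem subst_nil : (nil : Tm Γ atmlst).subst θ = nil := rfl

@[simp] theorem subst_cons (x : Tm Γ atm) (l : Tm Γ atmlst) :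
    (cons x l).subst θ = cons (x.subst θ) (l.subst θ) := by
  simp only [cons, Tm.subst_app, Tm.subst_const]

@[simp] theorem subst_atom (x : Tm Γ atm) : (atom x).subst θ = atom (x.subst θ) := by
  simp only [atom, Tm.subst_app, Tm.subst_const]

@[simp] theorem subst_tt : (tt : Tm Γ prp).subst θ = tt := rfl

@[simp] theorem subst_conj (b c : Tm Γ prp) :
    (conj b c).subst θ = conj (b.subst θ) (c.subst θ) := by
  simp only [conj, Tm.subst_app, Tm.subst_const]

@[simp] theorem subst_impl (x : Tm Γ atm) (b : Tm Γ prp) :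
    (impl x b).subst θ = impl (x.subst θ) (b.subst θ) := by
  simp only [impl, Tm.subst_app, Tm.subst_const]

@[simp] theorem subst_forallI (b : Tm Γ (ι →ₜ prp)) :
    (forallI b).subst θ = forallI (b.subst θ) := by
  simp only [forallI, Tm.subst_app, Tm.subst_const]

@[simp] theorem subst_abs (r : Tm Γ (ι →ₜ ι)) : (abs r).subst θ = abs (r.subst θ) := by
  simp only [abs, Tm.subst_app, Tm.subst_const]

@[simp] theorem subst_app (m n : Tm Γ ι) : (app m n).subst θ = app (m.subst θ) (n.subst θ) := by
  simp only [FOLDN.app, Tm.subst_app, Tm.subst_const]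

@[simp] theorem subst_arr (m n : Tm Γ ι) : (arr m n).subst θ = arr (m.subst θ) (n.subst θ) := by
  simp only [arr, Tm.subst_app, Tm.subst_const]

@[simp] theorem subst_typeof (m n : Tm Γ ι) :
    (typeof m n).subst θ = typeof (m.subst θ) (n.subst θ) := by
  simp only [typeof, Tm.subst_app, Tm.subst_const]

@[simp] theorem subst_natsem (m n : Tm Γ ι) :
    (natsem m n).subst θ = natsem (m.subst θ) (n.subst θ) := by
  simp only [natsem, Tm.subst_app, Tm.subst_const]

@[simp] theorem subst_transone (m n : Tm Γ ι) :
    (transone m n).subst θ = transone (m.subst θ) (n.subst θ) := by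
  simp only [transone, Tm.subst_app, Tm.subst_const]

@[simp] theorem subst_transsem (m n : Tm Γ ι) :
    (transsem m n).subst θ = transsem (m.subst θ) (n.subst θ) := by
  simp only [transsem, Tm.subst_app, Tm.subst_const]

@[simp] theorem wk_subst_cons {a b : Ty} (t : Tm Γ a) (u : Tm Δ b) :
    (t.wk).subst (Subst.cons u θ) = t.subst θ := by
  rw [Tm.wk_eq_subst, Tm.subst_subst, Subst.weak_comp_cons]

theorem wk_subst_lift {a b : Ty} (t : Tm Γ a) :
    (t.wk : Tm (b :: Γ) a).subst θ.lift = (t.subst θ).wk := by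
  rw [Tm.wk_eq_subst, Tm.wk_eq_subst, Tm.subst_subst, Tm.subst_subst, Subst.weak_comp_lift]

@[simp] theorem lift_z {b : Ty} : (θ.lift : Subst (b :: Γ) (b :: Δ)) b .z = .var .z := rfl

@[simp] theorem lift_s {a b : Ty} (x : Var Γ a) :
    (θ.lift : Subst (b :: Γ) (b :: Δ)) a (.s x) = (θ a x).wk := rfl

@[simp] theorem subst_nat (t : Tm Γ nt) : (Form.nat t).subst θ = .nat (t.subst θ) := rfl

@[simp] theorem subst_element (x : Tm Γ atm) (l : Tm Γ atmlst) :
    (element x l).subst θ = element (x.subst θ) (l.subst θ) := rfl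

@[simp] theorem subst_seq (t : Tm Γ nt) (l : Tm Γ atmlst) (b : Tm Γ prp) :
    (seq t l b).subst θ = seq (t.subst θ) (l.subst θ) (b.subst θ) := rfl

@[simp] theorem subst_prog (x : Tm Γ atm) (b : Tm Γ prp) :
    (prog x b).subst θ = prog (x.subst θ) (b.subst θ) := rfl

@[simp] theorem subst_same (m n : Tm Γ ι) :
    (same m n).subst θ = same (m.subst θ) (n.subst θ) := rfl

@[simp] theorem subst_prvv (l : Tm Γ atmlst) (b : Tm Γ prp) :
    (prvv l b).subst θ = prvv (l.subst θ) (b.subst θ) := by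
  simp only [prvv, Form.subst, subst_seq, wk_subst_lift, Tm.subst_var, lift_z]

@[simp] theorem subst_prv (x : Tm Γ atm) : (prv x).subst θ = prv (x.subst θ) := by
  simp only [prv, subst_prvv, subst_nil, subst_atom]

end

section
variable {D : Definition} {Δ : Ctx} (w : Stage D) (θ : Subst Δ w.ctx)

@[simp] theorem sat_element (x : Tm Δ atm) (l : Tm Δ atmlst) :
    Sat (element x l) w θ ↔ w ⊩ element (x.subst θ) (l.subst θ) := Iff.rfl

@[simp] theorem sat_seq (t : Tm Δ nt) (l : Tm Δ atmlst) (b : Tm Δ prp) :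
    Sat (seq t l b) w θ ↔ w ⊩ seq (t.subst θ) (l.subst θ) (b.subst θ) := Iff.rfl

@[simp] theorem sat_same (m n : Tm Δ ι) :
    Sat (same m n) w θ ↔ w ⊩ same (m.subst θ) (n.subst θ) := Iff.rfl

@[simp] theorem sat_prv (x : Tm Δ atm) : Sat (prv x) w θ ↔ w ⊩ prv (x.subst θ) := by
  rw [← subst_prv]
  exact Iff.rfl

end

/-! ## Induction -/

/-- Induction for a property `P` of the terms at all stages that is expressed by the formula `B`.
The case of `zero` is part of `step`, where the induction hypothesis is then void. -/
theorem nat_induction {D : Definition} {P : ∀ w : Stage D, Tm w.ctx nt → Prop} (B : Form [nt])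
    (hB : ∀ (w : Stage D) (j : Tm w.ctx nt), Sat B w (Subst.cons j Subst.empty) ↔ P w j)
    (step : ∀ (w : Stage D) (j : Tm w.ctx nt),
      (∀ (w' : Stage D) (e : w.Hom w') (i : Tm w'.ctx nt), j.subst e.θ = succ i →
        (w' ⊩ .nat i) ∧ P w' i) → P w j)
    {w : Stage D} {t : Tm w.ctx nt} (h : w ⊩ .nat t) : P w t := by
  have h_ind : w ⊩ (Form.nat v0 ∧ₘ B).subst (Subst.cons t Subst.empty) := by
    refine h.nat_induction _ (fun w => ?_) fun w j hj => ?_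
    · refine Forces.of_sat fun w' e => ?_
      rw [Subst.cons_comp, subst_zero, Subst.empty_comp, sat_and, hB, sat_nat, Tm.subst_var,
        Subst.cons_z]
      exact ⟨Der.natR_zero, step _ _ fun _ _ i hi =>
        absurd ((subst_zero _).symm.trans hi).symm (succ_ne_zero i)⟩
    · have hj_sat (w' : Stage D) (e : w.Hom w') :
          (w' ⊩ .nat (j.subst e.θ)) ∧ P w' (j.subst e.θ) := by
        have h := (hj.mono e).sat
        rwa [sat_subst, Subst.cons_comp, Subst.empty_comp, sat_and, hB, sat_nat, Tm.subst_var,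
          Subst.cons_z] at h
      refine Forces.of_sat fun w' e => ?_
      rw [Subst.cons_comp, subst_succ, Subst.empty_comp, sat_and, hB, sat_nat, Tm.subst_var,
        Subst.cons_z]
      refine ⟨Der.natR_succ (hj_sat w' e).1, step _ _ fun w'' e' i hi => ?_⟩
      rw [subst_succ, succ_inj, Tm.subst_subst] at hi
      exact hi ▸ hj_sat w'' (e.comp e')
  exact (hB w t).1 h_ind.sat.2

/-! ## Inversion of the definition -/

section
variable {D : Definition} {w : Stage D}

theorem Forces.prvv_intro {j : Tm w.ctx nt} {l : Tm w.ctx atmlst} {b : Tm w.ctx prp}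
    (hj : w ⊩ .nat j) (h : w ⊩ seq j l b) : w ⊩ prvv l b := by
  rw [← Form.subst_id (prvv l b)]
  refine Forces.ex_intro j ?_
  simp only [Form.subst, subst_seq, Tm.subst_var, Subst.cons_z, wk_subst_cons, Tm.subst_id]
  exact hj.and_intro h

theorem Forces.prvv_elim {l : Tm w.ctx atmlst} {b : Tm w.ctx prp} {C : Form w.ctx}
    (h : w ⊩ prvv l b)
    (k : ∀ (w' : Stage D) (e : w.Hom w') (j : Tm w'.ctx nt), (w' ⊩ .nat j) →
      (w' ⊩ seq j (l.subst e.θ) (b.subst e.θ)) → w' ⊩ C.subst e.θ) : w ⊩ C := by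
  refine Forces.ex_elim h fun w' e j hj => ?_
  simp only [Form.subst, subst_seq, Tm.subst_var, Subst.cons_z, wk_subst_cons] at hj
  exact k w' e j hj.and_left hj.and_right

theorem Forces.prv_elim {x : Tm w.ctx atm} {C : Form w.ctx} (h : w ⊩ prv x)
    (k : ∀ (w' : Stage D) (e : w.Hom w') (j : Tm w'.ctx nt), (w' ⊩ .nat j) →
      (w' ⊩ seq j nil (atom (x.subst e.θ))) → w' ⊩ C.subst e.θ) : w ⊩ C :=
  Forces.prvv_elim h fun w' e j hj hs => k w' e j hj (by rwa [subst_nil, subst_atom] at hs)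

end

/-- A stage in a derivation from the definition `lambdaDefinition`. -/
abbrev LambdaStage : Type := Stage lambdaDefinition

theorem forall_mem_clauses {P : Clause → Prop} : (∀ c ∈ lambdaDefinition.clauses, P c) ↔
    (∀ c ∈ clausesNat, P c) ∧ (∀ c ∈ clausesList, P c) ∧ (∀ c ∈ clausesIntuit, P c) ∧
      (∀ c ∈ clausesLambda, P c) ∧ P clauseSame := by
  simp only [lambdaDefinition, clausesAll, Set.mem_ofPred_eq, List.forall_mem_append,
    List.forall_mem_singleton, and_assoc]

theorem mem_clauses {c : Clause} : c ∈ lambdaDefinition.clauses ↔ c ∈ clausesNat ∨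
    c ∈ clausesList ∨ c ∈ clausesIntuit ∨ c ∈ clausesLambda ∨ c = clauseSame := by
  simp only [lambdaDefinition, clausesAll, Set.mem_ofPred_eq, List.mem_append, List.mem_singleton,
    or_assoc]

namespace Forces

variable {w : LambdaStage}

theorem same_refl (m : Tm w.ctx ι) : w ⊩ same m m := by
  have h : w ⊩ _ := def_intro (c := clauseSame) (by simp [mem_clauses])
    (Subst.cons m Subst.empty) .topR
  simpa [clauseSame, Args.subst, same] using h

theorem same_elim {m n : Tm w.ctx ι} {C : Form w.ctx} (h : w ⊩ same m n)
    (k : ∀ (w' : LambdaStage) (e : w.Hom w'), m.subst e.θ = n.subst e.θ → w' ⊩ C.subst e.θ) :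
    w ⊩ C := by
  refine def_elim [clauseSame] ?_ h fun w' e => ?_
  · rw [forall_mem_clauses]
    simp [clausesNat, clausesList, clausesIntuit, clausesLambda]
  simp only [clauseSame, List.mem_cons, List.not_mem_nil, or_false, Args.subst, Form.pred.injEq,
    and_imp, forall_eq, heq_eq_eq, Tm.subst_var, Args.cons.injEq, and_true, forall_const]
  exact fun ρ hm hn _ => k w' e (hm.trans hn.symm)

theorem element_elim {x : Tm w.ctx atm} {l : Tm w.ctx atmlst} {C : Form w.ctx}
    (h : w ⊩ element x l)
    (k : ∀ (w' : LambdaStage) (e : w.Hom w') (y : Tm w'.ctx atm) (l' : Tm w'.ctx atmlst),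
      l.subst e.θ = cons y l' → (x.subst e.θ = y ∨ w' ⊩ element (x.subst e.θ) l') →
      w' ⊩ C.subst e.θ) : w ⊩ C := by
  refine def_elim [⟨[atmlst, atm], .element, .two v1 (cons v1 v0), .top⟩,
    ⟨[atmlst, atm, atm], .element, .two v2 (cons v1 v0), element v2 v0⟩] ?_ h fun w' e => ?_
  · rw [forall_mem_clauses]
    simp [clausesNat, clausesList, clausesIntuit, clausesLambda, clauseSame]
  simp only [List.mem_cons, List.not_mem_nil, or_false, Args.subst, Form.pred.injEq, and_imp,
    forall_eq_or_imp, heq_eq_eq, Tm.subst_var, subst_cons, Args.cons.injEq, and_true, forall_const,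
    forall_eq, subst_element]
  refine ⟨fun ρ hx hl _ => k w' e _ _ hl (.inl hx), fun ρ hx hl hb => k w' e _ _ hl (.inr ?_)⟩
  rwa [hx]

theorem element_head (x : Tm w.ctx atm) (l : Tm w.ctx atmlst) : w ⊩ element x (cons x l) := by
  have h : w ⊩ _ := def_intro (c := ⟨[atmlst, atm], .element, .two v1 (cons v1 v0), .top⟩)
    (by simp [mem_clauses, clausesList]) (Subst.cons l (Subst.cons x Subst.empty)) .topR
  simpa [Args.subst, element] using h

theorem element_tail {x : Tm w.ctx atm} {l : Tm w.ctx atmlst} (y : Tm w.ctx atm)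
    (h : w ⊩ element x l) : w ⊩ element x (cons y l) := by
  have h : w ⊩ _ := def_intro
    (c := ⟨[atmlst, atm, atm], .element, .two v2 (cons v1 v0), element v2 v0⟩)
    (by simp [mem_clauses, clausesList])
    (Subst.cons l (Subst.cons y (Subst.cons x Subst.empty))) (by simpa using h)
  simpa [Args.subst, element] using h

end Forces

/-- The last step of a derivation of a sequent of the object logic. The index `i` bounds the
height of the derivation. -/
inductive SeqRule (w : LambdaStage) : Tm w.ctx nt → Tm w.ctx atmlst → Tm w.ctx prp → Prop
  | init (i : Tm w.ctx nt) (x' : Tm w.ctx atm) (l : Tm w.ctx atmlst) (x : Tm w.ctx atm) :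
      w ⊩ element x (cons x' l) → SeqRule w i (cons x' l) (atom x)
  | tt (i : Tm w.ctx nt) (l : Tm w.ctx atmlst) : SeqRule w i l tt
  | conj {i : Tm w.ctx nt} {l : Tm w.ctx atmlst} {b c : Tm w.ctx prp} :
      w ⊩ seq i l b → w ⊩ seq i l c → SeqRule w (succ i) l (conj b c)
  | impl {i : Tm w.ctx nt} {l : Tm w.ctx atmlst} {x : Tm w.ctx atm} {b : Tm w.ctx prp} :
      w ⊩ seq i (cons x l) b → SeqRule w (succ i) l (impl x b)
  | forallI {i : Tm w.ctx nt} {l : Tm w.ctx atmlst} {b : Tm w.ctx (ι →ₜ prp)} :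
      (∀ (w' : LambdaStage) (e : w.Hom w') (x : Tm w'.ctx ι),
        w' ⊩ seq (i.subst e.θ) (l.subst e.θ) (.app (b.subst e.θ) x)) →
      SeqRule w (succ i) l (forallI b)
  | prog {i : Tm w.ctx nt} {l : Tm w.ctx atmlst} {x : Tm w.ctx atm} {b : Tm w.ctx prp} :
      w ⊩ prog x b → w ⊩ seq i l b → SeqRule w (succ i) l (atom x)

theorem Forces.seq_elim {w : LambdaStage} {j : Tm w.ctx nt} {l : Tm w.ctx atmlst}
    {b : Tm w.ctx prp} {C : Form w.ctx} (h : w ⊩ seq j l b)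
    (k : ∀ (w' : LambdaStage) (e : w.Hom w'),
      SeqRule w' (j.subst e.θ) (l.subst e.θ) (b.subst e.θ) → w' ⊩ C.subst e.θ) : w ⊩ C := by
  refine def_elim clausesIntuit ?_ h fun w' e => ?_
  · rw [forall_mem_clauses]
    refine ⟨?_, ?_, fun c hc _ => hc, ?_, ?_⟩
    all_goals simp [clausesNat, clausesList, clausesLambda, clauseSame]
  simp only [clausesIntuit, List.mem_cons, List.not_mem_nil, or_false, Args.subst, Form.pred.injEq,
    and_imp, forall_eq_or_imp, heq_eq_eq, Tm.subst_var, subst_cons, subst_atom, Args.cons.injEq,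
    and_true, subst_element, forall_const, subst_tt, subst_succ, subst_conj, subst_impl, subst_seq,
    subst_forallI, forall_eq]
  refine ⟨fun ρ _ hl hb hx => k w' e ?_, fun ρ _ _ hb _ => k w' e ?_,
    fun ρ hj hl hb hs => k w' e ?_, fun ρ hj hl hb hs => k w' e ?_,
    fun ρ hj hl hb hs => k w' e ?_, fun ρ hj hl hb hs => hs.ex_elim fun w'' e' g hg => ?_⟩
  · rw [hl, hb]
    exact .init _ _ _ _ hx
  · rw [hb]
    exact .tt _ _
  · rw [hj, hl, hb]
    exact .conj (by simpa using hs.and_left) (by simpa using hs.and_right)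
  · rw [hj, hl, hb]
    exact .impl hs
  · rw [hj, hl, hb]
    refine .forallI fun w'' e' x => ?_
    have hx := hs.mono e'
    rw [Form.subst_subst] at hx
    simpa [Subst.comp] using hx.all_elim x
  · rw [Form.subst_subst] at hg ⊢
    refine k w'' (e.comp e') ?_
    simp only [Stage.Hom.comp_θ, ← Tm.subst_subst]
    rw [hj, hl, hb, subst_succ, subst_atom]
    refine .prog (b := g) ?_ ?_
    · simpa [Subst.comp] using hg.and_left
    · simpa [Subst.comp] using hg.and_right

theorem SeqRule.forces {w : LambdaStage} {j : Tm w.ctx nt} {l : Tm w.ctx atmlst}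
    {b : Tm w.ctx prp} (h : SeqRule w j l b) : w ⊩ seq j l b := by
  cases h with
  | init i x' l x h =>
    have h_seq : w ⊩ _ := .def_intro (c := ⟨[atm, atmlst, atm, nt], .seq,
      .three v3 (cons v2 v1) (atom v0), element v0 (cons v2 v1)⟩)
      (by simp [mem_clauses, clausesIntuit])
      (Subst.cons x (Subst.cons l (Subst.cons x' (Subst.cons j Subst.empty)))) (by simpa using h)
    simpa [Args.subst, seq] using h_seq
  | tt i l =>
    have h_seq : w ⊩ _ := .def_intro (c := ⟨[atmlst, nt], .seq, .three v1 v0 FOLDN.tt, .top⟩)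
      (by simp [mem_clauses, clausesIntuit]) (Subst.cons l (Subst.cons j Subst.empty)) .topR
    simpa [Args.subst, seq] using h_seq
  | @conj i l b c hb hc =>
    have h_seq : w ⊩ _ := .def_intro (c := ⟨[prp, prp, atmlst, nt], .seq,
      .three (succ v3) v2 (FOLDN.conj v1 v0), seq v3 v2 v1 ∧ₘ seq v3 v2 v0⟩)
      (by simp [mem_clauses, clausesIntuit])
      (Subst.cons c (Subst.cons b (Subst.cons l (Subst.cons i Subst.empty))))
      (by simpa [Form.subst] using hb.and_intro hc)
    simpa [Args.subst, seq] using h_seq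
  | @impl i l x b h =>
    have h_seq : w ⊩ _ := .def_intro (c := ⟨[prp, atm, atmlst, nt], .seq,
      .three (succ v3) v2 (FOLDN.impl v1 v0), seq v3 (cons v1 v2) v0⟩)
      (by simp [mem_clauses, clausesIntuit])
      (Subst.cons b (Subst.cons x (Subst.cons l (Subst.cons i Subst.empty)))) (by simpa using h)
    simpa [Args.subst, seq] using h_seq
  | @forallI i l b h =>
    have h_seq : w ⊩ _ := .def_intro (c := ⟨[ι →ₜ prp, atmlst, nt], .seq,
      .three (succ v2) v1 (FOLDN.forallI v0), .all ι (seq v3 v2 (.app v1 v0))⟩)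
      (by simp [mem_clauses, clausesIntuit])
      (Subst.cons b (Subst.cons l (Subst.cons i Subst.empty)))
      (.of_sat fun w' e => by simpa using h w' e)
    simpa [Args.subst, seq] using h_seq
  | @prog i l x b hx hb =>
    have h_seq : w ⊩ _ := .def_intro (c := ⟨[atm, atmlst, nt], .seq,
      .three (succ v2) v1 (atom v0), .ex prp (FOLDN.prog v1 v0 ∧ₘ seq v3 v2 v0)⟩)
      (by simp [mem_clauses, clausesIntuit])
      (Subst.cons x (Subst.cons l (Subst.cons i Subst.empty)))
      (.ex_intro b (by simpa [Form.subst] using hx.and_intro hb))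
    simpa [Args.subst, seq] using h_seq

/-- The clauses for typing and evaluation: `ProgClause x b` if the atom `x` follows from the
goal `b`. -/
inductive ProgClause {Γ : Ctx} : Tm Γ atm → Tm Γ prp → Prop
  | typeof_abs (r : Tm Γ (ι →ₜ ι)) (t u : Tm Γ ι) : ProgClause (typeof (abs r) (arr t u))
      (forallI (.lam (impl (typeof v0 t.wk) (atom (typeof (.app r.wk v0) u.wk)))))
  | typeof_app (m n t u : Tm Γ ι) : ProgClause (typeof (app m n) t)
      (conj (atom (typeof m (arr u t))) (atom (typeof n u)))
  | natsem_abs (r : Tm Γ (ι →ₜ ι)) : ProgClause (natsem (abs r) (abs r)) tt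
  | natsem_app (m n v : Tm Γ ι) (r : Tm Γ (ι →ₜ ι)) : ProgClause (natsem (app m n) v)
      (conj (atom (natsem m (abs r))) (atom (natsem (.app r n) v)))
  | transone_beta (r : Tm Γ (ι →ₜ ι)) (m : Tm Γ ι) :
      ProgClause (transone (app (abs r) m) (.app r m)) tt
  | transone_app (m n m' : Tm Γ ι) :
      ProgClause (transone (app m n) (app m' n)) (atom (transone m m'))
  | transsem_refl (m : Tm Γ ι) : ProgClause (transsem m m) tt
  | transsem_step (m n m' : Tm Γ ι) :
      ProgClause (transsem m n) (conj (atom (transone m m')) (atom (transsem m' n)))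

theorem Forces.prog_elim {w : LambdaStage} {x : Tm w.ctx atm} {b : Tm w.ctx prp} {C : Form w.ctx}
    (h : w ⊩ prog x b) (k : ∀ (w' : LambdaStage) (e : w.Hom w'),
      ProgClause (x.subst e.θ) (b.subst e.θ) → w' ⊩ C.subst e.θ) : w ⊩ C := by
  refine def_elim clausesLambda ?_ h fun w' e c hc ρ heq hb => k w' e ?_
  · rw [forall_mem_clauses]
    refine ⟨?_, ?_, ?_, fun c hc _ => hc, ?_⟩
    all_goals simp [clausesNat, clausesList, clausesIntuit, clauseSame]
  simp only [clausesLambda, List.mem_cons, List.not_mem_nil, or_false] at hc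
  rcases hc with rfl | rfl | rfl | rfl | rfl | rfl | rfl | rfl
  all_goals
    simp only [Args.subst, subst_typeof, subst_natsem, subst_transone, subst_transsem, subst_abs,
      subst_app, subst_arr, subst_forallI, subst_impl, subst_conj, subst_atom, subst_tt,
      Tm.subst_var, Tm.subst_lam, Tm.subst_app, lift_z, lift_s, Form.pred.injEq, heq_eq_eq,
      Args.cons.injEq, and_true, true_and] at heq
    rw [heq.1, heq.2]
    constructor

theorem Forces.prog_intro {w : LambdaStage} {c : Clause} (ρ : Subst c.vars w.ctx)
    (hc : c ∈ clausesLambda) : w ⊩ .pred c.pred (c.args.subst ρ) := by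
  have h_body : ∀ c ∈ clausesLambda, c.body = .top := by simp [clausesLambda]
  refine def_intro (by simp [mem_clauses, hc]) ρ ?_
  rw [h_body c hc]
  exact .topR

theorem ProgClause.forces {w : LambdaStage} {x : Tm w.ctx atm} {b : Tm w.ctx prp}
    (h : ProgClause x b) : w ⊩ prog x b := by
  cases h with
  | typeof_abs r t u =>
    simpa [Args.subst, prog] using Forces.prog_intro
      (c := ⟨[ι, ι, ι →ₜ ι], .prog, .two (typeof (abs v2) (arr v1 v0))
        (forallI (.lam (impl (typeof v0 v2) (atom (typeof (.app v3 v0) v1))))), .top⟩)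
      (Subst.cons u (Subst.cons t (Subst.cons r Subst.empty))) (by simp [clausesLambda])
  | typeof_app m n t u =>
    simpa [Args.subst, prog] using Forces.prog_intro
      (c := ⟨[ι, ι, ι, ι], .prog, .two (typeof (app v3 v2) v1)
        (conj (atom (typeof v3 (arr v0 v1))) (atom (typeof v2 v0))), .top⟩)
      (Subst.cons u (Subst.cons t (Subst.cons n (Subst.cons m Subst.empty))))
      (by simp [clausesLambda])
  | natsem_abs r =>
    simpa [Args.subst, prog] using Forces.prog_intro
      (c := ⟨[ι →ₜ ι], .prog, .two (natsem (abs v0) (abs v0)) tt, .top⟩)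
      (Subst.cons r Subst.empty) (by simp [clausesLambda])
  | natsem_app m n v r =>
    simpa [Args.subst, prog] using Forces.prog_intro
      (c := ⟨[ι →ₜ ι, ι, ι, ι], .prog, .two (natsem (app v3 v2) v1)
        (conj (atom (natsem v3 (abs v0))) (atom (natsem (.app v0 v2) v1))), .top⟩)
      (Subst.cons r (Subst.cons v (Subst.cons n (Subst.cons m Subst.empty))))
      (by simp [clausesLambda])
  | transone_beta r m =>
    simpa [Args.subst, prog] using Forces.prog_intro
      (c := ⟨[ι, ι →ₜ ι], .prog, .two (transone (app (abs v1) v0) (.app v1 v0)) tt, .top⟩)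
      (Subst.cons m (Subst.cons r Subst.empty)) (by simp [clausesLambda])
  | transone_app m n m' =>
    simpa [Args.subst, prog] using Forces.prog_intro
      (c := ⟨[ι, ι, ι], .prog,
        .two (transone (app v2 v1) (app v0 v1)) (atom (transone v2 v0)), .top⟩)
      (Subst.cons m' (Subst.cons n (Subst.cons m Subst.empty))) (by simp [clausesLambda])
  | transsem_refl m =>
    simpa [Args.subst, prog] using Forces.prog_intro
      (c := ⟨[ι], .prog, .two (transsem v0 v0) tt, .top⟩)
      (Subst.cons m Subst.empty) (by simp [clausesLambda])
  | transsem_step m n m' =>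
    simpa [Args.subst, prog] using Forces.prog_intro
      (c := ⟨[ι, ι, ι], .prog, .two (transsem v2 v1)
        (conj (atom (transone v2 v0)) (atom (transsem v0 v1))), .top⟩)
      (Subst.cons m' (Subst.cons n (Subst.cons m Subst.empty))) (by simp [clausesLambda])

/-! ## Structural properties of the object logic -/

section
variable {w : LambdaStage}

theorem seq_of_element {x : Tm w.ctx atm} {l : Tm w.ctx atmlst} (j : Tm w.ctx nt)
    (h : w ⊩ element x l) : w ⊩ seq j l (atom x) := by
  refine h.element_elim fun w' e y l' hl _ => ?_
  have hx := h.mono e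
  rw [subst_element, hl] at hx
  rw [subst_seq, subst_atom, hl]
  exact (SeqRule.init _ _ _ _ hx).forces

theorem element_cons_elim {x y : Tm w.ctx atm} {l : Tm w.ctx atmlst} {C : Form w.ctx}
    (h : w ⊩ element x (cons y l))
    (k : ∀ (w' : LambdaStage) (e : w.Hom w'),
      (x.subst e.θ = y.subst e.θ ∨ w' ⊩ element (x.subst e.θ) (l.subst e.θ)) →
      w' ⊩ C.subst e.θ) : w ⊩ C := by
  refine h.element_elim fun w' e z l' hl hx => k w' e ?_
  rw [subst_cons, cons_inj] at hl
  rwa [hl.1, hl.2]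

theorem element_nil_elim {x : Tm w.ctx atm} (h : w ⊩ element x nil) (C : Form w.ctx) : w ⊩ C :=
  h.element_elim fun _ _ _ _ hl _ => absurd hl.symm (cons_ne_nil _ _)

end

/-- A relation `rel` between contexts along which derivations of height `j` are turned into
derivations of height `k`. The field `pred` supplies the induction hypothesis. -/
structure Simulation (w₀ : LambdaStage) (j k : Tm w₀.ctx nt) where
  rel : ∀ {w : LambdaStage}, w₀.Hom w → Tm w.ctx atmlst → Tm w.ctx atmlst → Prop
  mono : ∀ {w w' : LambdaStage} {e : w₀.Hom w} (e' : w.Hom w') {l l' : Tm w.ctx atmlst},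
    rel e l l' → rel (e.comp e') (l.subst e'.θ) (l'.subst e'.θ)
  cons : ∀ {w : LambdaStage} {e : w₀.Hom w} (x : Tm w.ctx atm) {l l' : Tm w.ctx atmlst},
    rel e l l' → rel e (cons x l) (cons x l')
  of_element : ∀ {w : LambdaStage} {e : w₀.Hom w} {x : Tm w.ctx atm} {l l' : Tm w.ctx atmlst},
    rel e l l' → w ⊩ element x l → w ⊩ seq (k.subst e.θ) l' (atom x)
  pred : ∀ {w : LambdaStage} (e : w₀.Hom w) {i : Tm w.ctx nt}, j.subst e.θ = succ i →
    ∃ i' : Tm w.ctx nt, k.subst e.θ = succ i' ∧ ∀ (l l' : Tm w.ctx atmlst) (b : Tm w.ctx prp),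
      rel e l l' → w ⊩ seq i l b → w ⊩ seq i' l' b

namespace Simulation

variable {w₀ : LambdaStage} {j k : Tm w₀.ctx nt} (S : Simulation w₀ j k)
include S

theorem seq_of_rule {w : LambdaStage} {e : w₀.Hom w} {l l' : Tm w.ctx atmlst} {b : Tm w.ctx prp}
    (hl : S.rel e l l') (h : SeqRule w (j.subst e.θ) l b) : w ⊩ seq (k.subst e.θ) l' b := by
  generalize hj : j.subst e.θ = j' at h
  cases h with
  | init _ _ _ _ hx => exact S.of_element hl hx
  | tt => exact (SeqRule.tt _ _).forces
  | conj hb hc =>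
    obtain ⟨i', hk, h_pred⟩ := S.pred e hj
    rw [hk]
    exact (SeqRule.conj (h_pred _ _ _ hl hb) (h_pred _ _ _ hl hc)).forces
  | impl hb =>
    obtain ⟨i', hk, h_pred⟩ := S.pred e hj
    rw [hk]
    exact (SeqRule.impl (h_pred _ _ _ (S.cons _ hl) hb)).forces
  | forallI hb =>
    obtain ⟨i', hk, -⟩ := S.pred e hj
    rw [hk]
    refine (SeqRule.forallI fun w' e' x => ?_).forces
    obtain ⟨i'', hk', h_pred⟩ := S.pred (e.comp e') (by
      rw [Stage.Hom.comp_θ, ← Tm.subst_subst, hj, subst_succ])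
    rw [Stage.Hom.comp_θ, ← Tm.subst_subst, hk, subst_succ, succ_inj] at hk'
    rw [hk']
    exact h_pred _ _ _ (S.mono e' hl) (hb w' e' x)
  | prog hx hb =>
    obtain ⟨i', hk, h_pred⟩ := S.pred e hj
    rw [hk]
    exact (SeqRule.prog hx (h_pred _ _ _ hl hb)).forces

theorem seq {l l' : Tm w₀.ctx atmlst} {b : Tm w₀.ctx prp} (hl : S.rel (.id w₀) l l')
    (h : w₀ ⊩ FOLDN.seq j l b) : w₀ ⊩ FOLDN.seq k l' b := by
  refine h.seq_elim fun w e h_rule => ?_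
  have h_seq := S.seq_of_rule (S.mono e hl) (b := b.subst e.θ)
  simp only [Stage.Hom.comp_θ, Stage.Hom.id_θ, Subst.id_comp] at h_seq
  exact h_seq h_rule

end Simulation

theorem seq_succ {w : LambdaStage} {j : Tm w.ctx nt} {l : Tm w.ctx atmlst} {b : Tm w.ctx prp}
    (hj : w ⊩ .nat j) (h : w ⊩ seq j l b) : w ⊩ seq (succ j) l b := by
  refine nat_induction (P := fun w j => ∀ (l : Tm w.ctx atmlst) (b : Tm w.ctx prp),
      (w ⊩ seq j l b) → w ⊩ seq (succ j) l b)
    (.all atmlst (.all prp (seq v2 v1 v0 ⊃ₘ seq (succ v2) v1 v0))) (fun w j => by simp)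
    (fun w j ih l b h => ?_) hj l b h
  exact Simulation.seq
    { rel := fun _ l l' => l = l'
      mono := fun _ _ _ hl => by rw [hl]
      cons := fun _ _ _ hl => by rw [hl]
      of_element := fun hl hx => hl ▸ seq_of_element _ hx
      pred := fun e i hi =>
        ⟨succ i, by rw [subst_succ, hi], fun l l' b hl hs => hl ▸ (ih _ e i hi).2 l b hs⟩ }
    rfl h

/-- Every element of the list `l` is an element of `l'`. -/
def included {Γ : Ctx} (l l' : Tm Γ atmlst) : Form Γ :=
  .all atm (element v0 l.wk ⊃ₘ element v0 l'.wk)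

@[simp] theorem subst_included {Γ Δ : Ctx} (θ : Subst Γ Δ) (l l' : Tm Γ atmlst) :
    (included l l').subst θ = included (l.subst θ) (l'.subst θ) := by
  simp only [included, Form.subst, subst_element, wk_subst_lift, Tm.subst_var, lift_z]

theorem forces_included {w : LambdaStage} {l l' : Tm w.ctx atmlst} :
    (w ⊩ included l l') ↔ ∀ (w' : LambdaStage) (e : w.Hom w') (x : Tm w'.ctx atm),
      (w' ⊩ element x (l.subst e.θ)) → w' ⊩ element x (l'.subst e.θ) := by
  rw [Forces.iff_sat]
  simp [included]

theorem Forces.element_of_included {w : LambdaStage} {l l' : Tm w.ctx atmlst} {x : Tm w.ctx atm}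
    (hx : w ⊩ element x l) (h : w ⊩ included l l') : w ⊩ element x l' := by
  simpa using forces_included.1 h w (.id w) x (by simpa using hx)

theorem included_cons {w : LambdaStage} (x : Tm w.ctx atm) (l : Tm w.ctx atmlst) :
    w ⊩ included l (cons x l) :=
  forces_included.2 fun _ _ _ hy => by rw [subst_cons]; exact hy.element_tail _

theorem Forces.included_cons_cons {w : LambdaStage} {l l' : Tm w.ctx atmlst}
    (h : w ⊩ included l l') (x : Tm w.ctx atm) : w ⊩ included (cons x l) (cons x l') := by
  refine forces_included.2 fun w' e y hy => ?_
  rw [subst_cons] at hy ⊢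
  refine element_cons_elim hy fun w'' e' hyx => ?_
  rw [subst_element, subst_cons]
  rcases hyx with hyx | hyl
  · rw [hyx]
    exact element_head _ _
  · refine (hyl.element_of_included ?_).element_tail _
    simpa using (h.mono e).mono e'

theorem seq_weaken {w : LambdaStage} {j : Tm w.ctx nt} {l l' : Tm w.ctx atmlst}
    {b : Tm w.ctx prp} (hj : w ⊩ .nat j) (hl : w ⊩ included l l') (h : w ⊩ seq j l b) :
    w ⊩ seq j l' b := by
  refine nat_induction (P := fun w j => ∀ (l l' : Tm w.ctx atmlst) (b : Tm w.ctx prp),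
      (w ⊩ included l l') → (w ⊩ seq j l b) → w ⊩ seq j l' b)
    (.all atmlst (.all atmlst (.all prp (included v2 v1 ⊃ₘ seq v3 v2 v0 ⊃ₘ seq v3 v1 v0))))
    (fun w j => by simp) (fun w j ih l l' b hl h => ?_) hj l l' b hl h
  exact Simulation.seq
    { rel := fun {w} _ l l' => w ⊩ included l l'
      mono := fun e' _ _ hl => by simpa using hl.mono e'
      cons := fun x _ _ hl => hl.included_cons_cons x
      of_element := fun hl hx => seq_of_element _ (hx.element_of_included hl)
      pred := fun e i hi => ⟨i, hi, (ih _ e i hi).2⟩ }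
    hl h

/-- Every element of the list `l` is derivable from `l'` with height `k`. -/
def entails {Γ : Ctx} (k : Tm Γ nt) (l l' : Tm Γ atmlst) : Form Γ :=
  .all atm (element v0 l.wk ⊃ₘ seq k.wk l'.wk (atom v0))

@[simp] theorem subst_entails {Γ Δ : Ctx} (θ : Subst Γ Δ) (k : Tm Γ nt) (l l' : Tm Γ atmlst) :
    (entails k l l').subst θ = entails (k.subst θ) (l.subst θ) (l'.subst θ) := by
  simp only [entails, Form.subst, subst_element, subst_seq, subst_atom, wk_subst_lift,
    Tm.subst_var, lift_z]

theorem forces_entails {w : LambdaStage} {k : Tm w.ctx nt} {l l' : Tm w.ctx atmlst} :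
    (w ⊩ entails k l l') ↔ ∀ (w' : LambdaStage) (e : w.Hom w') (x : Tm w'.ctx atm),
      (w' ⊩ element x (l.subst e.θ)) → w' ⊩ seq (k.subst e.θ) (l'.subst e.θ) (atom x) := by
  rw [Forces.iff_sat]
  simp [entails]

theorem Forces.seq_of_entails {w : LambdaStage} {k : Tm w.ctx nt} {l l' : Tm w.ctx atmlst}
    {x : Tm w.ctx atm} (hx : w ⊩ element x l) (h : w ⊩ entails k l l') :
    w ⊩ seq k l' (atom x) := by
  simpa using forces_entails.1 h w (.id w) x (by simpa using hx)

theorem entails_refl {w : LambdaStage} (k : Tm w.ctx nt) (l : Tm w.ctx atmlst) :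
    w ⊩ entails k l l :=
  forces_entails.2 fun _ _ _ hx => seq_of_element _ hx

theorem Forces.entails_cons_cons {w : LambdaStage} {k : Tm w.ctx nt} {l l' : Tm w.ctx atmlst}
    (h : w ⊩ entails k l l') (hk : w ⊩ .nat k) (x : Tm w.ctx atm) :
    w ⊩ entails k (cons x l) (cons x l') := by
  refine forces_entails.2 fun w' e y hy => ?_
  rw [subst_cons] at hy ⊢
  refine element_cons_elim hy fun w'' e' hyx => ?_
  rw [subst_seq, subst_cons, subst_atom]
  rcases hyx with hyx | hyl
  · rw [hyx]
    exact seq_of_element _ (element_head _ _)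
  · refine seq_weaken ((hk.mono e).mono e') (included_cons _ _) (hyl.seq_of_entails ?_)
    simpa using (h.mono e).mono e'

theorem entails_singleton {w : LambdaStage} {k : Tm w.ctx nt} {x : Tm w.ctx atm}
    {l : Tm w.ctx atmlst} (hx : w ⊩ seq k l (atom x)) : w ⊩ entails k (cons x nil) l := by
  refine forces_entails.2 fun w' e y hy => ?_
  rw [subst_cons, subst_nil] at hy
  refine element_cons_elim hy fun w'' e' hyx => ?_
  rcases hyx with hyx | hy_nil
  · simpa [hyx] using (hx.mono e).mono e'
  · exact element_nil_elim hy_nil _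

/-- `k` bounds the heights of the derivations obtained by cutting derivations of height `i` into
derivations of height `j`. It is uniform in the sequents because in the rule for `forallI` the
bound for the premise must not depend on the eigenvariable. -/
def cutBound {Γ : Ctx} (j i k : Tm Γ nt) : Form Γ :=
  .nat k ∧ₘ
    .all atmlst (.all prp (seq i.wk.wk v1 v0 ⊃ₘ seq k.wk.wk v1 v0)) ∧ₘ
    .all atmlst (.all atmlst (.all prp
      (entails i.wk.wk.wk v2 v1 ⊃ₘ seq j.wk.wk.wk v2 v0 ⊃ₘ seq k.wk.wk.wk v1 v0)))

@[simp] theorem sat_cutBound {Δ : Ctx} {w : LambdaStage} (θ : Subst Δ w.ctx) (j i k : Tm Δ nt) :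
    Sat (cutBound j i k) w θ ↔ (w ⊩ .nat (k.subst θ)) ∧
      (∀ (l : Tm w.ctx atmlst) (b : Tm w.ctx prp),
        (w ⊩ seq (i.subst θ) l b) → w ⊩ seq (k.subst θ) l b) ∧
      (∀ (l l' : Tm w.ctx atmlst) (b : Tm w.ctx prp), (w ⊩ entails (i.subst θ) l l') →
        (w ⊩ seq (j.subst θ) l b) → w ⊩ seq (k.subst θ) l' b) := by
  simp [cutBound]

@[simp] theorem subst_cutBound {Γ Δ : Ctx} (θ : Subst Γ Δ) (j i k : Tm Γ nt) :
    (cutBound j i k).subst θ = cutBound (j.subst θ) (i.subst θ) (k.subst θ) := by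
  simp only [cutBound, Form.subst, subst_seq, subst_entails, wk_subst_lift, Tm.subst_var, lift_z,
    lift_s]
  rfl

theorem Forces.cutBound_elim {w : LambdaStage} {j i k : Tm w.ctx nt}
    (h : w ⊩ cutBound j i k) :
    (w ⊩ .nat k) ∧
      (∀ (l : Tm w.ctx atmlst) (b : Tm w.ctx prp), (w ⊩ seq i l b) → w ⊩ seq k l b) ∧
      (∀ (l l' : Tm w.ctx atmlst) (b : Tm w.ctx prp), (w ⊩ entails i l l') →
        (w ⊩ seq j l b) → w ⊩ seq k l' b) := by
  simpa using Forces.iff_sat.1 h w (.id w)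

theorem seq_cut_zero {w : LambdaStage} {i : Tm w.ctx nt} {l l' : Tm w.ctx atmlst}
    {b : Tm w.ctx prp} (hi : w ⊩ .nat i) (hl : w ⊩ entails i l l') (h : w ⊩ seq zero l b) :
    w ⊩ seq i l' b :=
  Simulation.seq
    { rel := fun {w} e l l' => w ⊩ entails (i.subst e.θ) l l'
      mono := fun e' _ _ hl => by simpa [Tm.subst_subst] using hl.mono e'
      cons := fun {_ e} x _ _ hl => hl.entails_cons_cons (hi.mono e) x
      of_element := fun hl hx => hx.seq_of_entails hl
      pred := fun _ _ hi => absurd hi.symm (succ_ne_zero _) }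
    (by simpa using hl) h

theorem seq_cut_succ {w : LambdaStage} {j i k : Tm w.ctx nt} {l l' : Tm w.ctx atmlst}
    {b : Tm w.ctx prp} (hi : w ⊩ .nat i) (hk : w ⊩ cutBound j i k) (hl : w ⊩ entails i l l')
    (h : w ⊩ seq (succ j) l b) : w ⊩ seq (succ k) l' b := by
  have hk' {w' : LambdaStage} (e : w.Hom w') :
      w' ⊩ cutBound (j.subst e.θ) (i.subst e.θ) (k.subst e.θ) := by simpa using hk.mono e
  exact Simulation.seq
    { rel := fun {w} e l l' => w ⊩ entails (i.subst e.θ) l l'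
      mono := fun e' _ _ hl => by simpa [Tm.subst_subst] using hl.mono e'
      cons := fun {_ e} x _ _ hl => hl.entails_cons_cons (hi.mono e) x
      of_element := fun {_ e _ _ _} hl hx => by
        obtain ⟨hk_nat, h_lift, -⟩ := (hk' e).cutBound_elim
        rw [subst_succ]
        exact seq_succ hk_nat (h_lift _ _ (hx.seq_of_entails hl))
      pred := fun e i' hj => ⟨k.subst e.θ, subst_succ _ _, fun l l' b hl hs => by
        rw [subst_succ, succ_inj] at hj
        exact (hk' e).cutBound_elim.2.2 l l' b hl (hj ▸ hs)⟩ }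
    (by simpa using hl) h

theorem cutBound_zero {w : LambdaStage} {i : Tm w.ctx nt} (hi : w ⊩ .nat i) :
    w ⊩ cutBound zero i i := by
  rw [Forces.iff_sat]
  intro w' e
  rw [sat_cutBound]
  exact ⟨hi.mono e, fun _ _ h => h, fun _ _ _ => seq_cut_zero (hi.mono e)⟩

theorem Forces.cutBound_succ {w : LambdaStage} {j i k : Tm w.ctx nt} (h : w ⊩ cutBound j i k)
    (hi : w ⊩ .nat i) : w ⊩ cutBound (succ j) i (succ k) := by
  rw [Forces.iff_sat]
  intro w' e
  have he : w' ⊩ cutBound (j.subst e.θ) (i.subst e.θ) (k.subst e.θ) := by simpa using h.mono e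
  obtain ⟨hk, h_lift, -⟩ := he.cutBound_elim
  rw [sat_cutBound, subst_succ, subst_succ]
  exact ⟨Der.natR_succ hk, fun l b hs => seq_succ hk (h_lift l b hs),
    fun _ _ _ => seq_cut_succ (hi.mono e) he⟩

theorem Forces.cutBound_cases {w : LambdaStage} {j i : Tm w.ctx nt} {C : Form w.ctx}
    (hj : w ⊩ .nat j) (hi : w ⊩ .nat i)
    (h : ∀ (w' : LambdaStage) (e : w.Hom w') (k : Tm w'.ctx nt),
      (w' ⊩ cutBound (j.subst e.θ) (i.subst e.θ) k) → w' ⊩ C.subst e.θ) : w ⊩ C := by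
  have h_ex : w ⊩ (Form.all nt (.nat v0 ⊃ₘ .ex nt (cutBound v2 v1 v0))).subst
      (Subst.cons j Subst.empty) := by
    refine hj.nat_induction _ (fun w => ?_) fun w j ih => ?_
    · refine .of_sat fun w' e i hi => ?_
      exact .ex_intro i (by simpa using cutBound_zero hi)
    · refine .of_sat fun w' e i hi => ?_
      have ih_e := ih.mono e
      rw [Form.subst_subst] at ih_e
      refine .ex_elim ((ih_e.all_elim i).imp_elim hi) fun w'' e' k hk => ?_
      have hi' : w'' ⊩ .nat (i.subst e'.θ) := by simpa using hi.mono e'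
      have hk' : w'' ⊩ cutBound ((j.subst e.θ).subst e'.θ) (i.subst e'.θ) k := by
        simpa [Tm.subst_subst] using hk
      rw [Form.subst_subst]
      exact .ex_intro (succ k) (by simpa using hk'.cutBound_succ hi')
  have hi_ex := (h_ex.all_elim i).imp_elim (by simpa using hi)
  exact hi_ex.ex_elim fun w' e k hk => h w' e k (by simpa using hk)

section
variable {w : LambdaStage}

theorem prvv_tt (l : Tm w.ctx atmlst) : w ⊩ prvv l tt :=
  Forces.prvv_intro Der.natR_zero (SeqRule.tt _ _).forces

theorem prvv_conj {l : Tm w.ctx atmlst} {b c : Tm w.ctx prp} (hb : w ⊩ prvv l b)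
    (hc : w ⊩ prvv l c) : w ⊩ prvv l (conj b c) := by
  refine hb.prvv_elim fun w₁ e₁ j hj hb => ?_
  have hc₁ : w₁ ⊩ prvv (l.subst e₁.θ) (c.subst e₁.θ) := by simpa using hc.mono e₁
  rw [subst_prvv, subst_conj]
  refine hc₁.prvv_elim fun w₂ e₂ i hi hc => ?_
  rw [subst_prvv, subst_conj]
  refine Forces.cutBound_cases (hj.mono e₂) hi fun w₃ e₃ k hk => ?_
  obtain ⟨hk_nat, h_lift, h_cut⟩ := hk.cutBound_elim
  have hb₃ := h_cut _ _ _ (entails_refl _ _) ((hb.mono e₂).mono e₃)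
  have hc₃ := h_lift _ _ (hc.mono e₃)
  rw [subst_prvv, subst_conj]
  exact .prvv_intro (Der.natR_succ hk_nat) (SeqRule.conj hb₃ hc₃).forces

theorem prv_of_progClause {x : Tm w.ctx atm} {b : Tm w.ctx prp} (hx : ProgClause x b)
    (h : w ⊩ prvv nil b) : w ⊩ prv x := by
  refine h.prvv_elim fun w' e j hj hb => ?_
  rw [subst_prv]
  exact .prvv_intro (Der.natR_succ hj) (SeqRule.prog (hx.forces.mono e) hb).forces

theorem prv_cut {x y : Tm w.ctx atm} (h : w ⊩ prvv (cons x nil) (atom y)) (hx : w ⊩ prv x) :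
    w ⊩ prv y := by
  refine h.prvv_elim fun w₁ e₁ j hj h => ?_
  have hx₁ : w₁ ⊩ prv (x.subst e₁.θ) := by simpa using hx.mono e₁
  rw [subst_prv]
  refine hx₁.prv_elim fun w₂ e₂ i hi hx => ?_
  rw [subst_prv]
  refine Forces.cutBound_cases (hj.mono e₂) hi fun w₃ e₃ k hk => ?_
  obtain ⟨hk_nat, -, h_cut⟩ := hk.cutBound_elim
  have hx₃ := (entails_singleton hx).mono e₃
  have h₃ := (h.mono e₂).mono e₃
  simp only [subst_entails, subst_seq, subst_cons, subst_nil, subst_atom] at hx₃ h₃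
  rw [subst_prv]
  exact .prvv_intro hk_nat (h_cut _ _ _ hx₃ h₃)

end

/-! ## Inversion and rule induction for provable atoms -/

section
variable {w : LambdaStage}

theorem Forces.eq_refl (j : Tm w.ctx nt) : w ⊩ .pred .eq (.two j j) := by
  have h : w ⊩ _ := def_intro (c := ⟨[nt], .eq, .two v0 v0, .top⟩)
    (by simp [mem_clauses, clausesNat]) (Subst.cons j Subst.empty) .topR
  simpa [Args.subst] using h

theorem Forces.eq_elim {i j : Tm w.ctx nt} {C : Form w.ctx} (h : w ⊩ .pred .eq (.two i j))
    (k : ∀ (w' : LambdaStage) (e : w.Hom w'), i.subst e.θ = j.subst e.θ → w' ⊩ C.subst e.θ) :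
    w ⊩ C := by
  refine def_elim [⟨[nt], .eq, .two v0 v0, .top⟩] ?_ h fun w' e => ?_
  · rw [forall_mem_clauses]
    simp [clausesNat, clausesList, clausesIntuit, clausesLambda, clauseSame]
  simp only [List.mem_cons, List.not_mem_nil, or_false, Args.subst, Form.pred.injEq, and_imp,
    forall_eq, heq_eq_eq, Tm.subst_var, Args.cons.injEq, and_true, forall_const]
  exact fun ρ hi hj _ => k w' e (hi.trans hj.symm)

theorem nat_pred {j : Tm w.ctx nt} (h : w ⊩ .nat (succ j)) : w ⊩ .nat j := by
  refine nat_induction (P := fun w i => ∀ j : Tm w.ctx nt,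
      (w ⊩ .pred .eq (.two i (succ j))) → w ⊩ .nat j)
    (.all nt (.pred .eq (.two v1 (succ v0)) ⊃ₘ .nat v0))
    (fun w j => by simp [Form.subst, Args.subst])
    (fun w i ih j hij => hij.eq_elim fun w' e hi => ?_) h j (.eq_refl _)
  rw [subst_succ] at hi
  exact (ih w' e _ hi).1

theorem SeqRule.conj_inv {j : Tm w.ctx nt} {l : Tm w.ctx atmlst} {b c : Tm w.ctx prp}
    (h : SeqRule w j l (FOLDN.conj b c)) : ∃ i, j = succ i ∧ (w ⊩ seq i l b) ∧ (w ⊩ seq i l c) := by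
  generalize hd : FOLDN.conj b c = d at h
  cases h with
  | conj hb hc =>
    rw [conj_inj] at hd
    exact ⟨_, rfl, hd.1 ▸ hb, hd.2 ▸ hc⟩
  | _ => exact absurd (congrArg Tm.head hd) (by simp)

theorem SeqRule.impl_inv {j : Tm w.ctx nt} {l : Tm w.ctx atmlst} {x : Tm w.ctx atm}
    {b : Tm w.ctx prp} (h : SeqRule w j l (FOLDN.impl x b)) :
    ∃ i, j = succ i ∧ (w ⊩ seq i (cons x l) b) := by
  generalize hd : FOLDN.impl x b = d at h
  cases h with
  | impl hb =>
    rw [impl_inj] at hd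
    exact ⟨_, rfl, by rwa [hd.1, hd.2]⟩
  | _ => exact absurd (congrArg Tm.head hd) (by simp)

theorem SeqRule.forallI_inv {j : Tm w.ctx nt} {l : Tm w.ctx atmlst} {b : Tm w.ctx (ι →ₜ prp)}
    (h : SeqRule w j l (FOLDN.forallI b)) (x : Tm w.ctx ι) :
    ∃ i, j = succ i ∧ (w ⊩ seq i l (.app b x)) := by
  generalize hd : FOLDN.forallI b = d at h
  cases h with
  | forallI hb =>
    rw [forallI_inj] at hd
    exact ⟨_, rfl, by simpa [hd] using hb w (.id w) x⟩
  | _ => exact absurd (congrArg Tm.head hd) (by simp)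

theorem SeqRule.atom_inv {j : Tm w.ctx nt} {x : Tm w.ctx atm} (h : SeqRule w j nil (atom x)) :
    ∃ i b, j = succ i ∧ (w ⊩ FOLDN.prog x b) ∧ (w ⊩ seq i nil b) := by
  generalize hl : nil = l, hd : atom x = d at h
  cases h with
  | init => exact absurd hl.symm (cons_ne_nil _ _)
  | prog hx hb =>
    rw [atom_inj] at hd
    exact ⟨_, _, rfl, hd ▸ hx, hl ▸ hb⟩
  | _ => exact absurd (congrArg Tm.head hd) (by simp)

theorem seq_conj_elim {j : Tm w.ctx nt} {l : Tm w.ctx atmlst} {b c : Tm w.ctx prp}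
    (hj : w ⊩ .nat j) (h : w ⊩ seq j l (conj b c)) : (w ⊩ seq j l b) ∧ (w ⊩ seq j l c) := by
  suffices h_and : w ⊩ seq j l b ∧ₘ seq j l c from ⟨h_and.and_left, h_and.and_right⟩
  refine h.seq_elim fun w' e h_rule => ?_
  rw [subst_conj] at h_rule
  obtain ⟨i, hi, hb, hc⟩ := h_rule.conj_inv
  have hj' := hj.mono e
  rw [subst_nat, hi] at hj'
  rw [Form.subst, subst_seq, subst_seq, hi]
  exact (seq_succ (nat_pred hj') hb).and_intro (seq_succ (nat_pred hj') hc)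

theorem prvv_conj_elim {l : Tm w.ctx atmlst} {b c : Tm w.ctx prp} (h : w ⊩ prvv l (conj b c)) :
    (w ⊩ prvv l b) ∧ (w ⊩ prvv l c) := by
  suffices h_and : w ⊩ prvv l b ∧ₘ prvv l c from ⟨h_and.and_left, h_and.and_right⟩
  refine h.prvv_elim fun w' e j hj h => ?_
  rw [subst_conj] at h
  obtain ⟨hb, hc⟩ := seq_conj_elim hj h
  rw [Form.subst, subst_prvv, subst_prvv]
  exact (Forces.prvv_intro hj hb).and_intro (.prvv_intro hj hc)

theorem Forces.prvv_cases {l : Tm w.ctx atmlst} {b : Tm w.ctx prp} {C : Form w.ctx}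
    (h : w ⊩ prvv l b)
    (k : ∀ (w' : LambdaStage) (e : w.Hom w') (j : Tm w'.ctx nt), (w' ⊩ .nat j) →
      SeqRule w' j (l.subst e.θ) (b.subst e.θ) → w' ⊩ C.subst e.θ) : w ⊩ C := by
  refine h.prvv_elim fun w₁ e₁ j hj h => h.seq_elim fun w₂ e₂ h_rule => ?_
  rw [Tm.subst_subst, Tm.subst_subst] at h_rule
  rw [Form.subst_subst]
  exact k w₂ (e₁.comp e₂) _ (hj.mono e₂) h_rule

theorem prvv_impl_elim {l : Tm w.ctx atmlst} {x : Tm w.ctx atm} {b : Tm w.ctx prp}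
    (h : w ⊩ prvv l (impl x b)) : w ⊩ prvv (cons x l) b := by
  refine h.prvv_cases fun w' e j hj h_rule => ?_
  rw [subst_impl] at h_rule
  obtain ⟨i, rfl, hb⟩ := h_rule.impl_inv
  rw [subst_prvv, subst_cons]
  exact .prvv_intro (nat_pred hj) hb

theorem prvv_forallI_elim {l : Tm w.ctx atmlst} {b : Tm w.ctx (ι →ₜ prp)}
    (h : w ⊩ prvv l (forallI b)) (x : Tm w.ctx ι) : w ⊩ prvv l (.app b x) := by
  refine h.prvv_cases fun w' e j hj h_rule => ?_
  rw [subst_forallI] at h_rule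
  obtain ⟨i, rfl, hb⟩ := h_rule.forallI_inv (x.subst e.θ)
  rw [subst_prvv, Tm.subst_app]
  exact .prvv_intro (nat_pred hj) hb

theorem Forces.seq_atom_elim {j : Tm w.ctx nt} {x : Tm w.ctx atm} {C : Form w.ctx}
    (h : w ⊩ seq j nil (atom x))
    (k : ∀ (w' : LambdaStage) (e : w.Hom w') (i : Tm w'.ctx nt) (b : Tm w'.ctx prp),
      j.subst e.θ = succ i → ProgClause (x.subst e.θ) b → (w' ⊩ seq i nil b) →
      w' ⊩ C.subst e.θ) : w ⊩ C := by
  refine h.seq_elim fun w₁ e₁ h_rule => ?_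
  rw [subst_nil, subst_atom] at h_rule
  obtain ⟨i, b, hi, hx, hb⟩ := h_rule.atom_inv
  refine hx.prog_elim fun w₂ e₂ h_clause => ?_
  rw [Tm.subst_subst] at h_clause
  rw [Form.subst_subst]
  refine k w₂ (e₁.comp e₂) (i.subst e₂.θ) _ ?_ h_clause ?_
  · rw [Stage.Hom.comp_θ, ← Tm.subst_subst, hi, subst_succ]
  · simpa only [subst_seq, subst_nil] using hb.mono e₂

theorem Forces.prv_cases {x : Tm w.ctx atm} {C : Form w.ctx} (h : w ⊩ prv x)
    (k : ∀ (w' : LambdaStage) (e : w.Hom w') (b : Tm w'.ctx prp),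
      ProgClause (x.subst e.θ) b → (w' ⊩ prvv nil b) → w' ⊩ C.subst e.θ) : w ⊩ C := by
  refine h.prv_elim fun w₁ e₁ j hj hs => hs.seq_atom_elim fun w₂ e₂ i b hi h_clause hb => ?_
  rw [Tm.subst_subst] at h_clause
  rw [Form.subst_subst]
  have hj₂ := hj.mono e₂
  rw [subst_nat, hi] at hj₂
  exact k w₂ (e₁.comp e₂) b h_clause (prvv_intro (nat_pred hj₂) hb)

end

section
variable {Γ : Ctx} {m n t v : Tm Γ ι} {b : Tm Γ prp}

theorem ProgClause.typeof_inv (h : ProgClause (typeof m t) b) :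
    (∃ r t₁ t₂, m = abs r ∧ t = arr t₁ t₂ ∧
      b = forallI (.lam (impl (typeof v0 t₁.wk) (atom (typeof (.app r.wk v0) t₂.wk))))) ∨
    ∃ m₁ m₂ u, m = app m₁ m₂ ∧
      b = conj (atom (typeof m₁ (arr u t))) (atom (typeof m₂ u)) := by
  generalize hx : typeof m t = x at h
  cases h with
  | typeof_abs r t₁ t₂ =>
    rw [typeof_inj] at hx
    exact .inl ⟨r, t₁, t₂, hx.1, hx.2, rfl⟩
  | typeof_app m₁ m₂ t' u =>
    rw [typeof_inj] at hx
    exact .inr ⟨m₁, m₂, u, hx.1, hx.2 ▸ rfl⟩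
  | _ => exact absurd (congrArg Tm.head hx) (by simp)

theorem ProgClause.natsem_inv (h : ProgClause (natsem m v) b) :
    (∃ r, m = abs r ∧ v = abs r) ∨
    ∃ m₁ m₂ r, m = app m₁ m₂ ∧
      b = conj (atom (natsem m₁ (abs r))) (atom (natsem (.app r m₂) v)) := by
  generalize hx : natsem m v = x at h
  cases h with
  | natsem_abs r => exact .inl ⟨r, natsem_inj.1 hx⟩
  | natsem_app m₁ m₂ v' r =>
    rw [natsem_inj] at hx
    exact .inr ⟨m₁, m₂, r, hx.1, hx.2 ▸ rfl⟩
  | _ => exact absurd (congrArg Tm.head hx) (by simp)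

theorem ProgClause.transone_inv (h : ProgClause (transone m n) b) :
    (∃ r m₂, m = app (abs r) m₂ ∧ n = .app r m₂) ∨
    ∃ m₁ m₂ n₁, m = app m₁ m₂ ∧ n = app n₁ m₂ ∧ b = atom (transone m₁ n₁) := by
  generalize hx : transone m n = x at h
  cases h with
  | transone_beta r m₂ => exact .inl ⟨r, m₂, transone_inj.1 hx⟩
  | transone_app m₁ m₂ n₁ =>
    rw [transone_inj] at hx
    exact .inr ⟨m₁, m₂, n₁, hx.1, hx.2, rfl⟩
  | _ => exact absurd (congrArg Tm.head hx) (by simp)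

theorem ProgClause.transsem_inv (h : ProgClause (transsem m n) b) :
    m = n ∨ ∃ m', b = conj (atom (transone m m')) (atom (transsem m' n)) := by
  generalize hx : transsem m n = x at h
  cases h with
  | transsem_refl m' =>
    rw [transsem_inj] at hx
    exact .inl (hx.1.trans hx.2.symm)
  | transsem_step m₁ n₁ m' =>
    rw [transsem_inj] at hx
    exact .inr ⟨m', by rw [hx.1, hx.2]⟩
  | _ => exact absurd (congrArg Tm.head hx) (by simp)

end

section
variable {w : LambdaStage}

theorem Forces.prv_natsem_app_elim {m n v : Tm w.ctx ι} {C : Form w.ctx}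
    (h : w ⊩ prv (natsem (app m n) v))
    (k : ∀ (w' : LambdaStage) (e : w.Hom w') (r : Tm w'.ctx (ι →ₜ ι)),
      (w' ⊩ prv (natsem (m.subst e.θ) (abs r))) →
      (w' ⊩ prv (natsem (.app r (n.subst e.θ)) (v.subst e.θ))) → w' ⊩ C.subst e.θ) : w ⊩ C := by
  refine h.prv_cases fun w' e b h_clause hb => ?_
  rw [subst_natsem, subst_app] at h_clause
  rcases h_clause.natsem_inv with ⟨r, hm, -⟩ | ⟨m₁, m₂, r, hm, rfl⟩
  · exact absurd hm (app_ne_abs _ _ _)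
  · rw [app_inj] at hm
    rw [← hm.1, ← hm.2] at hb
    exact k w' e r (prvv_conj_elim hb).1 (prvv_conj_elim hb).2

theorem Forces.prv_natsem_abs_elim {r : Tm w.ctx (ι →ₜ ι)} {v : Tm w.ctx ι} {C : Form w.ctx}
    (h : w ⊩ prv (natsem (abs r) v))
    (k : ∀ (w' : LambdaStage) (e : w.Hom w'), (abs r).subst e.θ = v.subst e.θ →
      w' ⊩ C.subst e.θ) : w ⊩ C := by
  refine h.prv_cases fun w' e b h_clause _ => k w' e ?_
  rw [subst_natsem] at h_clause
  rcases h_clause.natsem_inv with ⟨r', hm, hv⟩ | ⟨m₁, m₂, r', hm, -⟩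
  · exact hm.trans hv.symm
  · rw [subst_abs] at hm
    exact absurd hm.symm (app_ne_abs _ _ _)

theorem prv_transone_abs_absurd {r : Tm w.ctx (ι →ₜ ι)} {m : Tm w.ctx ι} {C : Form w.ctx}
    (h : w ⊩ prv (transone (abs r) m)) : w ⊩ C := by
  refine h.prv_cases fun w' e b h_clause _ => ?_
  rw [subst_transone, subst_abs] at h_clause
  rcases h_clause.transone_inv with ⟨r', m₂, hm, -⟩ | ⟨m₁, m₂, n₁, hm, -⟩ <;>
  exact absurd hm.symm (app_ne_abs _ _ _)

theorem Forces.prv_transone_app_elim {m n v : Tm w.ctx ι} {C : Form w.ctx}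
    (h : w ⊩ prv (transone (app m n) v))
    (k_beta : ∀ (w' : LambdaStage) (e : w.Hom w') (r : Tm w'.ctx (ι →ₜ ι)),
      m.subst e.θ = abs r → v.subst e.θ = .app r (n.subst e.θ) → w' ⊩ C.subst e.θ)
    (k_app : ∀ (w' : LambdaStage) (e : w.Hom w') (m' : Tm w'.ctx ι),
      v.subst e.θ = app m' (n.subst e.θ) → (w' ⊩ prv (transone (m.subst e.θ) m')) →
      w' ⊩ C.subst e.θ) : w ⊩ C := by
  refine h.prv_cases fun w' e b h_clause hb => ?_
  rw [subst_transone, subst_app] at h_clause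
  rcases h_clause.transone_inv with ⟨r, m₂, hm, hv⟩ | ⟨m₁, m₂, n₁, hm, hv, rfl⟩ <;>
  rw [app_inj] at hm
  · exact k_beta w' e r hm.1 (hm.2 ▸ hv)
  · exact k_app w' e n₁ (hm.2 ▸ hv) (hm.1 ▸ hb)

theorem Forces.prv_transsem_elim {m n : Tm w.ctx ι} {C : Form w.ctx} (h : w ⊩ prv (transsem m n))
    (k_refl : ∀ (w' : LambdaStage) (e : w.Hom w'), m.subst e.θ = n.subst e.θ → w' ⊩ C.subst e.θ)
    (k_step : ∀ (w' : LambdaStage) (e : w.Hom w') (m' : Tm w'.ctx ι),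
      (w' ⊩ prv (transone (m.subst e.θ) m')) → (w' ⊩ prv (transsem m' (n.subst e.θ))) →
      w' ⊩ C.subst e.θ) : w ⊩ C := by
  refine h.prv_cases fun w' e b h_clause hb => ?_
  rw [subst_transsem] at h_clause
  rcases h_clause.transsem_inv with hm | ⟨m', rfl⟩
  · exact k_refl w' e hm
  · exact k_step w' e m' (prvv_conj_elim hb).1 (prvv_conj_elim hb).2

theorem Forces.prv_typeof_app_elim {m n t : Tm w.ctx ι} {C : Form w.ctx}
    (h : w ⊩ prv (typeof (app m n) t))
    (k : ∀ (w' : LambdaStage) (e : w.Hom w') (u : Tm w'.ctx ι),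
      (w' ⊩ prv (typeof (m.subst e.θ) (arr u (t.subst e.θ)))) →
      (w' ⊩ prv (typeof (n.subst e.θ) u)) → w' ⊩ C.subst e.θ) : w ⊩ C := by
  refine h.prv_cases fun w' e b h_clause hb => ?_
  rw [subst_typeof, subst_app] at h_clause
  rcases h_clause.typeof_inv with ⟨r, t₁, t₂, hm, -⟩ | ⟨m₁, m₂, u, hm, rfl⟩
  · exact absurd hm (app_ne_abs _ _ _)
  · rw [app_inj] at hm
    rw [← hm.1, ← hm.2] at hb
    exact k w' e u (prvv_conj_elim hb).1 (prvv_conj_elim hb).2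

theorem prv_typeof_beta {r : Tm w.ctx (ι →ₜ ι)} {n t u : Tm w.ctx ι}
    (h : w ⊩ prv (typeof (abs r) (arr t u))) (hn : w ⊩ prv (typeof n t)) :
    w ⊩ prv (typeof (.app r n) u) := by
  refine h.prv_cases fun w' e b h_clause hb => ?_
  rw [subst_typeof, subst_abs, subst_arr] at h_clause
  rcases h_clause.typeof_inv with ⟨r', t₁, t₂, hr, ht, rfl⟩ | ⟨m₁, m₂, u', hm, -⟩
  · rw [abs_inj] at hr
    rw [arr_inj] at ht
    have h_body := prvv_forallI_elim hb (n.subst e.θ)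
    rw [← hr, ← ht.1, ← ht.2, Tm.app_lam] at h_body
    simp only [subst_impl, subst_atom, subst_typeof, Tm.subst_app, Tm.subst_var, Subst.cons_z,
      wk_subst_cons, Tm.subst_id] at h_body
    have hn' := hn.mono e
    simp only [subst_prv, subst_typeof, Tm.subst_app] at hn' ⊢
    exact prv_cut (prvv_impl_elim h_body) hn'
  · exact absurd hm.symm (app_ne_abs _ _ _)

end

theorem ProgClause.subst {Γ Δ : Ctx} {x : Tm Γ atm} {b : Tm Γ prp} (h : ProgClause x b)
    (θ : Subst Γ Δ) : ProgClause (x.subst θ) (b.subst θ) := by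
  cases h <;>
  simp only [subst_typeof, subst_natsem, subst_transone, subst_transsem, subst_abs, subst_app,
    subst_arr, subst_forallI, subst_impl, subst_conj, subst_atom, subst_tt, Tm.subst_var,
    Tm.subst_lam, Tm.subst_app, wk_subst_lift, lift_z] <;>
  constructor

/-- The induction hypothesis covers every derivation of height at most `i`, the height of the body
of the last clause, and not only the premises of that clause. -/
theorem prv_induction (q : Const (ι →ₜ ι →ₜ atm))
    {P : ∀ w : LambdaStage, Tm w.ctx ι → Tm w.ctx ι → Prop} (B : Form [ι, ι])
    (hB : ∀ (w : LambdaStage) (m n : Tm w.ctx ι),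
      Sat B w (Subst.cons n (Subst.cons m Subst.empty)) ↔ P w m n)
    (step : ∀ (w : LambdaStage) (m n : Tm w.ctx ι) (i : Tm w.ctx nt) (b : Tm w.ctx prp),
      (w ⊩ .nat i) → ProgClause (.app (.app (.const q) m) n) b → (w ⊩ seq i nil b) →
      (∀ (w' : LambdaStage) (e : w.Hom w') (m' n' : Tm w'.ctx ι),
        (w' ⊩ seq (i.subst e.θ) nil (atom (.app (.app (.const q) m') n'))) → P w' m' n') →
      P w m n)
    {w : LambdaStage} {m n : Tm w.ctx ι} (h : w ⊩ prv (.app (.app (.const q) m) n)) :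
    P w m n := by
  have h_seq (w : LambdaStage) (j : Tm w.ctx nt) (hj : w ⊩ .nat j) : ∀ m n : Tm w.ctx ι,
      (w ⊩ seq j nil (atom (.app (.app (.const q) m) n))) → P w m n := by
    refine nat_induction (P := fun w j => ∀ m n : Tm w.ctx ι,
        (w ⊩ seq j nil (atom (.app (.app (.const q) m) n))) → P w m n)
      (.all ι (.all ι (seq v2 nil (atom (.app (.app (.const q) v1) v0)) ⊃ₘ
        B.subst (Subst.cons v0 (Subst.cons v1 Subst.empty)))))
      (fun w j => by simp [sat_subst, Subst.cons_comp, Subst.empty_comp, hB])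
      (fun w j ih m n h => ?_) hj
    rw [← hB]
    refine (h.seq_atom_elim fun w₁ e₁ i b hi h_clause hb => ?_ :
      w ⊩ B.subst (Subst.cons n (Subst.cons m Subst.empty))).sat
    rw [Form.subst_subst]
    refine Forces.of_sat fun w₂ e₂ => ?_
    simp only [Subst.cons_comp, Subst.empty_comp, hB]
    have hi₂ : j.subst (e₁.comp e₂).θ = succ (i.subst e₂.θ) := by
      rw [Stage.Hom.comp_θ, ← Tm.subst_subst, hi, subst_succ]
    refine step w₂ _ _ (i.subst e₂.θ) (b.subst e₂.θ) (ih w₂ (e₁.comp e₂) _ hi₂).1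
      (by simpa using h_clause.subst e₂.θ) (by simpa using hb.mono e₂)
      fun w₃ e₃ m' n' h' => (ih w₃ ((e₁.comp e₂).comp e₃) _ ?_).2 m' n' h'
    rw [Stage.Hom.comp_θ, ← Tm.subst_subst, hi₂, subst_succ]
  rw [← hB]
  refine (h.prv_elim fun w₁ e₁ j hj hs => ?_ :
    w ⊩ B.subst (Subst.cons n (Subst.cons m Subst.empty))).sat
  rw [Form.subst_subst]
  refine Forces.of_sat fun w₂ e₂ => ?_
  simp only [Subst.cons_comp, Subst.empty_comp, hB]
  refine h_seq w₂ _ (hj.mono e₂) _ _ ?_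
  simpa using hs.mono e₂

section
variable {P : ∀ w : LambdaStage, Tm w.ctx ι → Tm w.ctx ι → Prop} (B : Form [ι, ι])
  (hB : ∀ (w : LambdaStage) (m n : Tm w.ctx ι),
    Sat B w (Subst.cons n (Subst.cons m Subst.empty)) ↔ P w m n)
include hB

theorem natsem_induction
    (h_abs : ∀ (w : LambdaStage) (r : Tm w.ctx (ι →ₜ ι)), P w (abs r) (abs r))
    (h_app : ∀ (w : LambdaStage) (m n v : Tm w.ctx ι) (r : Tm w.ctx (ι →ₜ ι)),
      (w ⊩ prv (natsem m (abs r))) → (w ⊩ prv (natsem (.app r n) v)) →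
      (∀ (w' : LambdaStage) (e : w.Hom w'), P w' (m.subst e.θ) (abs (r.subst e.θ))) →
      (∀ (w' : LambdaStage) (e : w.Hom w'),
        P w' (.app (r.subst e.θ) (n.subst e.θ)) (v.subst e.θ)) →
      P w (app m n) v)
    {w : LambdaStage} {m v : Tm w.ctx ι} (h : w ⊩ prv (natsem m v)) : P w m v := by
  refine prv_induction .natsem B hB (fun w m v i b hi h_clause hb ih => ?_) h
  rcases h_clause.natsem_inv with ⟨r, rfl, rfl⟩ | ⟨m, n, r, rfl, rfl⟩
  · exact h_abs w r
  · obtain ⟨hm, hv⟩ := seq_conj_elim hi hb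
    exact h_app w m n v r (.prvv_intro hi hm) (.prvv_intro hi hv)
      (fun w' e => ih w' e _ _ (by simpa [natsem] using hm.mono e))
      fun w' e => ih w' e _ _ (by simpa [natsem] using hv.mono e)

theorem transone_induction
    (h_beta : ∀ (w : LambdaStage) (r : Tm w.ctx (ι →ₜ ι)) (m : Tm w.ctx ι),
      P w (app (abs r) m) (.app r m))
    (h_app : ∀ (w : LambdaStage) (m n m' : Tm w.ctx ι), (w ⊩ prv (transone m m')) →
      (∀ (w' : LambdaStage) (e : w.Hom w'), P w' (m.subst e.θ) (m'.subst e.θ)) →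
      P w (app m n) (app m' n))
    {w : LambdaStage} {m m' : Tm w.ctx ι} (h : w ⊩ prv (transone m m')) : P w m m' := by
  refine prv_induction .transone B hB (fun w m m' i b hi h_clause hb ih => ?_) h
  rcases h_clause.transone_inv with ⟨r, n, rfl, rfl⟩ | ⟨m, n, m', rfl, rfl, rfl⟩
  · exact h_beta w r n
  · exact h_app w m n m' (.prvv_intro hi hb)
      fun w' e => ih w' e _ _ (by simpa [transone] using hb.mono e)

theorem transsem_induction (h_refl : ∀ (w : LambdaStage) (m : Tm w.ctx ι), P w m m)
    (h_step : ∀ (w : LambdaStage) (m m' n : Tm w.ctx ι), (w ⊩ prv (transone m m')) →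
      (w ⊩ prv (transsem m' n)) →
      (∀ (w' : LambdaStage) (e : w.Hom w'), P w' (m'.subst e.θ) (n.subst e.θ)) → P w m n)
    {w : LambdaStage} {m n : Tm w.ctx ι} (h : w ⊩ prv (transsem m n)) : P w m n := by
  refine prv_induction .transsem B hB (fun w m n i b hi h_clause hb ih => ?_) h
  rcases h_clause.transsem_inv with rfl | ⟨m', rfl⟩
  · exact h_refl w m
  · obtain ⟨hm, hn⟩ := seq_conj_elim hi hb
    exact h_step w m m' n (.prvv_intro hi hm) (.prvv_intro hi hn)
      fun w' e => ih w' e _ _ (by simpa [transsem] using hn.mono e)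

end

/-! ## Determinacy, equivalence of the semantics and subject reduction -/

section
variable {w : LambdaStage}

theorem natsem_det {m v₁ v₂ : Tm w.ctx ι} (h₁ : w ⊩ prv (natsem m v₁))
    (h₂ : w ⊩ prv (natsem m v₂)) : w ⊩ same v₁ v₂ := by
  refine natsem_induction
    (P := fun w m v₁ => ∀ v₂, (w ⊩ prv (natsem m v₂)) → w ⊩ same v₁ v₂)
    (.all ι (prv (natsem v2 v0) ⊃ₘ same v1 v0)) (fun w m v₁ => by simp)
    (fun w r v₂ h => ?_) (fun w m n v₁ r _ _ ih_m ih_v v₂ h => ?_) h₁ v₂ h₂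
  · refine h.prv_natsem_abs_elim fun w' e hv => ?_
    rw [subst_same, hv]
    exact .same_refl _
  · refine h.prv_natsem_app_elim fun w₁ e₁ r' hm hv => ?_
    refine (ih_m w₁ e₁ _ hm).same_elim fun w₂ e₂ hr => ?_
    rw [subst_abs, subst_abs, abs_inj, Tm.subst_subst] at hr
    rw [Form.subst_subst]
    refine ih_v w₂ (e₁.comp e₂) _ ?_
    simpa [← hr, Tm.subst_subst] using hv.mono e₂

theorem transone_det {m n₁ n₂ : Tm w.ctx ι} (h₁ : w ⊩ prv (transone m n₁))
    (h₂ : w ⊩ prv (transone m n₂)) : w ⊩ same n₁ n₂ := by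
  refine transone_induction
    (P := fun w m n₁ => ∀ n₂, (w ⊩ prv (transone m n₂)) → w ⊩ same n₁ n₂)
    (.all ι (prv (transone v2 v0) ⊃ₘ same v1 v0)) (fun w m n₁ => by simp)
    (fun w r n n₂ h => ?_) (fun w m n m' hm ih n₂ h => ?_) h₁ n₂ h₂
  · refine h.prv_transone_app_elim (fun w' e r' hr hn => ?_) fun w' e m' _ hm => ?_
    · rw [subst_abs, abs_inj] at hr
      rw [subst_same, Tm.subst_app, hn, hr]
      exact .same_refl _
    · rw [subst_abs] at hm
      exact prv_transone_abs_absurd hm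
  · refine h.prv_transone_app_elim (fun w' e r hr _ => ?_) fun w' e m'' hn hm' => ?_
    · have hm' := hm.mono e
      rw [subst_prv, subst_transone, hr] at hm'
      exact prv_transone_abs_absurd hm'
    · refine (ih w' e _ hm').same_elim fun w'' e' heq => ?_
      rw [subst_same, subst_app, hn, subst_same, subst_app, subst_app, heq]
      exact .same_refl _

theorem transsem_of_transsem_abs {m n : Tm w.ctx ι} {r : Tm w.ctx (ι →ₜ ι)}
    (hn : w ⊩ prv (transsem m n)) (hr : w ⊩ prv (transsem m (abs r))) :
    w ⊩ prv (transsem n (abs r)) := by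
  refine transsem_induction
    (P := fun w m n => ∀ r, (w ⊩ prv (transsem m (abs r))) → w ⊩ prv (transsem n (abs r)))
    (.all (ι →ₜ ι) (prv (transsem v2 (abs v0)) ⊃ₘ prv (transsem v1 (abs v0))))
    (fun w m n => by simp) (fun w m r h => h) (fun w m m' n hm _ ih r h => ?_) hn r hr
  refine h.prv_transsem_elim (fun w' e hm_abs => ?_) fun w₁ e₁ m'' hm'' hr => ?_
  · have hm' := hm.mono e
    rw [subst_prv, subst_transone, hm_abs, subst_abs] at hm'
    exact prv_transone_abs_absurd hm'
  · have hm₁ : w₁ ⊩ prv (transone (m.subst e₁.θ) (m'.subst e₁.θ)) := by simpa using hm.mono e₁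
    refine (transone_det hm₁ hm'').same_elim fun w₂ e₂ hm' => ?_
    have hr₂ := hr.mono e₂
    rw [subst_prv, subst_transsem, ← hm', Tm.subst_subst] at hr₂
    simpa [Tm.subst_subst] using ih w₂ (e₁.comp e₂) _ (by simpa [Tm.subst_subst] using hr₂)

theorem transsem_det {m : Tm w.ctx ι} {r₁ r₂ : Tm w.ctx (ι →ₜ ι)}
    (h₁ : w ⊩ prv (transsem m (abs r₁))) (h₂ : w ⊩ prv (transsem m (abs r₂))) :
    w ⊩ same (abs r₁) (abs r₂) := by
  refine (transsem_of_transsem_abs h₁ h₂).prv_transsem_elim (fun w' e hr => ?_)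
    fun w' e m' hm' _ => ?_
  · rw [subst_same, hr]
    exact .same_refl _
  · rw [subst_abs] at hm'
    exact prv_transone_abs_absurd hm'

theorem prv_typeof_app {m n t u : Tm w.ctx ι} (hm : w ⊩ prv (typeof m (arr u t)))
    (hn : w ⊩ prv (typeof n u)) : w ⊩ prv (typeof (app m n) t) :=
  prv_of_progClause (.typeof_app m n t u) (prvv_conj hm hn)

theorem prv_natsem_abs (r : Tm w.ctx (ι →ₜ ι)) : w ⊩ prv (natsem (abs r) (abs r)) :=
  prv_of_progClause (.natsem_abs r) (prvv_tt _)

theorem prv_natsem_app {m n v : Tm w.ctx ι} {r : Tm w.ctx (ι →ₜ ι)}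
    (hm : w ⊩ prv (natsem m (abs r))) (hv : w ⊩ prv (natsem (.app r n) v)) :
    w ⊩ prv (natsem (app m n) v) :=
  prv_of_progClause (.natsem_app m n v r) (prvv_conj hm hv)

theorem prv_transone_beta (r : Tm w.ctx (ι →ₜ ι)) (m : Tm w.ctx ι) :
    w ⊩ prv (transone (app (abs r) m) (.app r m)) :=
  prv_of_progClause (.transone_beta r m) (prvv_tt _)

theorem prv_transone_app {m m' : Tm w.ctx ι} (h : w ⊩ prv (transone m m')) (n : Tm w.ctx ι) :
    w ⊩ prv (transone (app m n) (app m' n)) :=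
  prv_of_progClause (.transone_app m n m') h

theorem prv_transsem_refl (m : Tm w.ctx ι) : w ⊩ prv (transsem m m) :=
  prv_of_progClause (.transsem_refl m) (prvv_tt _)

theorem prv_transsem_step {m m' n : Tm w.ctx ι} (hm : w ⊩ prv (transone m m'))
    (hn : w ⊩ prv (transsem m' n)) : w ⊩ prv (transsem m n) :=
  prv_of_progClause (.transsem_step m n m') (prvv_conj hm hn)

theorem prv_transsem_app {m m' n v : Tm w.ctx ι} (hm : w ⊩ prv (transsem m m'))
    (hv : w ⊩ prv (transsem (app m' n) v)) : w ⊩ prv (transsem (app m n) v) := by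
  refine transsem_induction
    (P := fun w m m' => ∀ n v, (w ⊩ prv (transsem (app m' n) v)) →
      w ⊩ prv (transsem (app m n) v))
    (.all ι (.all ι (prv (transsem (app v2 v1) v0) ⊃ₘ prv (transsem (app v3 v1) v0))))
    (fun w m n => by simp) (fun w m n v h => h) (fun w m m₁ m' hm _ ih n v h => ?_) hm n v hv
  exact prv_transsem_step (prv_transone_app hm n)
    (by simpa using ih w (.id w) n v (by simpa using h))

theorem transsem_of_natsem {m v : Tm w.ctx ι} (h : w ⊩ prv (natsem m v)) :
    w ⊩ prv (transsem m v) := by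
  refine natsem_induction (P := fun w m v => w ⊩ prv (transsem m v))
    (prv (transsem v1 v0)) (fun w m v => by simp)
    (fun w r => prv_transsem_refl _) (fun w m n v r _ _ ih_m ih_v => ?_) h
  have hm : w ⊩ prv (transsem m (abs r)) := by simpa using ih_m w (.id w)
  have hv : w ⊩ prv (transsem (.app r n) v) := by simpa using ih_v w (.id w)
  exact prv_transsem_app hm (prv_transsem_step (prv_transone_beta r n) hv)

theorem natsem_of_transone {m m' v : Tm w.ctx ι} (hm : w ⊩ prv (transone m m'))
    (hv : w ⊩ prv (natsem m' v)) : w ⊩ prv (natsem m v) := by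
  refine transone_induction
    (P := fun w m m' => ∀ v, (w ⊩ prv (natsem m' v)) → w ⊩ prv (natsem m v))
    (.all ι (prv (natsem v1 v0) ⊃ₘ prv (natsem v2 v0))) (fun w m m' => by simp)
    (fun w r n v h => prv_natsem_app (prv_natsem_abs r) h) (fun w m n m' _ ih v h => ?_) hm v hv
  refine h.prv_natsem_app_elim fun w' e r hm' hv => ?_
  rw [subst_prv, subst_natsem, subst_app]
  exact prv_natsem_app (ih w' e _ hm') hv

theorem natsem_of_transsem {m : Tm w.ctx ι} {r : Tm w.ctx (ι →ₜ ι)}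
    (h : w ⊩ prv (transsem m (abs r))) : w ⊩ prv (natsem m (abs r)) := by
  have h_natsem : ∀ v, (w ⊩ prv (natsem (abs r) v)) → w ⊩ prv (natsem m v) := by
    refine transsem_induction
      (P := fun w m n => ∀ v, (w ⊩ prv (natsem n v)) → w ⊩ prv (natsem m v))
      (.all ι (prv (natsem v1 v0) ⊃ₘ prv (natsem v2 v0))) (fun w m n => by simp)
      (fun w m v hv => hv) (fun w m m' n hm _ ih v hv => ?_) h
    exact natsem_of_transone hm (by simpa using ih w (.id w) v (by simpa using hv))
  exact h_natsem _ (prv_natsem_abs r)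

theorem natsem_typeof {m n t : Tm w.ctx ι} (h : w ⊩ prv (natsem m n))
    (ht : w ⊩ prv (typeof m t)) : w ⊩ prv (typeof n t) := by
  refine natsem_induction
    (P := fun w m n => ∀ t, (w ⊩ prv (typeof m t)) → w ⊩ prv (typeof n t))
    (.all ι (prv (typeof v2 v0) ⊃ₘ prv (typeof v1 v0))) (fun w m n => by simp)
    (fun w r t ht => ht) (fun w m n v r _ _ ih_m ih_v t ht => ?_) h t ht
  refine ht.prv_typeof_app_elim fun w' e u hm hn => ?_
  rw [subst_prv, subst_typeof]
  exact ih_v w' e _ (prv_typeof_beta (ih_m w' e _ hm) hn)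

theorem transone_typeof {m n t : Tm w.ctx ι} (h : w ⊩ prv (transone m n))
    (ht : w ⊩ prv (typeof m t)) : w ⊩ prv (typeof n t) := by
  refine transone_induction
    (P := fun w m n => ∀ t, (w ⊩ prv (typeof m t)) → w ⊩ prv (typeof n t))
    (.all ι (prv (typeof v2 v0) ⊃ₘ prv (typeof v1 v0))) (fun w m n => by simp)
    (fun w r n t ht => ?_) (fun w m n m' _ ih t ht => ?_) h t ht
  · refine ht.prv_typeof_app_elim fun w' e u hr hn => ?_
    rw [subst_abs] at hr
    simpa using prv_typeof_beta hr hn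
  · refine ht.prv_typeof_app_elim fun w' e u hm hn => ?_
    rw [subst_prv, subst_typeof, subst_app]
    exact prv_typeof_app (ih w' e _ hm) hn

theorem transsem_typeof {m n t : Tm w.ctx ι} (h : w ⊩ prv (transsem m n))
    (ht : w ⊩ prv (typeof m t)) : w ⊩ prv (typeof n t) := by
  refine transsem_induction
    (P := fun w m n => ∀ t, (w ⊩ prv (typeof m t)) → w ⊩ prv (typeof n t))
    (.all ι (prv (typeof v2 v0) ⊃ₘ prv (typeof v1 v0))) (fun w m n => by simp)
    (fun w m t ht => ht) (fun w m m' n hm _ ih t ht => ?_) h t ht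
  simpa using ih w (.id w) t (by simpa using transone_typeof hm ht)

end

end FOLDN

theorem mainTheorem5 :
    -- determinacy of semantics
    (FOLDN.Derivable FOLDN.lambdaDefinition FOLDN.natsemDet ∧
      FOLDN.Derivable FOLDN.lambdaDefinition FOLDN.transoneDet ∧
      FOLDN.Derivable FOLDN.lambdaDefinition FOLDN.transsemDet) ∧
    -- equivalence of semantics
    (FOLDN.Derivable FOLDN.lambdaDefinition FOLDN.natsemToTranssem ∧
      FOLDN.Derivable FOLDN.lambdaDefinition FOLDN.transsemToNatsem) ∧
    -- subject reduction
    (FOLDN.Derivable FOLDN.lambdaDefinition FOLDN.natsemSubjRed ∧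
      FOLDN.Derivable FOLDN.lambdaDefinition FOLDN.transoneSubjRed ∧
      FOLDN.Derivable FOLDN.lambdaDefinition FOLDN.transsemSubjRed) := by
  refine ⟨⟨?_, ?_, ?_⟩, ⟨?_, ?_⟩, ?_, ?_, ?_⟩ <;> refine FOLDN.derivable_of_sat fun w => ?_
  · simpa [FOLDN.natsemDet] using fun m m₁ m₂ => FOLDN.natsem_det
  · simpa [FOLDN.transoneDet] using fun m m₁ m₂ => FOLDN.transone_det
  · simpa [FOLDN.transsemDet] using fun m r₁ r₂ => FOLDN.transsem_det
  · simpa [FOLDN.natsemToTranssem] using fun m r => FOLDN.transsem_of_natsem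
  · simpa [FOLDN.transsemToNatsem] using fun m r => FOLDN.natsem_of_transsem
  · simpa [FOLDN.natsemSubjRed] using fun m n h t => FOLDN.natsem_typeof h
  · simpa [FOLDN.transoneSubjRed] using fun m n h t => FOLDN.transone_typeof h
  · simpa [FOLDN.transsemSubjRed] using fun m n h t => FOLDN.transsem_typeof h
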